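/- Let $n\ge 1$, $k\ge 3$ be integers and $\alpha\in(0,1)$. Let $B\subset\mathbb R^2$ be the open unit disc and let $X\in C^{k,\alpha}(\overline B,\mathbb R^{n+2})$ be a conformally parametrized immersion: $X_{u^1}(w),X_{u^2}(w)$ are linearly independent and $g_{11}=g_{22}>0$, $g_{12}=0$ at every $w\in\overline B$, where $g_{ij}=\langle X_{u^i},X_{u^j}\rangle$. Let $(g^{ij})$ be the inverse matrix of $(g_{ij})$ and $W=\sqrt{g_{11}g_{22}-g_{12}^2}$. A *weak normal frame* (of class $W^{1,2}(B)\cap L^\infty(B)$) is an $n$-tuple $N=(N_1,\dots,N_n)$ of maps $N_\sigma\in W^{1,2}(B,\mathbb R^{n+2})\cap L^\infty(B,\mathbb R^{n+2})$ such that for almost every $w\in B$ the vectors $N_1(w),\dots,N_n(w)$ are orthonormal, span the normal space $\{X_{u^1}(w),X_{u^2}(w)\}^\perp$, and satisfy $\det\big(X_{u^1},X_{u^2},N_1,\dots,N_n\big)(w)>0$. With the weak partial derivatives $N_{\sigma,u^i}$, its torsion coefficients and its total torsion are $$T_{\sigma,i}^\vartheta=\langle N_{\sigma,u^i},N_\vartheta\rangle,\qquad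 \mathcal T_X(N)=\sum_{i,j=1}^2\sum_{\sigma,\vartheta=1}^n\iint_B g^{ij}\,T_{\sigma,i}^\vartheta T_{\sigma,j}^\vartheta\,W\,du^1du^2 .$$ A *weak normal Coulomb frame* is a weak normal frame $N$ that is critical for $\mathcal T_X$, i.e. $$\lim_{\varepsilon\to0}\tfrac1\varepsilon\big\{\mathcal T_X(\widetilde N(\cdot,\varepsilon))-\mathcal T_X(N)\big\}=0,\qquad \widetilde N_\sigma(w,\varepsilon)=\sum_{\vartheta=1}^nR_\sigma^\vartheta(w,\varepsilon)N_\vartheta(w),$$ for every $\varepsilon_0>0$ and every family $R=(R_\sigma^\vartheta)\in C^2(\overline B\times(-\varepsilon_0,\varepsilon_0),SO(n))$ with $R(w,0)=\mathrm{id}$ on $\overline B$. Then there is a weak normal frame $N$ with $\mathcal T_X(N)\le\mathcal T_X(M)$ for all weak normal frames $M$ of class $W^{1,2}(B)\cap L^\infty(B)$, and $N$ is a weak normal Coulomb frame. In particular, its torsion coefficients belong to $L^2(B)$ and solve weakly the Euler–Lagrange system: for all $\sigma,\vartheta\in\{1,\dots,n\}$ and all $\varphi\in C^\infty(\overline B)$,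 $$\iint_B\big\{\varphi_{u^1}T_{\sigma,1}^\vartheta+\varphi_{u^2}T_{\sigma,2}^\vartheta\big\}\,du^1du^2=0 .$$ -/

import Mathlib

open MeasureTheory Set Filter Topology
open scoped NNReal ENNReal ContDiff

noncomputable section

namespace CoulombFrame

/-- The parameter plane with its Euclidean norm and Lebesgue measure. -/
abbrev Plane : Type := EuclideanSpace ℝ (Fin 2)

/-- The ambient Euclidean space `ℝ^(n+2)`. -/
abbrev Ambient (n : ℕ) : Type := EuclideanSpace ℝ (Fin (n + 2))

/-- The open unit disc `B`. -/
def disc : Set Plane := Metric.ball 0 1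

/-- The closure of the unit disc `B`. -/
def closedDisc : Set Plane := Metric.closedBall 0 1

/-- The `i`-th coordinate vector of the parameter plane. -/
def dir (i : Fin 2) : Plane := EuclideanSpace.single i 1

/-! ### Surfaces -/

/-- The Hölder class `C^{k,α}` on the closed unit disc: `f` is `C^k` up to the boundary and its
`k`-th derivative is Hölder continuous with exponent `α` on the closed disc. -/
def MemHolder {F : Type*} [NormedAddCommGroup F] [NormedSpace ℝ F]
    (k : ℕ) (α : ℝ≥0) (f : Plane → F) : Prop :=
  ContDiffOn ℝ k f closedDisc ∧
    ∃ C : ℝ≥0, HolderOnWith C α (iteratedFDerivWithin ℝ k f closedDisc) closedDisc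

/-- The classical partial derivative `X_{u^i}(w)` for `w` in the closed disc. -/
def tangent {n : ℕ} (X : Plane → Ambient n) (i : Fin 2) (w : Plane) : Ambient n :=
  fderivWithin ℝ X closedDisc w (dir i)

/-- The first fundamental form `g_{ij} = ⟨X_{u^i}, X_{u^j}⟩`. -/
def metric {n : ℕ} (X : Plane → Ambient n) (w : Plane) : Matrix (Fin 2) (Fin 2) ℝ :=
  Matrix.of fun i j => inner ℝ (tangent X i w) (tangent X j w)

/-- The area element `W = √(g₁₁ g₂₂ - g₁₂²)`. -/
def areaElement {n : ℕ} (X : Plane → Ambient n) (w : Plane) : ℝ :=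
  √(metric X w 0 0 * metric X w 1 1 - metric X w 0 1 ^ 2)

/-- `X` is a conformally parametrized immersion of disc type and of class `C^{k,α}` on the closed
disc. -/
structure IsConformalImmersion {n : ℕ} (k : ℕ) (α : ℝ≥0) (X : Plane → Ambient n) : Prop where
  regular : MemHolder k α X
  immersion : ∀ w ∈ closedDisc, LinearIndependent ℝ fun i => tangent X i w
  conformal : ∀ w ∈ closedDisc,
    metric X w 0 0 = metric X w 1 1 ∧ 0 < metric X w 0 0 ∧ metric X w 0 1 = 0

/-- The tangent space spanned by `X_u(w)` and `X_v(w)`. -/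
def tangentSpace {n : ℕ} (X : Plane → Ambient n) (w : Plane) : Submodule ℝ (Ambient n) :=
  Submodule.span ℝ (range fun i => tangent X i w)

/-- The normal space, the orthogonal complement of the tangent space. -/
def normalSpace {n : ℕ} (X : Plane → Ambient n) (w : Plane) : Submodule ℝ (Ambient n) :=
  (tangentSpace X w)ᗮ

/-! ### Sobolev functions on the disc -/

/-- `g` is the weak partial derivative of `f` in direction `u^i` on the open disc `B`. -/
def HasWeakPartial {F : Type*} [NormedAddCommGroup F] [NormedSpace ℝ F]
    (i : Fin 2) (f g : Plane → F) : Prop :=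
  LocallyIntegrableOn f disc ∧ LocallyIntegrableOn g disc ∧
    ∀ φ : Plane → ℝ, ContDiff ℝ ∞ φ → HasCompactSupport φ → tsupport φ ⊆ disc →
      ∫ w in disc, (fderiv ℝ φ w (dir i)) • f w = -∫ w in disc, φ w • g w

/-- Weak partial derivatives are unique up to null sets. -/
theorem HasWeakPartial.ae_eq {F : Type*} [NormedAddCommGroup F] [NormedSpace ℝ F]
    [CompleteSpace F] {i : Fin 2} {f g h : Plane → F}
    (hg : HasWeakPartial i f g) (hh : HasWeakPartial i f h) :
    ∀ᵐ w ∂(volume.restrict disc), g w = h w := by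
  have hB : IsOpen disc := Metric.isOpen_ball
  have key : ∀ᵐ w ∂(volume : Measure Plane), w ∈ disc → (g - h) w = 0 := by
    refine hB.ae_eq_zero_of_integral_contDiff_smul_eq_zero (hg.2.1.sub hh.2.1) ?_
    intro φ hφ hc hs
    have hint : ∀ k : Plane → F, LocallyIntegrableOn k disc →
        Integrable (fun w => φ w • k w) := fun k hk =>
      (integrableOn_iff_integrable_of_support_subset
        ((Function.support_smul_subset_left φ k).trans (subset_tsupport φ))).mp
        ((hk.integrableOn_compact_subset hs hc).continuousOn_smul hφ.continuous.continuousOn hc)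
    have hset : ∀ k : Plane → F, ∫ w in disc, φ w • k w = ∫ w, φ w • k w := fun k =>
      setIntegral_eq_integral_of_forall_compl_eq_zero fun w hw => by
        rw [image_eq_zero_of_notMem_tsupport fun h => hw (hs h), zero_smul]
    have e := (hg.2.2 φ hφ hc hs).symm.trans (hh.2.2 φ hφ hc hs)
    rw [hset, hset, neg_inj] at e
    simp only [Pi.sub_apply, smul_sub]
    rw [integral_sub (hint g hg.2.1) (hint h hh.2.1), e, sub_self]
  rw [ae_restrict_iff' hB.measurableSet]
  filter_upwards [key] with w hw hwB
  exact sub_eq_zero.mp (hw hwB)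

open Classical in
/-- The weak partial derivative of `f` in direction `u^i`, a representative of its class modulo
null sets (and `0` if there is no weak derivative). -/
def weakPartial {F : Type*} [NormedAddCommGroup F] [NormedSpace ℝ F]
    (i : Fin 2) (f : Plane → F) : Plane → F :=
  if h : ∃ g, HasWeakPartial i f g then h.choose else 0

/-- The Sobolev space `W^{1,2}(B)`. -/
def MemW12 {F : Type*} [NormedAddCommGroup F] [NormedSpace ℝ F] (f : Plane → F) : Prop :=
  MemLp f 2 (volume.restrict disc) ∧
    ∀ i : Fin 2, ∃ g, HasWeakPartial i f g ∧ MemLp g 2 (volume.restrict disc)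

/-! ### Weak normal frames and their total torsion -/

/-- The determinant of the square matrix with columns `X_u, X_v, N_1, …, N_n` at `w`. -/
def frameDet {n : ℕ} (X : Plane → Ambient n) (N : Fin n → Plane → Ambient n) (w : Plane) : ℝ :=
  (Matrix.of fun r c : Fin (n + 2) =>
    (Matrix.vecCons (tangent X 0 w) (Matrix.vecCons (tangent X 1 w) fun σ => N σ w) :
      Fin (n + 2) → Ambient n) c r).det

/-- `N = (N_1, …, N_n)` is a weak normal frame of class `W^{1,2}(B) ∩ L^∞(B)`: almost everywhere
in `B` its columns are orthonormal, span the normal space, and are positively oriented. -/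
structure IsWeakNormalFrame {n : ℕ} (X : Plane → Ambient n) (N : Fin n → Plane → Ambient n) :
    Prop where
  sobolev : ∀ σ, MemW12 (N σ)
  bounded : ∀ σ, MemLp (N σ) ∞ (volume.restrict disc)
  orthonormal : ∀ᵐ w ∂(volume.restrict disc), Orthonormal ℝ fun σ => N σ w
  spans : ∀ᵐ w ∂(volume.restrict disc),
    Submodule.span ℝ (range fun σ => N σ w) = normalSpace X w
  oriented : ∀ᵐ w ∂(volume.restrict disc), 0 < frameDet X N w

/-- The torsion coefficient `T_{σ,i}^ϑ = ⟨N_{σ,u^i}, N_ϑ⟩`. -/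
def torsion {n : ℕ} (N : Fin n → Plane → Ambient n) (σ ϑ : Fin n) (i : Fin 2) (w : Plane) : ℝ :=
  inner ℝ (weakPartial i (N σ) w) (N ϑ w)

/-- The functional of total torsion
`𝒯_X(N) = ∑_{i,j} ∑_{σ,ϑ} ∬_B g^{ij} T_{σ,i}^ϑ T_{σ,j}^ϑ W du dv`. -/
def totalTorsion {n : ℕ} (X : Plane → Ambient n) (N : Fin n → Plane → Ambient n) : ℝ :=
  ∑ i : Fin 2, ∑ j : Fin 2, ∑ σ : Fin n, ∑ ϑ : Fin n,
    ∫ w in disc, (metric X w)⁻¹ i j * torsion N σ ϑ i w * torsion N σ ϑ j w * areaElement X w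

/-- The rotated frame with entries `∑_ϑ R_σ^ϑ N_ϑ`. -/
def rotate {n : ℕ} (R : Plane → Matrix (Fin n) (Fin n) ℝ) (N : Fin n → Plane → Ambient n) :
    Fin n → Plane → Ambient n :=
  fun σ w => ∑ ϑ, R w σ ϑ • N ϑ w

/-- `R = R(w, ε)` is a one-parameter family of rotations of class `C²` on
`closedDisc × (-ε₀, ε₀)` with values in `SO(n)` and with `R(w, 0) = id`. -/
structure IsRotationFamily {n : ℕ} (ε₀ : ℝ) (R : Plane → ℝ → Matrix (Fin n) (Fin n) ℝ) :
    Prop where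
  contDiff : ∀ σ ϑ, ContDiffOn ℝ 2 (fun p : Plane × ℝ => R p.1 p.2 σ ϑ)
    (closedDisc ×ˢ Ioo (-ε₀) ε₀)
  special : ∀ w ∈ closedDisc, ∀ ε ∈ Ioo (-ε₀) ε₀,
    R w ε ∈ Matrix.specialOrthogonalGroup (Fin n) ℝ
  initial : ∀ w ∈ closedDisc, R w 0 = 1

/-- `N` is critical for the total torsion: the first variation vanishes along every one-parameter
family of rotations. -/
def IsCritical {n : ℕ} (X : Plane → Ambient n) (N : Fin n → Plane → Ambient n) : Prop :=
  ∀ (ε₀ : ℝ) (R : Plane → ℝ → Matrix (Fin n) (Fin n) ℝ), 0 < ε₀ → IsRotationFamily ε₀ R →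
    Tendsto (fun ε : ℝ => 1 / ε * (totalTorsion X (rotate (fun w => R w ε) N) - totalTorsion X N))
      (𝓝[≠] 0) (𝓝 0)

/-- A weak normal Coulomb frame is a weak normal frame that is critical for the total torsion. -/
structure IsWeakNormalCoulombFrame {n : ℕ} (X : Plane → Ambient n)
    (N : Fin n → Plane → Ambient n) : Prop where
  frame : IsWeakNormalFrame X N
  critical : IsCritical X N

/-- The torsion coefficients of `N` are weak solutions of the Euler–Lagrange system
`div (T_{σ,1}^ϑ, T_{σ,2}^ϑ) = 0` in `B` with vanishing normal component on `∂B`, tested with all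
functions that are smooth up to the boundary. -/
def SolvesWeakEulerLagrange {n : ℕ} (N : Fin n → Plane → Ambient n) : Prop :=
  ∀ (σ ϑ : Fin n),
    (∀ i : Fin 2, MemLp (torsion N σ ϑ i) 2 (volume.restrict disc)) ∧
    ∀ φ : Plane → ℝ, ContDiffOn ℝ ∞ φ closedDisc →
      ∫ w in disc, (fderiv ℝ φ w (dir 0) * torsion N σ ϑ 0 w
        + fderiv ℝ φ w (dir 1) * torsion N σ ϑ 1 w) = 0

end CoulombFrame

end

/-!
A weak normal frame of least total torsion is found by the direct method of the calculus of
variations.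

In conformal parameters `g^{ij} W = δ^{ij}`, so the total torsion is the energy `∑_{i,σ,ϑ} ∬_B
|T_{σ,i}^ϑ|²` (`totalTorsion_eq_sum`). The class of weak normal frames is not empty: projecting a
basis of the normal space at the centre onto the normal spaces along the radii, in small steps, and
orthonormalizing gives a frame that is `C¹` up to the boundary (`exists_weakNormalFrame`).

For a minimizing sequence, `∂_i N_σ` splits into its normal part, whose coordinates are the torsion
coefficients, and its tangential part, which is of order zero in `N_σ` because `⟨∂_i N_σ, X_{u^j}⟩
= -⟨N_σ, X_{u^i u^j}⟩`. Bounded energy therefore bounds the frames in `W^{1,2}(B)`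
(`exists_integral_gradient_bound`). By Rellich's theorem, proved here with mollifiers for functions
bounded in `L^∞(B)` (`exists_rellich_subseq`), a subsequence converges almost everywhere with
weakly convergent gradients. The pointwise constraints pass to the limit, and the torsion
coefficients converge weakly enough, as products of weakly and boundedly convergent factors, for
the energy to be lower semicontinuous (`exists_limit_frame`).

A rotation `R` changes the torsion matrices to `(∂_i R + R T_i) Rᵀ`, hence the energy by `∑_i ∬ 2
⟨∂_i R, R T_i⟩ + |∂_i R|²` (`totalTorsion_rotate`). Along a `C²` family with `R(·, 0) = id` the
quotient `∂_i R / ε` is bounded and converges, so the difference quotients of the energy converge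
(`tendsto_variation`), and at a minimizer their limit is zero (`isCritical_of_minimal`). Rotating
by the angle `ε φ` in the plane of the axes `σ` and `ϑ` turns this into the Euler–Lagrange system
(`solvesWeakEulerLagrange_of_critical`).
-/

noncomputable section

namespace CoulombFrame

/-! ### Mollification -/

theorem isOpen_disc : IsOpen disc := Metric.isOpen_ball

theorem measurableSet_disc : MeasurableSet disc := isOpen_disc.measurableSet

theorem disc_subset_closedDisc : disc ⊆ closedDisc := Metric.ball_subset_closedBall

instance isFiniteMeasure_restrict_disc : IsFiniteMeasure ((volume : Measure Plane).restrict disc) :=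
  ⟨by rw [Measure.restrict_apply_univ]; exact measure_ball_lt_top⟩

/-- The standard sequence of bump functions, supported in balls whose radii shrink to `0`. -/
def bump (m : ℕ) : ContDiffBump (0 : Plane) where
  rIn := 1 / (2 * (m + 1))
  rOut := 1 / (m + 1)
  rIn_pos := by positivity
  rIn_lt_rOut := by
    apply one_div_lt_one_div_of_lt
    · positivity
    · have : (0 : ℝ) < m + 1 := by positivity
      linarith

theorem tendsto_bump_rOut : Tendsto (fun m => (bump m).rOut) atTop (𝓝 0) :=
  tendsto_one_div_add_atTop_nhds_zero_nat

/-- The normalized mollification kernel. -/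
def kernel (m : ℕ) : Plane → ℝ := (bump m).normed volume

theorem kernel_contDiff (m : ℕ) : ContDiff ℝ ∞ (kernel m) := (bump m).contDiff_normed

theorem kernel_hasCompactSupport (m : ℕ) : HasCompactSupport (kernel m) :=
  (bump m).hasCompactSupport_normed

theorem kernel_nonneg (m : ℕ) (x : Plane) : 0 ≤ kernel m x := (bump m).nonneg_normed x

theorem kernel_integral (m : ℕ) : ∫ x, kernel m x = 1 := (bump m).integral_normed

theorem kernel_integrable (m : ℕ) : Integrable (kernel m) := (bump m).integrable_normed

theorem kernel_sub_comm (m : ℕ) (x y : Plane) : kernel m (x - y) = kernel m (y - x) := by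
  rw [← neg_sub y x]; exact (bump m).normed_neg _

theorem kernel_bounded (m : ℕ) : ∃ C, ∀ x, ‖kernel m x‖ ≤ C :=
  (kernel_hasCompactSupport m).exists_bound_of_continuous (kernel_contDiff m).continuous

theorem kernel_eq_zero (m : ℕ) {x : Plane} (hx : (bump m).rOut ≤ ‖x‖) : kernel m x = 0 := by
  have : x ∉ Function.support (kernel m) := by
    rw [kernel, (bump m).support_normed_eq]
    simpa using hx
  simpa using this

/-- The mollification of the extension of `f|_B` by zero. -/
def moll (m : ℕ) (f : Plane → ℝ) (x : Plane) : ℝ := ∫ y in disc, kernel m (x - y) * f y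

theorem moll_eq_convolution (m : ℕ) (f : Plane → ℝ) :
    moll m f =
      convolution (kernel m) (disc.indicator f) (ContinuousLinearMap.lsmul ℝ ℝ) volume := by
  ext x
  rw [convolution_eq_swap, moll, ← integral_indicator measurableSet_disc]
  congr 1; ext y
  by_cases hy : y ∈ disc <;> simp [hy]

theorem locallyIntegrable_indicator {f : Plane → ℝ} (hf : IntegrableOn f disc) :
    LocallyIntegrable (disc.indicator f) :=
  (hf.integrable_indicator measurableSet_disc).locallyIntegrable

theorem moll_contDiff (m : ℕ) {f : Plane → ℝ} (hf : IntegrableOn f disc) :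
    ContDiff ℝ ∞ (moll m f) := by
  rw [moll_eq_convolution]
  exact (kernel_hasCompactSupport m).contDiff_convolution_left _ (kernel_contDiff m)
    (locallyIntegrable_indicator hf)

theorem ae_tendsto_moll {f : Plane → ℝ} (hf : IntegrableOn f disc) :
    ∀ᵐ x ∂(volume.restrict disc), Tendsto (fun m => moll m f x) atTop (𝓝 (f x)) := by
  have h := ContDiffBump.ae_convolution_tendsto_right_of_locallyIntegrable (φ := bump) (K := 2)
    tendsto_bump_rOut (Eventually.of_forall fun m => le_of_eq ?_) (locallyIntegrable_indicator hf)
  · filter_upwards [ae_restrict_of_ae h, ae_restrict_mem measurableSet_disc] with x hx hxd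
    simp only [moll_eq_convolution]
    simpa [hxd, kernel] using hx
  · simp only [bump]; field_simp

theorem kernel_mul_integrable (m : ℕ) {f : Plane → ℝ} (hf : IntegrableOn f disc) (x : Plane) :
    IntegrableOn (fun y => kernel m (x - y) * f y) disc := by
  obtain ⟨C, hC⟩ := kernel_bounded m
  refine hf.bdd_mul (c := C) ?_ (Eventually.of_forall fun y => hC _)
  exact ((kernel_contDiff m).continuous.comp (by fun_prop)).aestronglyMeasurable

theorem abs_moll_le (m : ℕ) {f : Plane → ℝ} {C : ℝ} (hC : 0 ≤ C)
    (hb : ∀ᵐ y ∂(volume.restrict disc), |f y| ≤ C) (x : Plane) : |moll m f x| ≤ C := by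
  have hk : Integrable (fun y => kernel m (x - y)) := (kernel_integrable m).comp_sub_left x
  calc |moll m f x| ≤ ∫ y in disc, kernel m (x - y) * C := by
        rw [moll, ← Real.norm_eq_abs]
        refine norm_integral_le_of_norm_le (hk.integrableOn.mul_const C) ?_
        filter_upwards [hb] with y hy
        rw [Real.norm_eq_abs, abs_mul, abs_of_nonneg (kernel_nonneg m (x - y))]
        exact mul_le_mul_of_nonneg_left hy (kernel_nonneg _ _)
    _ = (∫ y in disc, kernel m (x - y)) * C := integral_mul_const _ _
    _ ≤ (∫ y, kernel m (x - y)) * C := by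
        refine mul_le_mul_of_nonneg_right ?_ hC
        exact setIntegral_le_integral hk (Eventually.of_forall fun y => kernel_nonneg _ _)
    _ = C := by
        rw [integral_sub_left_eq_self (kernel m) volume x, kernel_integral, one_mul]

theorem moll_fderiv (m : ℕ) {i : Fin 2} {f g : Plane → ℝ} (h : HasWeakPartial i f g)
    (hf : IntegrableOn f disc) {x : Plane}
    (hx : Metric.closedBall x (bump m).rOut ⊆ disc) :
    fderiv ℝ (moll m f) x (dir i) = moll m g x := by
  have hk1 : ContDiff ℝ 1 (kernel m) := (kernel_contDiff m).of_le (by exact_mod_cast le_top)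
  have hcont : Continuous (fderiv ℝ (kernel m)) := hk1.continuous_fderiv (by norm_num)
  have hd := (kernel_hasCompactSupport m).hasFDerivAt_convolution_left
    (ContinuousLinearMap.lsmul ℝ ℝ) hk1 (locallyIntegrable_indicator hf) x
  rw [moll_eq_convolution, hd.fderiv, convolution_eq_swap]
  have hint : Integrable (fun t => ((ContinuousLinearMap.precompL Plane
      (ContinuousLinearMap.lsmul ℝ ℝ)) (fderiv ℝ (kernel m) (x - t))) (disc.indicator f t)) := by
    exact ((kernel_hasCompactSupport m).fderiv (𝕜 := ℝ)).convolutionExists_left _ hcont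
      (locallyIntegrable_indicator hf) x |>.integrable_swap
  rw [ContinuousLinearMap.integral_apply hint]
  have hψ : ContDiff ℝ ∞ (fun y => kernel m (x - y)) := (kernel_contDiff m).comp (by fun_prop)
  have hs : tsupport (fun y => kernel m (x - y)) ⊆ Metric.closedBall x (bump m).rOut := by
    refine closure_minimal ?_ Metric.isClosed_closedBall
    intro y hy
    by_contra hn
    refine hy (kernel_eq_zero m ?_)
    rw [Metric.mem_closedBall, dist_comm, dist_eq_norm, not_le] at hn
    exact hn.le
  have hc : HasCompactSupport (fun y => kernel m (x - y)) :=
    HasCompactSupport.of_support_subset_isCompact (isCompact_closedBall x (bump m).rOut)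
      ((subset_tsupport _).trans hs)
  have key := h.2.2 _ hψ hc (hs.trans hx)
  have hfd : ∀ y, fderiv ℝ (fun y => kernel m (x - y)) y (dir i)
      = - fderiv ℝ (kernel m) (x - y) (dir i) := by
    intro y
    have h1 : HasFDerivAt (fun y => kernel m (x - y))
        ((fderiv ℝ (kernel m) (x - y)).comp (-(ContinuousLinearMap.id ℝ Plane))) y :=
      ((hk1.differentiable (by norm_num)) _).hasFDerivAt.comp y ((hasFDerivAt_id y).const_sub x)
    rw [h1.fderiv]; simp
  simp only [hfd, smul_eq_mul, neg_mul, integral_neg, neg_inj] at key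
  rw [moll, ← key, ← integral_indicator measurableSet_disc]
  congr 1; ext y
  by_cases hy : y ∈ disc <;> simp [hy, ContinuousLinearMap.precompL_apply]

theorem moll_swap (m : ℕ) {a b : Plane → ℝ} (ha : IntegrableOn a disc) (hb : IntegrableOn b disc) :
    ∫ x in disc, a x * moll m b x = ∫ x in disc, moll m a x * b x := by
  have hI : Integrable (Function.uncurry fun x y => kernel m (x - y) * (a x * b y))
      ((volume.restrict disc).prod (volume.restrict disc)) := by
    obtain ⟨C, hC⟩ := kernel_bounded m
    refine (Integrable.mul_prod (μ := volume.restrict disc) (ν := volume.restrict disc)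
      ha hb).bdd_mul (c := C) ?_ (Eventually.of_forall fun y => hC _)
    exact ((kernel_contDiff m).continuous.comp (by fun_prop)).aestronglyMeasurable
  have := integral_integral_swap hI
  calc ∫ x in disc, a x * moll m b x
      = ∫ x in disc, ∫ y in disc, kernel m (x - y) * (a x * b y) := by
        congr 1; ext x
        rw [moll, ← integral_const_mul]
        congr 1; ext y; ring
    _ = ∫ y in disc, ∫ x in disc, kernel m (x - y) * (a x * b y) := this
    _ = ∫ x in disc, moll m a x * b x := by
        congr 1; ext x
        rw [moll, ← integral_mul_const]
        congr 1; ext y; rw [kernel_sub_comm]; ring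

/-! ### Weak derivatives and the product rule -/

theorem MemLp.integrableOn_disc {F : Type*} [NormedAddCommGroup F] {f : Plane → F} {p : ℝ≥0∞}
    (hf : MemLp f p (volume.restrict disc)) (hp : 1 ≤ p) : IntegrableOn f disc :=
  memLp_one_iff_integrable.mp (hf.mono_exponent hp)

theorem integrableOn_mul_of_memLp_two {f g : Plane → ℝ} (hf : MemLp f 2 (volume.restrict disc))
    (hg : MemLp g 2 (volume.restrict disc)) : IntegrableOn (fun w => f w * g w) disc :=
  hf.integrable_mul hg

/-- An essentially bounded function is bounded a.e. by a real constant. -/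
theorem MemLp.exists_ae_bound {F : Type*} [NormedAddCommGroup F] {f : Plane → F}
    (hf : MemLp f ∞ (volume.restrict disc)) :
    ∃ C : ℝ, 0 ≤ C ∧ ∀ᵐ w ∂(volume.restrict disc), ‖f w‖ ≤ C := by
  refine ⟨(eLpNorm f ∞ (volume.restrict disc)).toReal, ENNReal.toReal_nonneg, ?_⟩
  have h := hf.2.ne
  rw [eLpNorm_exponent_top] at h ⊢
  filter_upwards [ae_le_eLpNormEssSup (f := f) (μ := volume.restrict disc)] with w hw
  simpa using ENNReal.toReal_mono h hw

theorem tendsto_integral_moll_mul {a b : Plane → ℝ} (ha : MemLp a ∞ (volume.restrict disc))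
    (hb : IntegrableOn b disc) :
    Tendsto (fun m => ∫ w in disc, moll m a w * b w) atTop (𝓝 (∫ w in disc, a w * b w)) := by
  obtain ⟨C, hC, hbd⟩ := MemLp.exists_ae_bound ha
  have hi : IntegrableOn a disc := MemLp.integrableOn_disc ha le_top
  refine tendsto_integral_of_dominated_convergence (fun w => C * ‖b w‖) (fun m => ?_)
    (hb.norm.const_mul C) (fun m => Eventually.of_forall fun w => ?_) ?_
  · exact (moll_contDiff m hi).continuous.aestronglyMeasurable.mul hb.aestronglyMeasurable
  · rw [norm_mul]
    exact mul_le_mul_of_nonneg_right (abs_moll_le m hC hbd w) (norm_nonneg _)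
  · filter_upwards [ae_tendsto_moll hi] with w hw
    exact hw.mul_const _

theorem integrableOn_test_mul {f φ : Plane → ℝ} (hf : IntegrableOn f disc) (hφ : Continuous φ)
    (hc : HasCompactSupport φ) : IntegrableOn (fun w => φ w * f w) disc := by
  obtain ⟨C, hC⟩ := hc.exists_bound_of_continuous hφ
  exact hf.bdd_mul hφ.aestronglyMeasurable (Eventually.of_forall fun y => hC y)

theorem continuous_fderiv_dir {φ : Plane → ℝ} (hφ : ContDiff ℝ ∞ φ) (i : Fin 2) :
    Continuous (fun w => fderiv ℝ φ w (dir i)) :=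
  (hφ.continuous_fderiv (by simp)).clm_apply continuous_const

theorem hasCompactSupport_fderiv_dir {φ : Plane → ℝ} (hc : HasCompactSupport φ) (i : Fin 2) :
    HasCompactSupport (fun w => fderiv ℝ φ w (dir i)) :=
  hc.fderiv_apply (𝕜 := ℝ) (dir i)

/-- The product rule for bounded weakly differentiable functions. Testing the weak derivative of
`f` with `φ · (η_m * g)` gives the identity up to mollification, and moving the mollification off
`∂_i g` by Fubini only bounded functions are mollified when `m → ∞`. -/
theorem HasWeakPartial.mul {i : Fin 2} {f g f' g' : Plane → ℝ}
    (hf : HasWeakPartial i f f') (hg : HasWeakPartial i g g')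
    (hfb : MemLp f ∞ (volume.restrict disc)) (hgb : MemLp g ∞ (volume.restrict disc))
    (hf' : IntegrableOn f' disc) (hg' : IntegrableOn g' disc) :
    HasWeakPartial i (fun w => f w * g w) (fun w => f' w * g w + f w * g' w) := by
  obtain ⟨Cf, -, hCf⟩ := MemLp.exists_ae_bound hfb
  obtain ⟨Cg, hCg₀, hCg⟩ := MemLp.exists_ae_bound hgb
  have hfi : IntegrableOn f disc := MemLp.integrableOn_disc hfb le_top
  have hgi : IntegrableOn g disc := MemLp.integrableOn_disc hgb le_top
  have hfg : IntegrableOn (fun w => f w * g w) disc := hgi.bdd_mul hfi.aestronglyMeasurable hCf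
  have hf'g : IntegrableOn (fun w => f' w * g w) disc := hf'.mul_bdd hgi.aestronglyMeasurable hCg
  have hfg' : IntegrableOn (fun w => f w * g' w) disc := hg'.bdd_mul hfi.aestronglyMeasurable hCf
  refine ⟨hfg.locallyIntegrableOn, (hf'g.add hfg').locallyIntegrableOn, fun φ hφ hc hs => ?_⟩
  obtain ⟨δ, hδ, hδs⟩ := IsCompact.exists_cthickening_subset_open hc isOpen_disc hs
  have hφfb : MemLp (fun w => φ w * f w) ∞ (volume.restrict disc) := by
    obtain ⟨C, hC⟩ := hc.exists_bound_of_continuous hφ.continuous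
    have : MemLp φ ∞ (volume.restrict disc) :=
      memLp_top_of_bound hφ.continuous.aestronglyMeasurable C (Eventually.of_forall hC)
    exact hfb.mul this
  have l1 := tendsto_integral_moll_mul hgb (integrableOn_test_mul hfi (continuous_fderiv_dir hφ i)
    (hasCompactSupport_fderiv_dir hc i))
  have l2 := tendsto_integral_moll_mul hφfb hg'
  have l3 := tendsto_integral_moll_mul hgb (integrableOn_test_mul hf' hφ.continuous hc)
  have hev : ∀ᶠ m in atTop, (∫ w in disc, moll m g w * (fderiv ℝ φ w (dir i) * f w))
      + (∫ w in disc, moll m (fun w => φ w * f w) w * g' w)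
      = - ∫ w in disc, moll m g w * (φ w * f' w) := by
    filter_upwards [tendsto_bump_rOut.eventually (gt_mem_nhds hδ)] with m hm
    have hG := moll_contDiff m hgi
    have hψ : ContDiff ℝ ∞ (fun w => φ w * moll m g w) := hφ.mul hG
    have hψc : HasCompactSupport (fun w => φ w * moll m g w) := hc.mul_right
    have hψs : tsupport (fun w => φ w * moll m g w) ⊆ disc := (tsupport_mul_subset_left).trans hs
    have key := hf.2.2 _ hψ hψc hψs
    have hder : ∀ w, fderiv ℝ (fun w => φ w * moll m g w) w (dir i)
        = φ w * moll m g' w + fderiv ℝ φ w (dir i) * moll m g w := by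
      intro w
      rw [fderiv_fun_mul (hφ.differentiable (by simp) w) (hG.differentiable (by simp) w)]
      simp only [_root_.add_apply, _root_.smul_apply, smul_eq_mul]
      -- the mollified weak derivative is the derivative of `moll m g` only away from `∂B`
      by_cases hw : w ∈ tsupport φ
      · rw [moll_fderiv m hg hgi]
        · ring
        · intro y hy
          refine hδs (Metric.mem_cthickening_of_dist_le y w δ _ hw ?_)
          exact (Metric.mem_closedBall.mp hy).trans hm.le
      · simp [image_eq_zero_of_notMem_tsupport hw]; ring
    rw [← moll_swap m (MemLp.integrableOn_disc hφfb le_top) hg', ← integral_add]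
    · simp only [hder, smul_eq_mul] at key
      refine Eq.trans ?_ (key.trans ?_)
      · exact integral_congr_ae (ae_of_all _ fun w => by beta_reduce; ring)
      · exact congrArg _ (integral_congr_ae (ae_of_all _ fun w => by beta_reduce; ring))
    · exact (integrableOn_test_mul hfi (continuous_fderiv_dir hφ i)
        (hasCompactSupport_fderiv_dir hc i)).bdd_mul hG.continuous.aestronglyMeasurable
        (ae_of_all _ (abs_moll_le m hCg₀ hCg))
    · obtain ⟨C, hC⟩ := (hc.mul_right (f' := moll m g')).exists_bound_of_continuous
        (hφ.continuous.mul (moll_contDiff m hg').continuous)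
      refine (hfi.bdd_mul (c := C)
        (hφ.continuous.mul (moll_contDiff m hg').continuous).aestronglyMeasurable
        (Eventually.of_forall hC)).congr (Eventually.of_forall fun w => ?_)
      simp only [Pi.mul_apply]; ring
  -- `m → ∞`: in each of the three integrals a bounded function is mollified and the other factor
  -- is integrable
  have hlim := tendsto_nhds_unique (Tendsto.congr' hev (l1.add l2)) l3.neg
  have i1 := integrableOn_test_mul hf'g hφ.continuous hc
  have i2 := integrableOn_test_mul hfg' hφ.continuous hc
  simp only [smul_eq_mul, mul_add]
  rw [integral_add i1 i2]
  have e1 : ∫ w in disc, fderiv ℝ φ w (dir i) * (f w * g w)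
      = ∫ w in disc, g w * (fderiv ℝ φ w (dir i) * f w) := by congr 1; ext w; ring
  have e2 : ∫ w in disc, φ w * (f w * g' w) = ∫ w in disc, φ w * f w * g' w := by
    congr 1; ext w; ring
  have e3 : ∫ w in disc, φ w * (f' w * g w) = ∫ w in disc, g w * (φ w * f' w) := by
    congr 1; ext w; ring
  rw [e1, e2, e3]
  linarith

theorem HasWeakPartial.add {i : Fin 2} {f g f' g' : Plane → ℝ}
    (hf : HasWeakPartial i f f') (hg : HasWeakPartial i g g')
    (hfi : IntegrableOn f disc) (hgi : IntegrableOn g disc)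
    (hf' : IntegrableOn f' disc) (hg' : IntegrableOn g' disc) :
    HasWeakPartial i (fun w => f w + g w) (fun w => f' w + g' w) := by
  refine ⟨(hfi.add hgi).locallyIntegrableOn, (hf'.add hg').locallyIntegrableOn,
    fun φ hφ hc hs => ?_⟩
  simp only [smul_eq_mul, mul_add]
  have hd := continuous_fderiv_dir hφ i
  have hdc := hasCompactSupport_fderiv_dir hc i
  rw [integral_add (integrableOn_test_mul hfi hd hdc) (integrableOn_test_mul hgi hd hdc),
    integral_add (integrableOn_test_mul hf' hφ.continuous hc)
      (integrableOn_test_mul hg' hφ.continuous hc)]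
  have h1 := hf.2.2 φ hφ hc hs
  have h2 := hg.2.2 φ hφ hc hs
  simp only [smul_eq_mul] at h1 h2
  rw [h1, h2]; ring

/-- Classical partial derivatives are weak partial derivatives. -/
theorem hasWeakPartial_of_contDiffOn {i : Fin 2} {f : Plane → ℝ} (hf : ContDiffOn ℝ 1 f disc) :
    HasWeakPartial i f (fun w => fderiv ℝ f w (dir i)) := by
  have hcd : ContinuousOn (fun w => fderiv ℝ f w (dir i)) disc :=
    (hf.continuousOn_fderiv_of_isOpen isOpen_disc le_rfl).clm_apply continuousOn_const
  have hl1 : LocallyIntegrableOn f disc :=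
    hf.continuousOn.locallyIntegrableOn measurableSet_disc
  have hl2 : LocallyIntegrableOn (fun w => fderiv ℝ f w (dir i)) disc :=
    hcd.locallyIntegrableOn measurableSet_disc
  refine ⟨hl1, hl2, fun φ hφ hc hs => ?_⟩
  -- products with functions supported in `tsupport φ` are integrable on the whole plane
  have hint : ∀ (k ψ : Plane → ℝ), LocallyIntegrableOn k disc → Continuous ψ →
      tsupport ψ ⊆ tsupport φ → Integrable (fun w => ψ w * k w) := fun k ψ hk hψ hψs => by
    have hcψ : IsCompact (tsupport ψ) := hc.of_isClosed_subset (isClosed_tsupport ψ) hψs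
    exact (integrableOn_iff_integrable_of_support_subset
      ((Function.support_mul_subset_left ψ k).trans (subset_tsupport ψ))).mp
      ((hk.integrableOn_compact_subset (hψs.trans hs) hcψ).continuousOn_smul
        hψ.continuousOn hcψ)
  have hset : ∀ (k ψ : Plane → ℝ), tsupport ψ ⊆ tsupport φ →
      ∫ w in disc, ψ w * k w = ∫ w, ψ w * k w := fun k ψ hψs =>
    setIntegral_eq_integral_of_forall_compl_eq_zero fun w hw => by
      rw [image_eq_zero_of_notMem_tsupport fun h => hw (hs (hψs h)), zero_mul]
  have hsd : tsupport (fun w => fderiv ℝ φ w (dir i)) ⊆ tsupport φ :=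
    tsupport_fderiv_apply_subset ℝ (dir i)
  have hdf : ∀ x ∈ tsupport φ, DifferentiableAt ℝ f x := fun x hx =>
    ((hf.differentiableOn (by norm_num)) x (hs hx)).differentiableAt (isOpen_disc.mem_nhds (hs hx))
  simp only [smul_eq_mul]
  rw [hset _ _ hsd, hset _ φ subset_rfl]
  have := integral_mul_fderiv_eq_neg_fderiv_mul_of_integrable (μ := (volume : Measure Plane))
    (f := φ) (g := f) (v := dir i) (hint f _ hl1 (continuous_fderiv_dir hφ i) hsd)
    (hint _ φ hl2 hφ.continuous subset_rfl) (hint _ φ hl1 hφ.continuous subset_rfl)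
    (fun x _ => hφ.differentiable (by simp) x) hdf
  rw [this, neg_neg]

/-! ### Calculus in `W^{1,2}(B) ∩ L^∞(B)` -/

variable {d : ℕ}

/-- `f` belongs to `W^{1,2}(B) ∩ L^∞(B)` and `f' i` is its weak partial derivative in direction
`u^i`. -/
structure BddW12 {F : Type*} [NormedAddCommGroup F] [NormedSpace ℝ F]
    (f : Plane → F) (f' : Fin 2 → Plane → F) : Prop where
  bdd : MemLp f ∞ (volume.restrict disc)
  weak : ∀ i, HasWeakPartial i f (f' i)
  sq : ∀ i, MemLp (f' i) 2 (volume.restrict disc)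

theorem BddW12.memW12 {F : Type*} [NormedAddCommGroup F] [NormedSpace ℝ F]
    {f : Plane → F} {f' : Fin 2 → Plane → F} (h : BddW12 f f') : MemW12 f :=
  ⟨h.bdd.mono_exponent le_top, fun i => ⟨f' i, h.weak i, h.sq i⟩⟩

theorem hasWeakPartial_weakPartial {F : Type*} [NormedAddCommGroup F] [NormedSpace ℝ F]
    {i : Fin 2} {f g : Plane → F} (h : HasWeakPartial i f g) :
    HasWeakPartial i f (weakPartial i f) := by
  have hex : ∃ g, HasWeakPartial i f g := ⟨g, h⟩
  rw [weakPartial, dif_pos hex]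
  exact hex.choose_spec

theorem bddW12_weakPartial {F : Type*} [NormedAddCommGroup F] [NormedSpace ℝ F] [CompleteSpace F]
    {f : Plane → F} (hb : MemLp f ∞ (volume.restrict disc)) (h : MemW12 f) :
    BddW12 f (fun i => weakPartial i f) := by
  refine ⟨hb, fun i => ?_, fun i => ?_⟩
  · obtain ⟨g, hg, -⟩ := h.2 i
    exact hasWeakPartial_weakPartial hg
  · obtain ⟨g, hg, hg2⟩ := h.2 i
    exact hg2.ae_eq (hg.ae_eq (hasWeakPartial_weakPartial hg))

theorem BddW12.weakPartial_ae_eq {F : Type*} [NormedAddCommGroup F] [NormedSpace ℝ F]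
    [CompleteSpace F] {f : Plane → F} {f' : Fin 2 → Plane → F} (h : BddW12 f f') (i : Fin 2) :
    ∀ᵐ w ∂(volume.restrict disc), weakPartial i f w = f' i w :=
  (hasWeakPartial_weakPartial (h.weak i)).ae_eq (h.weak i)

theorem BddW12.integrableOn {F : Type*} [NormedAddCommGroup F] [NormedSpace ℝ F]
    {f : Plane → F} {f' : Fin 2 → Plane → F} (h : BddW12 f f') : IntegrableOn f disc :=
  MemLp.integrableOn_disc h.bdd le_top

theorem BddW12.integrableOn_deriv {F : Type*} [NormedAddCommGroup F] [NormedSpace ℝ F]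
    {f : Plane → F} {f' : Fin 2 → Plane → F} (h : BddW12 f f') (i : Fin 2) :
    IntegrableOn (f' i) disc :=
  MemLp.integrableOn_disc (h.sq i) one_le_two

theorem BddW12.congr {F : Type*} [NormedAddCommGroup F] [NormedSpace ℝ F]
    {f g : Plane → F} {f' g' : Fin 2 → Plane → F} (h : BddW12 f f')
    (hfg : ∀ w, f w = g w) (hfg' : ∀ i w, f' i w = g' i w) : BddW12 g g' := by
  obtain rfl : f = g := funext hfg
  obtain rfl : f' = g' := funext fun i => funext (hfg' i)
  exact h

/-- The weak gradients of functions that agree a.e. agree a.e. -/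
theorem BddW12.ae_eq_of_ae_eq {F : Type*} [NormedAddCommGroup F] [NormedSpace ℝ F]
    [CompleteSpace F] {f g : Plane → F} {f' g' : Fin 2 → Plane → F} (hf : BddW12 f f')
    (hg : BddW12 g g') (h : ∀ᵐ w ∂(volume.restrict disc), f w = g w) (i : Fin 2) :
    ∀ᵐ w ∂(volume.restrict disc), f' i w = g' i w := by
  refine (hf.weak i).ae_eq ⟨(hf.weak i).1, (hg.weak i).2.1, fun φ hφ hc hs => ?_⟩
  rw [← (hg.weak i).2.2 φ hφ hc hs]
  exact integral_congr_ae (h.mono fun w hw => by beta_reduce; rw [hw])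

theorem bddW12_const (c : ℝ) : BddW12 (fun _ => c) (fun _ _ => 0) := by
  refine ⟨memLp_const c, fun i => ?_, fun i => MemLp.zero⟩
  simpa using hasWeakPartial_of_contDiffOn (i := i) (f := fun _ => c) contDiffOn_const

theorem BddW12.mul {f g : Plane → ℝ} {f' g' : Fin 2 → Plane → ℝ} (hf : BddW12 f f')
    (hg : BddW12 g g') :
    BddW12 (fun w => f w * g w) (fun i w => f' i w * g w + f w * g' i w) :=
  ⟨hg.bdd.mul hf.bdd, fun i => (hf.weak i).mul (hg.weak i) hf.bdd hg.bdd (hf.integrableOn_deriv i)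
    (hg.integrableOn_deriv i), fun i => (hg.bdd.mul (hf.sq i)).add ((hg.sq i).mul hf.bdd)⟩

theorem BddW12.add {f g : Plane → ℝ} {f' g' : Fin 2 → Plane → ℝ} (hf : BddW12 f f')
    (hg : BddW12 g g') : BddW12 (fun w => f w + g w) (fun i w => f' i w + g' i w) :=
  ⟨hf.bdd.add hg.bdd, fun i => (hf.weak i).add (hg.weak i) hf.integrableOn hg.integrableOn
    (hf.integrableOn_deriv i) (hg.integrableOn_deriv i), fun i => (hf.sq i).add (hg.sq i)⟩

theorem bddW12_sum {ι : Type*} (s : Finset ι) {f : ι → Plane → ℝ} {f' : ι → Fin 2 → Plane → ℝ}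
    (h : ∀ j ∈ s, BddW12 (f j) (f' j)) :
    BddW12 (fun w => ∑ j ∈ s, f j w) (fun i w => ∑ j ∈ s, f' j i w) := by
  classical
  induction s using Finset.induction_on with
  | empty => simpa using bddW12_const 0
  | insert a s ha ih =>
    simp only [Finset.sum_insert ha]
    exact (h a (Finset.mem_insert_self a s)).add
      (ih fun j hj => h j (Finset.mem_insert_of_mem hj))

theorem HasWeakPartial.eval {i : Fin 2} {f g : Plane → EuclideanSpace ℝ (Fin d)}
    (h : HasWeakPartial i f g) (hf : IntegrableOn f disc) (hg : IntegrableOn g disc) (c : Fin d) :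
    HasWeakPartial i (fun w => f w c) (fun w => g w c) := by
  refine ⟨(show IntegrableOn (fun w => f w c) disc volume from hf.eval_piLp c).locallyIntegrableOn,
    (show IntegrableOn (fun w => g w c) disc volume from hg.eval_piLp c).locallyIntegrableOn,
    fun φ hφ hc hs => ?_⟩
  have h1 : ∀ (k : Plane → EuclideanSpace ℝ (Fin d)) (ψ : Plane → ℝ), IntegrableOn k disc →
      Continuous ψ → HasCompactSupport ψ →
      (∫ w in disc, ψ w • k w) c = ∫ w in disc, ψ w • k w c := by
    intro k ψ hk hψ hψc
    refine eval_integral_piLp (fun j => ?_) c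
    exact integrableOn_test_mul (hk.eval_piLp j) hψ hψc
  have h2 := congrArg (fun v : EuclideanSpace ℝ (Fin d) => v c) (h.2.2 φ hφ hc hs)
  simp only [PiLp.neg_apply] at h2
  rwa [h1 f _ hf (continuous_fderiv_dir hφ i) (hasCompactSupport_fderiv_dir hc i),
    h1 g φ hg hφ.continuous hc] at h2

theorem hasWeakPartial_of_eval {i : Fin 2} {f g : Plane → EuclideanSpace ℝ (Fin d)}
    (hf : IntegrableOn f disc) (hg : IntegrableOn g disc)
    (h : ∀ c, HasWeakPartial i (fun w => f w c) (fun w => g w c)) : HasWeakPartial i f g := by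
  refine ⟨hf.locallyIntegrableOn, hg.locallyIntegrableOn, fun φ hφ hc hs => ?_⟩
  have h1 : ∀ (k : Plane → EuclideanSpace ℝ (Fin d)) (ψ : Plane → ℝ) (c : Fin d),
      IntegrableOn k disc → Continuous ψ → HasCompactSupport ψ →
      (∫ w in disc, ψ w • k w) c = ∫ w in disc, ψ w • k w c := by
    intro k ψ c hk hψ hψc
    refine eval_integral_piLp (fun j => ?_) c
    exact integrableOn_test_mul (hk.eval_piLp j) hψ hψc
  ext c
  rw [PiLp.neg_apply, h1 f _ c hf (continuous_fderiv_dir hφ i) (hasCompactSupport_fderiv_dir hc i),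
    h1 g φ c hg hφ.continuous hc]
  exact (h c).2.2 φ hφ hc hs

/-- Membership in `W^{1,2}(B) ∩ L^∞(B)` and weak gradients can be tested componentwise. -/
theorem bddW12_euclidean_iff {f : Plane → EuclideanSpace ℝ (Fin d)}
    {f' : Fin 2 → Plane → EuclideanSpace ℝ (Fin d)} :
    BddW12 f f' ↔ ∀ c, BddW12 (fun w => f w c) (fun i w => f' i w c) := by
  constructor
  · exact fun h c => ⟨h.bdd.eval_piLp c, fun i => (h.weak i).eval h.integrableOn
      (h.integrableOn_deriv i) c, fun i => (h.sq i).eval_piLp c⟩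
  · intro h
    have hb : MemLp f ∞ (volume.restrict disc) := MemLp.of_eval_piLp fun c => (h c).bdd
    have hs : ∀ i, MemLp (f' i) 2 (volume.restrict disc) :=
      fun i => MemLp.of_eval_piLp fun c => (h c).sq i
    exact ⟨hb, fun i => hasWeakPartial_of_eval (MemLp.integrableOn_disc hb le_top)
      (MemLp.integrableOn_disc (hs i) one_le_two) fun c => (h c).weak i, hs⟩

theorem inner_eq_sum (x y : EuclideanSpace ℝ (Fin d)) : inner ℝ x y = ∑ c, x c * y c := by
  rw [PiLp.inner_apply]
  exact Finset.sum_congr rfl fun c _ => by simp [mul_comm]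

theorem BddW12.inner {f g : Plane → EuclideanSpace ℝ (Fin d)}
    {f' g' : Fin 2 → Plane → EuclideanSpace ℝ (Fin d)} (hf : BddW12 f f') (hg : BddW12 g g') :
    BddW12 (fun w => inner ℝ (f w) (g w))
      (fun i w => inner ℝ (f' i w) (g w) + inner ℝ (f w) (g' i w)) := by
  refine (bddW12_sum Finset.univ fun c _ => (bddW12_euclidean_iff.mp hf c).mul
    (bddW12_euclidean_iff.mp hg c)).congr (fun w => (inner_eq_sum _ _).symm) fun i w => ?_
  rw [inner_eq_sum, inner_eq_sum, ← Finset.sum_add_distrib]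

theorem BddW12.smul {f : Plane → ℝ} {f' : Fin 2 → Plane → ℝ}
    {g : Plane → EuclideanSpace ℝ (Fin d)} {g' : Fin 2 → Plane → EuclideanSpace ℝ (Fin d)}
    (hf : BddW12 f f') (hg : BddW12 g g') :
    BddW12 (fun w => f w • g w) (fun i w => f' i w • g w + f w • g' i w) :=
  bddW12_euclidean_iff.mpr fun c => (hf.mul (bddW12_euclidean_iff.mp hg c)).congr
    (fun _ => by simp) fun _ _ => by simp

theorem bddW12_vec_sum {ι : Type*} (s : Finset ι) {f : ι → Plane → EuclideanSpace ℝ (Fin d)}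
    {f' : ι → Fin 2 → Plane → EuclideanSpace ℝ (Fin d)} (h : ∀ j ∈ s, BddW12 (f j) (f' j)) :
    BddW12 (fun w => ∑ j ∈ s, f j w) (fun i w => ∑ j ∈ s, f' j i w) :=
  bddW12_euclidean_iff.mpr fun c => (bddW12_sum s fun j hj =>
    bddW12_euclidean_iff.mp (h j hj) c).congr (fun _ => by simp) fun _ _ => by simp

/-! ### Functions that are smooth up to the boundary -/

theorem isCompact_closedDisc : IsCompact closedDisc := isCompact_closedBall 0 1

theorem uniqueDiffOn_closedDisc : UniqueDiffOn ℝ closedDisc :=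
  uniqueDiffOn_convex (convex_closedBall 0 1) (by
    rw [closedDisc, interior_closedBall _ one_ne_zero]; exact ⟨0, by simp⟩)

theorem closedDisc_mem_nhds {w : Plane} (hw : w ∈ disc) : closedDisc ∈ 𝓝 w :=
  mem_of_superset (isOpen_disc.mem_nhds hw) disc_subset_closedDisc

theorem memLp_top_of_continuousOn {F : Type*} [NormedAddCommGroup F] [SecondCountableTopology F]
    {f : Plane → F} (hf : ContinuousOn f closedDisc) : MemLp f ∞ (volume.restrict disc) := by
  obtain ⟨C, hC⟩ := isCompact_closedDisc.exists_bound_of_continuousOn hf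
  refine memLp_top_of_bound
    ((hf.mono disc_subset_closedDisc).aestronglyMeasurable measurableSet_disc) C ?_
  filter_upwards [ae_restrict_mem measurableSet_disc] with w hw
  exact hC w (disc_subset_closedDisc hw)

theorem fderiv_eq_fderivWithin {F : Type*} [NormedAddCommGroup F] [NormedSpace ℝ F]
    (f : Plane → F) {w : Plane} (hw : w ∈ disc) : fderiv ℝ f w = fderivWithin ℝ f closedDisc w :=
  (fderivWithin_of_mem_nhds (closedDisc_mem_nhds hw)).symm

theorem continuousOn_fderivWithin_dir {F : Type*} [NormedAddCommGroup F] [NormedSpace ℝ F]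
    {f : Plane → F} (hf : ContDiffOn ℝ 1 f closedDisc) (i : Fin 2) :
    ContinuousOn (fun w => fderivWithin ℝ f closedDisc w (dir i)) closedDisc :=
  (hf.continuousOn_fderivWithin uniqueDiffOn_closedDisc le_rfl).clm_apply continuousOn_const

theorem bddW12_of_contDiffOn {f : Plane → ℝ} (hf : ContDiffOn ℝ 1 f closedDisc) :
    BddW12 f (fun i w => fderiv ℝ f w (dir i)) := by
  refine ⟨memLp_top_of_continuousOn hf.continuousOn, fun i =>
    hasWeakPartial_of_contDiffOn (hf.mono disc_subset_closedDisc), fun i => ?_⟩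
  refine ((memLp_top_of_continuousOn (continuousOn_fderivWithin_dir hf i)).ae_eq ?_).mono_exponent
    le_top
  filter_upwards [ae_restrict_mem measurableSet_disc] with w hw
  rw [fderiv_eq_fderivWithin f hw]

theorem bddW12_vec_of_contDiffOn {f : Plane → EuclideanSpace ℝ (Fin d)}
    (hf : ContDiffOn ℝ 1 f closedDisc) : BddW12 f (fun i w => fderiv ℝ f w (dir i)) := by
  have hb : MemLp f ∞ (volume.restrict disc) := memLp_top_of_continuousOn hf.continuousOn
  have hs : ∀ i, MemLp (fun w => fderiv ℝ f w (dir i)) ∞ (volume.restrict disc) := fun i => by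
    refine (memLp_top_of_continuousOn (continuousOn_fderivWithin_dir hf i)).ae_eq ?_
    filter_upwards [ae_restrict_mem measurableSet_disc] with w hw
    rw [fderiv_eq_fderivWithin f hw]
  have hs2 := fun i => (hs i).mono_exponent (q := ∞) (p := 2) le_top
  refine ⟨hb, fun i => hasWeakPartial_of_eval (MemLp.integrableOn_disc hb le_top)
    (MemLp.integrableOn_disc (hs i) le_top) fun c => ?_, hs2⟩
  have hc : ContDiffOn ℝ 1 (fun w => f w c) closedDisc := contDiffOn_euclidean.mp hf c
  have h := (bddW12_of_contDiffOn hc).weak i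
  have he : ∀ w ∈ disc, fderiv ℝ (fun w => f w c) w (dir i) = fderiv ℝ f w (dir i) c := by
    intro w hw
    have hd : DifferentiableAt ℝ f w := ((hf.differentiableOn (by norm_num)) w
      (disc_subset_closedDisc hw)).differentiableAt (closedDisc_mem_nhds hw)
    have := ((EuclideanSpace.proj c : EuclideanSpace ℝ (Fin d) →L[ℝ] ℝ).hasFDerivAt
      (x := f w)).comp w hd.hasFDerivAt
    exact (congrArg (fun L : Plane →L[ℝ] ℝ => L (dir i)) this.fderiv).trans (by simp)
  refine ⟨h.1, ?_, fun φ h1 h2 h3 => (h.2.2 φ h1 h2 h3).trans ?_⟩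
  · exact (show IntegrableOn (fun w => fderiv ℝ f w (dir i) c) disc volume from
      (MemLp.integrableOn_disc (hs i) le_top).eval_piLp c).locallyIntegrableOn
  · rw [neg_inj]
    exact setIntegral_congr_fun measurableSet_disc fun w hw => by beta_reduce; rw [he w hw]

/-! ### The error of mollification in `L¹` -/

theorem lintegral_enorm_kernel (m : ℕ) : ∫⁻ x, ‖kernel m x‖ₑ = 1 := by
  rw [← ofReal_integral_norm_eq_lintegral_enorm (kernel_integrable m)]
  simp only [Real.norm_of_nonneg (kernel_nonneg m _), kernel_integral, ENNReal.ofReal_one]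

theorem lintegral_enorm_moll_le (m : ℕ) {g : Plane → ℝ} (hg : IntegrableOn g disc) (s : Set Plane) :
    ∫⁻ x in s, ‖moll m g x‖ₑ ≤ ∫⁻ y in disc, ‖g y‖ₑ := by
  have hk : Continuous (kernel m) := (kernel_contDiff m).continuous
  have hk1 := lintegral_enorm_kernel m
  calc ∫⁻ x in s, ‖moll m g x‖ₑ ≤ ∫⁻ x, ‖moll m g x‖ₑ := setLIntegral_le_lintegral _ _
    _ ≤ ∫⁻ x, ∫⁻ y in disc, ‖kernel m (x - y)‖ₑ * ‖g y‖ₑ := by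
        refine lintegral_mono fun x => (enorm_integral_le_lintegral_enorm _).trans_eq ?_
        simp only [enorm_mul]
    _ = ∫⁻ y in disc, ∫⁻ x, ‖kernel m (x - y)‖ₑ * ‖g y‖ₑ := by
        refine lintegral_lintegral_swap (AEMeasurable.mul
          (f := fun p : Plane × Plane => ‖kernel m (p.1 - p.2)‖ₑ)
          (g := fun p : Plane × Plane => ‖g p.2‖ₑ) ?_ ?_)
        · exact (hk.comp (by fun_prop : Continuous fun p : Plane × Plane =>
            p.1 - p.2)).enorm.measurable.aemeasurable
        · exact hg.aestronglyMeasurable.enorm.comp_snd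
    _ = ∫⁻ y in disc, ‖g y‖ₑ := by
        refine lintegral_congr fun y => ?_
        rw [lintegral_mul_const' _ _ enorm_ne_top,
          lintegral_sub_right_eq_self (fun x => ‖kernel m x‖ₑ) y, hk1, one_mul]

/-- Translation estimate in `L¹` for continuously differentiable functions. -/
theorem lintegral_enorm_translate_sub_le {F : Plane → ℝ} (hF : ContDiff ℝ 1 F) (h : Plane)
    {r ρ : ℝ} (hr : r + ‖h‖ ≤ ρ) :
    ∫⁻ x in Metric.ball (0 : Plane) r, ‖F (x - h) - F x‖ₑ
      ≤ ‖h‖ₑ * ∫⁻ x in Metric.ball (0 : Plane) ρ, ‖fderiv ℝ F x‖ₑ := by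
  have hcont : Continuous (fderiv ℝ F) := hF.continuous_fderiv (by norm_num)
  have hpt : ∀ x, ‖F (x - h) - F x‖ₑ ≤ ∫⁻ t in Ioc (0 : ℝ) 1, ‖fderiv ℝ F (x - t • h)‖ₑ * ‖h‖ₑ := by
    intro x
    have hder : ∀ t : ℝ, HasDerivAt (fun t : ℝ => F (x - t • h))
        (fderiv ℝ F (x - t • h) (-h)) t := by
      intro t
      have h1 : HasDerivAt (fun t : ℝ => x - t • h) (-h) t := by
        simpa using ((hasDerivAt_id t).smul_const h).const_sub x
      exact ((hF.differentiable (by norm_num)) _).hasFDerivAt.comp_hasDerivAt t h1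
    have hci : Continuous (fun t : ℝ => fderiv ℝ F (x - t • h) (-h)) :=
      (hcont.comp (by fun_prop)).clm_apply continuous_const
    have hftc := intervalIntegral.integral_eq_sub_of_hasDerivAt (fun t _ => hder t)
      (hci.intervalIntegrable 0 1)
    simp only [one_smul, zero_smul, sub_zero] at hftc
    rw [← hftc, intervalIntegral.integral_of_le zero_le_one]
    refine (enorm_integral_le_lintegral_enorm _).trans (lintegral_mono fun t => ?_)
    refine (ContinuousLinearMap.le_opENorm _ _).trans_eq ?_
    rw [enorm_neg]
  calc ∫⁻ x in Metric.ball (0 : Plane) r, ‖F (x - h) - F x‖ₑ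
      ≤ ∫⁻ x in Metric.ball (0 : Plane) r, ∫⁻ t in Ioc (0 : ℝ) 1,
          ‖fderiv ℝ F (x - t • h)‖ₑ * ‖h‖ₑ := lintegral_mono fun x => hpt x
    _ = ∫⁻ t in Ioc (0 : ℝ) 1, ∫⁻ x in Metric.ball (0 : Plane) r,
          ‖fderiv ℝ F (x - t • h)‖ₑ * ‖h‖ₑ := by
        refine lintegral_lintegral_swap (Continuous.measurable ?_).aemeasurable
        refine ENNReal.continuous_mul_const enorm_ne_top |>.comp ?_
        exact (hcont.comp (by fun_prop : Continuous fun p : Plane × ℝ => p.1 - p.2 • h)).enorm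
    _ ≤ ∫⁻ t in Ioc (0 : ℝ) 1, ‖h‖ₑ * ∫⁻ x in Metric.ball (0 : Plane) ρ, ‖fderiv ℝ F x‖ₑ := by
        refine setLIntegral_mono' measurableSet_Ioc fun t ht => ?_
        rw [lintegral_mul_const' _ _ enorm_ne_top, mul_comm]
        refine mul_le_mul_right ?_ _
        rw [← lintegral_indicator Metric.isOpen_ball.measurableSet,
          ← lintegral_indicator Metric.isOpen_ball.measurableSet,
          ← lintegral_sub_right_eq_self
            ((Metric.ball (0 : Plane) ρ).indicator fun x => ‖fderiv ℝ F x‖ₑ) (t • h)]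
        refine lintegral_mono fun x => ?_
        by_cases hx : x ∈ Metric.ball (0 : Plane) r
        · have hx' : x - t • h ∈ Metric.ball (0 : Plane) ρ := by
            rw [mem_ball_zero_iff] at hx ⊢
            calc ‖x - t • h‖ ≤ ‖x‖ + ‖t • h‖ := norm_sub_le _ _
              _ ≤ ‖x‖ + ‖h‖ := by
                  rw [norm_smul, Real.norm_of_nonneg ht.1.le]
                  nlinarith [norm_nonneg h, ht.2]
              _ < r + ‖h‖ := by linarith
              _ ≤ ρ := hr
          rw [indicator_of_mem hx, indicator_of_mem hx']
        · rw [indicator_of_notMem hx]; exact zero_le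
    _ = ‖h‖ₑ * ∫⁻ x in Metric.ball (0 : Plane) ρ, ‖fderiv ℝ F x‖ₑ := by simp

theorem integral_kernel_sub_eq_one (n : ℕ) {x : Plane}
    (hx : Metric.closedBall x (bump n).rOut ⊆ disc) : ∫ y in disc, kernel n (x - y) = 1 := by
  rw [setIntegral_eq_integral_of_forall_compl_eq_zero,
    integral_sub_left_eq_self (kernel n) volume x, kernel_integral]
  intro y hy
  refine kernel_eq_zero n ?_
  by_contra hlt
  refine hy (hx ?_)
  rw [Metric.mem_closedBall, dist_comm, dist_eq_norm]
  exact (not_le.mp hlt).le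

theorem closedBall_subset_disc {x : Plane} {r ε : ℝ} (hx : x ∈ Metric.ball (0 : Plane) r)
    (h : r + ε ≤ 1) : Metric.closedBall x ε ⊆ disc := by
  intro y hy
  rw [mem_ball_zero_iff] at hx
  rw [disc, mem_ball_zero_iff]
  have h1 : ‖y‖ ≤ ‖y - x‖ + ‖x‖ := by simpa using norm_add_le (y - x) x
  have h2 : ‖y - x‖ ≤ ε := by simpa [dist_eq_norm] using hy
  linarith

/-- The `L¹` error of mollification for `C¹` functions, an average of translation estimates. On the
disc of radius `r` the kernel does not reach `∂B`, so mollification there is a genuine average. -/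
theorem lintegral_enorm_moll_sub_le_of_contDiff (n : ℕ) {F : Plane → ℝ} (hF : ContDiff ℝ 1 F)
    {r ρ : ℝ} (hr : r + (bump n).rOut ≤ ρ) (hρ : ρ ≤ 1) :
    ∫⁻ x in Metric.ball (0 : Plane) r, ‖moll n F x - F x‖ₑ
      ≤ ENNReal.ofReal (bump n).rOut * ∫⁻ x in Metric.ball (0 : Plane) ρ, ‖fderiv ℝ F x‖ₑ := by
  have hk : Continuous (kernel n) := (kernel_contDiff n).continuous
  have hFi : IntegrableOn F disc :=
    (hF.continuous.continuousOn.integrableOn_compact isCompact_closedDisc).mono_set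
      disc_subset_closedDisc
  have hk1 := lintegral_enorm_kernel n
  have hpt : ∀ x ∈ Metric.ball (0 : Plane) r,
      ‖moll n F x - F x‖ₑ ≤ ∫⁻ h, ‖kernel n h‖ₑ * ‖F (x - h) - F x‖ₑ := by
    intro x hx
    have hsub := closedBall_subset_disc hx (hr.trans hρ)
    have hkx : Integrable (fun y => kernel n (x - y)) := (kernel_integrable n).comp_sub_left x
    have e : moll n F x - F x = ∫ y in disc, kernel n (x - y) * (F y - F x) := by
      simp only [mul_sub]
      rw [integral_sub (kernel_mul_integrable n hFi x) (hkx.integrableOn.mul_const _),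
        integral_mul_const, integral_kernel_sub_eq_one n hsub, one_mul, moll]
    rw [e]
    refine (enorm_integral_le_lintegral_enorm _).trans
      ((setLIntegral_le_lintegral _ _).trans_eq ?_)
    rw [← lintegral_sub_left_eq_self (fun h => ‖kernel n h‖ₑ * ‖F (x - h) - F x‖ₑ) x]
    simp only [enorm_mul, sub_sub_cancel]
  calc ∫⁻ x in Metric.ball (0 : Plane) r, ‖moll n F x - F x‖ₑ
      ≤ ∫⁻ x in Metric.ball (0 : Plane) r, ∫⁻ h, ‖kernel n h‖ₑ * ‖F (x - h) - F x‖ₑ :=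
        setLIntegral_mono' Metric.isOpen_ball.measurableSet hpt
    _ = ∫⁻ h, ∫⁻ x in Metric.ball (0 : Plane) r, ‖kernel n h‖ₑ * ‖F (x - h) - F x‖ₑ := by
        refine lintegral_lintegral_swap (Measurable.mul
          (f := fun p : Plane × Plane => ‖kernel n p.2‖ₑ)
          (g := fun p : Plane × Plane => ‖F (p.1 - p.2) - F p.1‖ₑ) ?_ ?_).aemeasurable
        · exact (hk.comp continuous_snd).enorm.measurable
        · exact ((hF.continuous.comp (by fun_prop : Continuous fun p : Plane × Plane =>
            p.1 - p.2)).sub (hF.continuous.comp continuous_fst)).enorm.measurable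
    _ ≤ ∫⁻ h, ‖kernel n h‖ₑ * (ENNReal.ofReal (bump n).rOut *
          ∫⁻ x in Metric.ball (0 : Plane) ρ, ‖fderiv ℝ F x‖ₑ) := by
        refine lintegral_mono fun h => ?_
        beta_reduce
        rw [lintegral_const_mul' _ _ enorm_ne_top]
        rcases le_or_gt (bump n).rOut ‖h‖ with hh | hh
        · simp [kernel_eq_zero n hh]
        · gcongr
          refine (lintegral_enorm_translate_sub_le hF h (ρ := ρ) (by linarith)).trans ?_
          gcongr
          rw [← ofReal_norm]
          exact ENNReal.ofReal_le_ofReal hh.le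
    _ = ENNReal.ofReal (bump n).rOut * ∫⁻ x in Metric.ball (0 : Plane) ρ, ‖fderiv ℝ F x‖ₑ := by
        rw [lintegral_mul_const _ hk.enorm.measurable, hk1, one_mul]

theorem enorm_le_dir (L : Plane →L[ℝ] ℝ) : ‖L‖ₑ ≤ ∑ i, ‖L (dir i)‖ₑ := by
  have h : ‖L‖ ≤ ∑ i, ‖L (dir i)‖ := by
    refine L.opNorm_le_bound (by positivity) fun v => ?_
    have hv : v = ∑ i, v i • dir i := by
      ext j; fin_cases j <;> simp [dir, Fin.sum_univ_two]
    calc ‖L v‖ = ‖∑ i, v i * L (dir i)‖ := by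
          conv_lhs => rw [hv]
          simp only [map_sum, map_smul, smul_eq_mul]
      _ ≤ ∑ i, ‖v i * L (dir i)‖ := norm_sum_le _ _
      _ ≤ ∑ i, ‖v‖ * ‖L (dir i)‖ := by
          refine Finset.sum_le_sum fun i _ => ?_
          rw [norm_mul]
          exact mul_le_mul_of_nonneg_right (PiLp.norm_apply_le v i) (norm_nonneg _)
      _ = (∑ i, ‖L (dir i)‖) * ‖v‖ := by rw [← Finset.mul_sum, mul_comm]
  calc ‖L‖ₑ = ENNReal.ofReal ‖L‖ := (ofReal_norm L).symm
    _ ≤ ENNReal.ofReal (∑ i, ‖L (dir i)‖) := ENNReal.ofReal_le_ofReal h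
    _ = ∑ i, ‖L (dir i)‖ₑ := by
        rw [ENNReal.ofReal_sum_of_nonneg fun _ _ => norm_nonneg _]
        simp only [ofReal_norm]

/-- The `L¹` error of mollification is controlled by the mollification radius times the `L¹` norm
of the weak gradient, by Fatou's lemma applied to the smooth approximations `moll m f`. -/
theorem lintegral_enorm_moll_sub_le (n : ℕ) {f : Plane → ℝ} {f' : Fin 2 → Plane → ℝ}
    (hf : IntegrableOn f disc) (hf' : ∀ i, IntegrableOn (f' i) disc)
    (h : ∀ i, HasWeakPartial i f (f' i)) {r : ℝ} (hr : r + (bump n).rOut < 1) :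
    ∫⁻ x in Metric.ball (0 : Plane) r, ‖moll n f x - f x‖ₑ
      ≤ ENNReal.ofReal (bump n).rOut * ∑ i, ∫⁻ x in disc, ‖f' i x‖ₑ := by
  have hr1 : r ≤ 1 := by linarith [(bump n).rOut_pos]
  have hsub : Metric.ball (0 : Plane) r ⊆ disc := Metric.ball_subset_ball hr1
  have hm : ∀ m, ContDiff ℝ ∞ (moll m f) := fun m => moll_contDiff m hf
  have hpt : ∀ᵐ x ∂(volume.restrict (Metric.ball (0 : Plane) r)),
      ‖moll n f x - f x‖ₑ ≤ liminf (fun m => ‖moll n (moll m f) x - moll m f x‖ₑ) atTop := by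
    filter_upwards [ae_restrict_of_ae_restrict_of_subset hsub (ae_tendsto_moll hf)] with x hx
    have h1 : Tendsto (fun m => moll n (moll m f) x) atTop (𝓝 (moll n f x)) := by
      have hkb : MemLp (fun y => kernel n (x - y)) ∞ (volume.restrict disc) := by
        obtain ⟨C, hC⟩ := kernel_bounded n
        exact memLp_top_of_bound ((kernel_contDiff n).continuous.comp
          (by fun_prop)).aestronglyMeasurable C (Eventually.of_forall fun y => hC _)
      have := tendsto_integral_moll_mul hkb hf
      refine this.congr fun m => ?_
      rw [← moll_swap m (MemLp.integrableOn_disc hkb le_top) hf]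
      rfl
    exact ((h1.sub hx).enorm).liminf_eq.ge
  have hev : ∀ᶠ m in atTop, ∫⁻ x in Metric.ball (0 : Plane) r, ‖moll n (moll m f) x - moll m f x‖ₑ
      ≤ ENNReal.ofReal (bump n).rOut * ∑ i, ∫⁻ x in disc, ‖f' i x‖ₑ := by
    have hpos : 0 < 1 - (r + (bump n).rOut) := by linarith
    filter_upwards [tendsto_bump_rOut.eventually (gt_mem_nhds hpos)] with m hmm
    refine (lintegral_enorm_moll_sub_le_of_contDiff n ((hm m).of_le (by exact_mod_cast le_top))
      le_rfl hr.le).trans (mul_le_mul_right ?_ _)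
    calc ∫⁻ x in Metric.ball (0 : Plane) (r + (bump n).rOut), ‖fderiv ℝ (moll m f) x‖ₑ
        ≤ ∫⁻ x in Metric.ball (0 : Plane) (r + (bump n).rOut), ∑ i, ‖moll m (f' i) x‖ₑ := by
          refine setLIntegral_mono' Metric.isOpen_ball.measurableSet fun x hx => ?_
          refine (enorm_le_dir _).trans_eq (Finset.sum_congr rfl fun i _ => ?_)
          rw [moll_fderiv m (h i) hf (closedBall_subset_disc hx (by linarith))]
      _ = ∑ i, ∫⁻ x in Metric.ball (0 : Plane) (r + (bump n).rOut), ‖moll m (f' i) x‖ₑ :=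
          lintegral_finsetSum _ fun i _ => (moll_contDiff m (hf' i)).continuous.enorm.measurable
      _ ≤ ∑ i, ∫⁻ x in disc, ‖f' i x‖ₑ :=
          Finset.sum_le_sum fun i _ => lintegral_enorm_moll_le m (hf' i) _
  calc ∫⁻ x in Metric.ball (0 : Plane) r, ‖moll n f x - f x‖ₑ
      ≤ ∫⁻ x in Metric.ball (0 : Plane) r,
          liminf (fun m => ‖moll n (moll m f) x - moll m f x‖ₑ) atTop := lintegral_mono_ae hpt
    _ ≤ liminf (fun m => ∫⁻ x in Metric.ball (0 : Plane) r,
          ‖moll n (moll m f) x - moll m f x‖ₑ) atTop := by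
        refine lintegral_liminf_le fun m => Continuous.measurable ?_
        refine Continuous.enorm (Continuous.sub (moll_contDiff n ?_).continuous (hm m).continuous)
        exact ((hm m).continuous.continuousOn.integrableOn_compact isCompact_closedDisc).mono_set
          disc_subset_closedDisc
    _ ≤ _ := liminf_le_of_frequently_le' hev.frequently

/-! ### Weak compactness and Rellich's theorem -/

/-- Finitely many properties that every sequence acquires after passing to a subsequence, and that
survive passing to further subsequences, hold along a common subsequence. -/
theorem exists_common_subseq {ι : Type*} [Finite ι] (Q : ι → (ℕ → ℕ) → Prop)
    (hex : ∀ j s, StrictMono s → ∃ t : ℕ → ℕ, StrictMono t ∧ Q j (s ∘ t))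
    (hst : ∀ j s t, StrictMono t → Q j s → Q j (s ∘ t)) :
    ∃ s, StrictMono s ∧ ∀ j, Q j s := by
  classical
  have := Fintype.ofFinite ι
  suffices H : ∀ A : Finset ι, ∃ s, StrictMono s ∧ ∀ j ∈ A, Q j s by
    obtain ⟨s, hs, h⟩ := H Finset.univ
    exact ⟨s, hs, fun j => h j (Finset.mem_univ j)⟩
  intro A
  induction A using Finset.induction_on with
  | empty => exact ⟨id, strictMono_id, by simp⟩
  | insert a A _ ih =>
    obtain ⟨s, hs, h⟩ := ih
    obtain ⟨t, ht, hQ⟩ := hex a s hs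
    refine ⟨s ∘ t, hs.comp ht, fun j hj => ?_⟩
    rcases Finset.mem_insert.mp hj with rfl | hj
    · exact hQ
    · exact hst j s t ht (h j hj)

theorem exists_weakly_convergent_subseq {H : Type*} [NormedAddCommGroup H] [InnerProductSpace ℝ H]
    [CompleteSpace H] [TopologicalSpace.SeparableSpace H] {x : ℕ → H} {C : ℝ}
    (hx : ∀ l, ‖x l‖ ≤ C) :
    ∃ (y : H) (s : ℕ → ℕ), StrictMono s ∧
      ∀ z, Tendsto (fun l => inner ℝ (x (s l)) z) atTop (𝓝 (inner ℝ y z)) := by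
  obtain ⟨a, -, s, hs, ha⟩ := WeakDual.isSeqCompact_closedBall ℝ H 0 C
    (x := fun l => StrongDual.toWeakDual (InnerProductSpace.toDual ℝ H (x l))) (fun l => by
      rw [mem_preimage, mem_closedBall_zero_iff]
      exact ((InnerProductSpace.toDual ℝ H).norm_map (x l)).trans_le (hx l))
  refine ⟨(InnerProductSpace.toDual ℝ H).symm (WeakDual.toStrongDual a), s, hs, fun z => ?_⟩
  have h := ((WeakDual.eval_continuous z).tendsto a).comp ha
  rw [InnerProductSpace.toDual_symm_apply]
  exact h

instance fact_two_ne_top : Fact ((2 : ℝ≥0∞) ≠ ⊤) := ⟨by simp⟩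

/-- Bounded sequences in `L²(B)` have weakly convergent subsequences. -/
theorem exists_weak_subseq_L2 {a : ℕ → Plane → ℝ} {C : ℝ≥0}
    (ha : ∀ l, MemLp (a l) 2 (volume.restrict disc))
    (hC : ∀ l, eLpNorm (a l) 2 (volume.restrict disc) ≤ C) :
    ∃ (b : Plane → ℝ) (s : ℕ → ℕ), StrictMono s ∧ MemLp b 2 (volume.restrict disc) ∧
      ∀ ψ, MemLp ψ 2 (volume.restrict disc) →
        Tendsto (fun l => ∫ w in disc, a (s l) w * ψ w) atTop (𝓝 (∫ w in disc, b w * ψ w)) := by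
  have hx : ∀ l, ‖(ha l).toLp (a l)‖ ≤ C := fun l => by
    rw [Lp.norm_toLp]
    exact ENNReal.toReal_mono ENNReal.coe_ne_top (hC l)
  obtain ⟨y, s, hs, h⟩ := exists_weakly_convergent_subseq hx
  refine ⟨y, s, hs, Lp.memLp y, fun ψ hψ => ?_⟩
  have e1 : ∀ l, inner ℝ ((ha (s l)).toLp (a (s l))) (hψ.toLp ψ)
      = ∫ w in disc, a (s l) w * ψ w := by
    intro l
    rw [L2.inner_def]
    refine integral_congr_ae ?_
    filter_upwards [(ha (s l)).coeFn_toLp, hψ.coeFn_toLp] with w h1 h2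
    rw [h1, h2]; simp [mul_comm]
  have e2 : inner ℝ y (hψ.toLp ψ) = ∫ w in disc, y w * ψ w := by
    rw [L2.inner_def]
    refine integral_congr_ae ?_
    filter_upwards [hψ.coeFn_toLp] with w h2
    rw [h2]; simp [mul_comm]
  rw [← e2]
  exact (h _).congr e1

/-- A sequence bounded in `L^∞(B)`, with weak gradients bounded in `L¹(B)`, that converges weakly
converges in measure: the mollifications at a fixed scale converge pointwise and boundedly, and the
mollification error is uniformly small on smaller discs. -/
theorem tendstoInMeasure_of_weak {f : ℕ → Plane → ℝ} {f' : ℕ → Fin 2 → Plane → ℝ}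
    {g : Plane → ℝ} {g' : Fin 2 → Plane → ℝ} {C : ℝ} (hC : 0 ≤ C) {G : ℝ≥0}
    (hf : ∀ l, BddW12 (f l) (f' l)) (hb : ∀ l, ∀ᵐ w ∂(volume.restrict disc), |f l w| ≤ C)
    (hG : ∀ l, ∑ i, ∫⁻ w in disc, ‖f' l i w‖ₑ ≤ G)
    (hg : IntegrableOn g disc) (hg' : ∀ i, IntegrableOn (g' i) disc)
    (hgw : ∀ i, HasWeakPartial i g (g' i))
    (hw : ∀ ψ, MemLp ψ 2 (volume.restrict disc) →
      Tendsto (fun l => ∫ w in disc, f l w * ψ w) atTop (𝓝 (∫ w in disc, g w * ψ w))) :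
    TendstoInMeasure (volume.restrict disc) f atTop g := by
  set G' : ℝ≥0∞ := ∑ i, ∫⁻ w in disc, ‖g' i w‖ₑ with hG'
  have hG'top : G' ≠ ⊤ := (ENNReal.sum_lt_top.mpr fun i _ => (hg' i).2).ne
  have hmoll : ∀ n x, Tendsto (fun l => moll n (f l) x) atTop (𝓝 (moll n g x)) := by
    intro n x
    obtain ⟨K, hK⟩ := kernel_bounded n
    have := hw (fun y => kernel n (x - y)) (memLp_top_of_bound ((kernel_contDiff n).continuous.comp
      (by fun_prop)).aestronglyMeasurable K (Eventually.of_forall fun y => hK _) |>.mono_exponent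
        le_top)
    simpa only [moll, mul_comm] using this
  have hmd : ∀ n, Tendsto (fun l => ∫⁻ x in disc, ‖moll n (f l) x - moll n g x‖ₑ) atTop (𝓝 0) := by
    intro n
    have hlim : ∀ x, |moll n g x| ≤ C := fun x =>
      le_of_tendsto (hmoll n x).abs (Eventually.of_forall fun l => abs_moll_le n hC (hb l) x)
    have := tendsto_lintegral_of_dominated_convergence (μ := volume.restrict disc)
      (F := fun l x => ‖moll n (f l) x - moll n g x‖ₑ) (f := fun _ => 0)
      (fun _ => ENNReal.ofReal (C + C)) (fun l => ?_) (fun l => Eventually.of_forall fun x => ?_) ?_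
      (Eventually.of_forall fun x => ?_)
    · simpa using this
    · exact ((moll_contDiff n (hf l).integrableOn).continuous.sub
        (moll_contDiff n hg).continuous).enorm.measurable
    · beta_reduce
      rw [← ofReal_norm]
      refine ENNReal.ofReal_le_ofReal ((norm_sub_le _ _).trans ?_)
      exact add_le_add (abs_moll_le n hC (hb l) x) (hlim x)
    · simp only [lintegral_const]
      exact ENNReal.mul_ne_top ENNReal.ofReal_ne_top (measure_ne_top _ _)
    · simpa using ((hmoll n x).sub_const (moll n g x)).enorm
  -- convergence in `L¹` on each smaller disc
  have hL1 : ∀ r < 1, Tendsto (fun l => ∫⁻ x in Metric.ball (0 : Plane) r, ‖f l x - g x‖ₑ)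
      atTop (𝓝 0) := by
    intro r hr
    have hsub : Metric.ball (0 : Plane) r ⊆ disc := Metric.ball_subset_ball hr.le
    rw [ENNReal.tendsto_nhds_zero]
    intro ε hε
    have hsmall : Tendsto (fun n => ENNReal.ofReal (bump n).rOut * (G + G')) atTop (𝓝 0) := by
      have := ENNReal.Tendsto.mul_const (b := (G + G' : ℝ≥0∞))
        (ENNReal.tendsto_ofReal tendsto_bump_rOut) (Or.inr (by simp [hG'top]))
      simpa using this
    have hε2 : 0 < ε / 2 := ENNReal.half_pos hε.ne'
    obtain ⟨n, hn1, hn2⟩ := ((tendsto_bump_rOut.eventually (gt_mem_nhds (sub_pos.mpr hr))).and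
      (ENNReal.tendsto_nhds_zero.mp hsmall _ hε2)).exists
    have hrn : r + (bump n).rOut < 1 := by linarith
    filter_upwards [ENNReal.tendsto_nhds_zero.mp (hmd n) _ hε2] with l hl
    have hfm := (moll_contDiff n (hf l).integrableOn).continuous
    have hgm := (moll_contDiff n hg).continuous
    have hfae : AEStronglyMeasurable (f l) (volume.restrict (Metric.ball (0 : Plane) r)) :=
      (hf l).bdd.aestronglyMeasurable.mono_measure (Measure.restrict_mono hsub le_rfl)
    calc ∫⁻ x in Metric.ball (0 : Plane) r, ‖f l x - g x‖ₑ
        ≤ ∫⁻ x in Metric.ball (0 : Plane) r, (‖moll n (f l) x - f l x‖ₑ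
            + (‖moll n (f l) x - moll n g x‖ₑ + ‖moll n g x - g x‖ₑ)) := by
          refine lintegral_mono fun x => ?_
          have e : f l x - g x = -(moll n (f l) x - f l x)
            + ((moll n (f l) x - moll n g x) + (moll n g x - g x)) := by ring
          rw [e]
          refine (enorm_add_le _ _).trans ?_
          rw [enorm_neg]
          exact add_le_add_right (enorm_add_le _ _) _
      _ = (∫⁻ x in Metric.ball (0 : Plane) r, ‖moll n (f l) x - f l x‖ₑ)
            + ((∫⁻ x in Metric.ball (0 : Plane) r, ‖moll n (f l) x - moll n g x‖ₑ)
            + ∫⁻ x in Metric.ball (0 : Plane) r, ‖moll n g x - g x‖ₑ) := by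
          have m1 : AEMeasurable (fun x => ‖moll n (f l) x - f l x‖ₑ)
              (volume.restrict (Metric.ball (0 : Plane) r)) :=
            (hfm.aestronglyMeasurable.sub hfae).enorm
          have m2 : Measurable (fun x => ‖moll n (f l) x - moll n g x‖ₑ) :=
            (hfm.sub hgm).enorm.measurable
          rw [lintegral_add_left' m1, lintegral_add_left m2]
      _ ≤ ENNReal.ofReal (bump n).rOut * G + (ε / 2 + ENNReal.ofReal (bump n).rOut * G') := by
          refine add_le_add ?_ (add_le_add ?_ ?_)
          · exact (lintegral_enorm_moll_sub_le n (hf l).integrableOn (hf l).integrableOn_deriv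
              (hf l).weak hrn).trans (mul_le_mul_right (hG l) _)
          · exact (lintegral_mono_set hsub).trans hl
          · exact lintegral_enorm_moll_sub_le n hg hg' hgw hrn
      _ = ε / 2 + ENNReal.ofReal (bump n).rOut * (G + G') := by ring
      _ ≤ ε / 2 + ε / 2 := by gcongr
      _ = ε := ENNReal.add_halves ε
  refine tendstoInMeasure_of_ne_top fun ε hε hεt => ?_
  rw [ENNReal.tendsto_nhds_zero]
  intro δ hδ
  -- the part of `B` near the boundary has small measure
  obtain ⟨r, hr, hrδ⟩ : ∃ r < (1 : ℝ), volume (disc \ Metric.ball (0 : Plane) r) ≤ δ / 2 := by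
    have hanti : Antitone fun n : ℕ => disc \ Metric.ball (0 : Plane) (1 - 1 / ((n : ℝ) + 1)) := by
      intro a b hab
      refine sdiff_subset_sdiff_right (Metric.ball_subset_ball ?_)
      have : 1 / ((b : ℝ) + 1) ≤ 1 / ((a : ℝ) + 1) := by
        apply one_div_le_one_div_of_le (by positivity)
        have : (a : ℝ) ≤ b := by exact_mod_cast hab
        linarith
      linarith
    have hinter : ⋂ n : ℕ, disc \ Metric.ball (0 : Plane) (1 - 1 / ((n : ℝ) + 1)) = ∅ := by
      refine eq_empty_of_forall_notMem fun x hx => ?_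
      rw [mem_iInter] at hx
      have hx1 : ‖x‖ < 1 := by simpa [disc] using (hx 0).1
      obtain ⟨n, hn⟩ := exists_nat_one_div_lt (sub_pos.mpr hx1)
      refine (hx n).2 ?_
      rw [mem_ball_zero_iff]; linarith
    have ht := tendsto_measure_iInter_atTop (μ := (volume : Measure Plane))
      (fun n => (measurableSet_disc.diff Metric.isOpen_ball.measurableSet).nullMeasurableSet) hanti
      ⟨0, ((measure_mono sdiff_subset).trans_lt measure_ball_lt_top).ne⟩
    rw [hinter, measure_empty] at ht
    obtain ⟨n, hn⟩ := (ENNReal.tendsto_nhds_zero.mp ht _ (ENNReal.half_pos hδ.ne')).exists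
    refine ⟨_, ?_, hn⟩
    have : (0 : ℝ) < 1 / ((n : ℝ) + 1) := by positivity
    linarith
  have hsub : Metric.ball (0 : Plane) r ⊆ disc := Metric.ball_subset_ball hr.le
  have hdiv : Tendsto (fun l => (∫⁻ x in Metric.ball (0 : Plane) r, ‖f l x - g x‖ₑ) / ε)
      atTop (𝓝 0) := by
    have := ENNReal.Tendsto.div_const (hL1 r hr) (Or.inr hε.ne')
    simpa using this
  filter_upwards [ENNReal.tendsto_nhds_zero.mp hdiv _ (ENNReal.half_pos hδ.ne')] with l hl
  have hae : AEMeasurable (fun x => ‖f l x - g x‖ₑ)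
      (volume.restrict (Metric.ball (0 : Plane) r)) :=
    (((hf l).bdd.aestronglyMeasurable.sub hg.aestronglyMeasurable).mono_measure
      (Measure.restrict_mono hsub le_rfl)).enorm
  have hsplit : (volume : Measure Plane).restrict disc
      = volume.restrict (Metric.ball 0 r) + volume.restrict (disc \ Metric.ball 0 r) := by
    rw [← Measure.restrict_union disjoint_sdiff_right
      (measurableSet_disc.diff Metric.isOpen_ball.measurableSet), union_sdiff_cancel hsub]
  calc volume.restrict disc {x | ε ≤ edist (f l x) (g x)}
      = volume.restrict (Metric.ball 0 r) {x | ε ≤ ‖f l x - g x‖ₑ}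
        + volume.restrict (disc \ Metric.ball 0 r) {x | ε ≤ ‖f l x - g x‖ₑ} := by
        rw [hsplit]; simp only [edist_eq_enorm_sub]; rfl
    _ ≤ δ / 2 + δ / 2 := by
        refine add_le_add ((meas_ge_le_lintegral_div hae hε.ne' hεt).trans hl) ?_
        refine (measure_mono (subset_univ _)).trans ?_
        rw [Measure.restrict_apply_univ]; exact hrδ
    _ = δ := ENNReal.add_halves δ

/-- Rellich compactness: a sequence bounded in `W^{1,2}(B) ∩ L^∞(B)` has a subsequence that
converges a.e., with weakly convergent gradients, to a function in this space. -/
theorem exists_rellich_subseq {f : ℕ → Plane → ℝ} {f' : ℕ → Fin 2 → Plane → ℝ}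
    {C : ℝ} (hC : 0 ≤ C) {G : ℝ≥0} (hf : ∀ l, BddW12 (f l) (f' l))
    (hb : ∀ l, ∀ᵐ w ∂(volume.restrict disc), |f l w| ≤ C)
    (hG : ∀ l i, eLpNorm (f' l i) 2 (volume.restrict disc) ≤ G) :
    ∃ (s : ℕ → ℕ), StrictMono s ∧ ∃ (g : Plane → ℝ) (g' : Fin 2 → Plane → ℝ), BddW12 g g' ∧
      (∀ᵐ w ∂(volume.restrict disc), Tendsto (fun l => f (s l) w) atTop (𝓝 (g w))) ∧
      ∀ i ψ, MemLp ψ 2 (volume.restrict disc) →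
        Tendsto (fun l => ∫ w in disc, f' (s l) i w * ψ w) atTop
          (𝓝 (∫ w in disc, g' i w * ψ w)) := by
  have hvol : (volume.restrict disc (univ : Set Plane)) ≠ ⊤ := measure_ne_top _ _
  have hf2 : ∀ l, eLpNorm (f l) 2 (volume.restrict disc)
      ≤ ((volume.restrict disc (univ : Set Plane)) ^ (2 : ℝ≥0∞).toReal⁻¹
        * ENNReal.ofReal C).toNNReal := by
    intro l
    rw [ENNReal.coe_toNNReal (ENNReal.mul_ne_top (ENNReal.rpow_ne_top_of_nonneg (by simp) hvol)
      ENNReal.ofReal_ne_top)]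
    exact eLpNorm_le_of_ae_bound (hb l)
  obtain ⟨s, hs, hQ⟩ := exists_common_subseq (ι := Option (Fin 2))
    (fun j s => ∃ b : Plane → ℝ, MemLp b 2 (volume.restrict disc) ∧
      ∀ ψ, MemLp ψ 2 (volume.restrict disc) →
        Tendsto (fun l => ∫ w in disc, (j.elim (f (s l)) (f' (s l))) w * ψ w) atTop
          (𝓝 (∫ w in disc, b w * ψ w))) (by
      rintro (_ | i) s hs
      · obtain ⟨b, t, ht, hb2, hbt⟩ := exists_weak_subseq_L2 (a := fun l => f (s l))
          (fun l => (hf (s l)).bdd.mono_exponent le_top) (fun l => hf2 (s l))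
        exact ⟨t, ht, b, hb2, hbt⟩
      · obtain ⟨b, t, ht, hb2, hbt⟩ := exists_weak_subseq_L2 (a := fun l => f' (s l) i)
          (fun l => (hf (s l)).sq i) (fun l => hG (s l) i)
        exact ⟨t, ht, b, hb2, hbt⟩) (by
      rintro j s t ht ⟨b, hb2, hbt⟩
      exact ⟨b, hb2, fun ψ hψ => (hbt ψ hψ).comp ht.tendsto_atTop⟩)
  choose b hb2 hbt using hQ
  have hgi : IntegrableOn (b none) disc := MemLp.integrableOn_disc (hb2 none) one_le_two
  have hgi' : ∀ i, IntegrableOn (b (some i)) disc :=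
    fun i => MemLp.integrableOn_disc (hb2 (some i)) one_le_two
  have htest : ∀ φ : Plane → ℝ, Continuous φ → HasCompactSupport φ →
      MemLp φ 2 (volume.restrict disc) := fun φ hφ hc => by
    obtain ⟨K, hK⟩ := hc.exists_bound_of_continuous hφ
    exact (memLp_top_of_bound hφ.aestronglyMeasurable K (Eventually.of_forall hK)).mono_exponent
      le_top
  have hweak : ∀ i, HasWeakPartial i (b none) (b (some i)) := by
    refine fun i => ⟨hgi.locallyIntegrableOn, (hgi' i).locallyIntegrableOn, fun φ hφ hc hsφ => ?_⟩
    have l1 := hbt none _ (htest _ (continuous_fderiv_dir hφ i) (hasCompactSupport_fderiv_dir hc i))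
    have l2 := (hbt (some i) _ (htest φ hφ.continuous hc)).neg
    simp only [smul_eq_mul]
    simp only [mul_comm (fderiv ℝ φ _ _), mul_comm (φ _)]
    refine tendsto_nhds_unique (l1.congr fun l => ?_) l2
    have := ((hf (s l)).weak i).2.2 φ hφ hc hsφ
    simp only [smul_eq_mul, mul_comm (fderiv ℝ φ _ _), mul_comm (φ _)] at this
    exact this
  have hGsum : ∀ l, ∑ i, ∫⁻ w in disc, ‖f' (s l) i w‖ₑ
      ≤ (2 * ((volume.restrict disc (univ : Set Plane)) ^ (1 / (1 : ℝ≥0∞).toReal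
        - 1 / (2 : ℝ≥0∞).toReal) * (G : ℝ≥0∞))).toNNReal := by
    intro l
    rw [ENNReal.coe_toNNReal (ENNReal.mul_ne_top (by simp) (ENNReal.mul_ne_top
      (ENNReal.rpow_ne_top_of_nonneg (by norm_num) hvol) ENNReal.coe_ne_top))]
    rw [Fin.sum_univ_two, two_mul]
    have h1 : ∀ i, ∫⁻ w in disc, ‖f' (s l) i w‖ₑ ≤ (volume.restrict disc (univ : Set Plane)) ^
        (1 / (1 : ℝ≥0∞).toReal - 1 / (2 : ℝ≥0∞).toReal) * (G : ℝ≥0∞) := fun i => by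
      rw [← eLpNorm_one_eq_lintegral_enorm, mul_comm]
      exact (eLpNorm_le_eLpNorm_mul_rpow_measure_univ one_le_two
        ((hf (s l)).sq i).aestronglyMeasurable).trans (mul_le_mul_left (hG (s l) i) _)
    exact add_le_add (h1 0) (h1 1)
  have hmeas := tendstoInMeasure_of_weak hC (fun l => hf (s l)) (fun l => hb (s l)) hGsum hgi hgi'
    hweak (hbt none)
  obtain ⟨t, ht, hae⟩ := hmeas.exists_seq_tendsto_ae
  have hbdd : ∀ᵐ w ∂(volume.restrict disc), |b none w| ≤ C := by
    filter_upwards [hae, ae_all_iff.mpr hb] with w hw hwb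
    exact le_of_tendsto hw.abs (Eventually.of_forall fun l => hwb _)
  refine ⟨s ∘ t, hs.comp ht, b none, fun i => b (some i),
    ⟨memLp_top_of_bound (hb2 none).aestronglyMeasurable C hbdd, hweak, fun i => hb2 (some i)⟩,
    hae, fun i ψ hψ => (hbt (some i) ψ hψ).comp ht.tendsto_atTop⟩

/-! ### Total torsion in conformal parameters -/

variable {n k : ℕ} {α : ℝ≥0} {X : Plane → Ambient n}

theorem tangent_contDiffOn (hX : IsConformalImmersion k α X) (hk : 3 ≤ k) (i : Fin 2) :
    ContDiffOn ℝ 1 (tangent X i) closedDisc := by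
  have h : ContDiffOn ℝ 2 X closedDisc :=
    hX.regular.1.of_le (by exact_mod_cast (by omega : 2 ≤ k))
  exact (h.fderivWithin uniqueDiffOn_closedDisc (m := 1) (by norm_num)).clm_apply contDiffOn_const

/-- The conformal factor `g₁₁ = g₂₂`. -/
def conformalFactor (X : Plane → Ambient n) (w : Plane) : ℝ := metric X w 0 0

theorem conformalFactor_pos (hX : IsConformalImmersion k α X) {w : Plane} (hw : w ∈ closedDisc) :
    0 < conformalFactor X w := (hX.conformal w hw).2.1

theorem inner_tangent (hX : IsConformalImmersion k α X) {w : Plane} (hw : w ∈ closedDisc)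
    (i j : Fin 2) :
    inner ℝ (tangent X i w) (tangent X j w) = if i = j then conformalFactor X w else 0 := by
  obtain ⟨h1, -, h2⟩ := hX.conformal w hw
  have h3 : metric X w 1 0 = metric X w 0 1 :=
    real_inner_comm (tangent X 0 w) (tangent X 1 w)
  change metric X w i j = _
  fin_cases i <;> fin_cases j <;> simp [conformalFactor, h1, h2, h3]

theorem metric_eq_smul_one (hX : IsConformalImmersion k α X) {w : Plane} (hw : w ∈ closedDisc) :
    metric X w = conformalFactor X w • (1 : Matrix (Fin 2) (Fin 2) ℝ) := by
  ext i j
  rw [show metric X w i j = _ from inner_tangent hX hw i j]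
  simp [Matrix.one_apply]

theorem areaElement_eq (hX : IsConformalImmersion k α X) {w : Plane} (hw : w ∈ closedDisc) :
    areaElement X w = conformalFactor X w := by
  have hpos := conformalFactor_pos hX hw
  rw [areaElement, metric_eq_smul_one hX hw]
  simp [Real.sqrt_mul_self hpos.le]

/-- In conformal parameters `g^{ij} W = δ^{ij}`. -/
theorem inv_metric_mul_areaElement (hX : IsConformalImmersion k α X) {w : Plane}
    (hw : w ∈ closedDisc) (i j : Fin 2) :
    (metric X w)⁻¹ i j * areaElement X w = if i = j then 1 else 0 := by
  have hpos := conformalFactor_pos hX hw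
  have hinv : (metric X w)⁻¹ = (conformalFactor X w)⁻¹ • (1 : Matrix (Fin 2) (Fin 2) ℝ) := by
    refine Matrix.inv_eq_right_inv ?_
    rw [metric_eq_smul_one hX hw]
    simp [smul_smul, hpos.ne']
  rw [areaElement_eq hX hw, hinv]
  by_cases h : i = j <;> simp [h, hpos.ne']

theorem memLp_inner {d : ℕ} {f g : Plane → EuclideanSpace ℝ (Fin d)}
    (hf : MemLp f 2 (volume.restrict disc)) (hg : MemLp g ∞ (volume.restrict disc)) :
    MemLp (fun w => inner ℝ (f w) (g w)) 2 (volume.restrict disc) := by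
  simp only [inner_eq_sum]
  exact memLp_finsetSum _ fun c _ => (hg.eval_piLp c).mul (hf.eval_piLp c)

variable {N : Fin n → Plane → Ambient n}

theorem IsWeakNormalFrame.bddW12 (hN : IsWeakNormalFrame X N) (σ : Fin n) :
    BddW12 (N σ) (fun i => weakPartial i (N σ)) :=
  bddW12_weakPartial (hN.bounded σ) (hN.sobolev σ)

theorem IsWeakNormalFrame.memLp_torsion (hN : IsWeakNormalFrame X N) (σ ϑ : Fin n) (i : Fin 2) :
    MemLp (torsion N σ ϑ i) 2 (volume.restrict disc) :=
  memLp_inner ((hN.bddW12 σ).sq i) (hN.bounded ϑ)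

theorem IsWeakNormalFrame.integrable_torsion_sq (hN : IsWeakNormalFrame X N) (σ ϑ : Fin n)
    (i : Fin 2) : IntegrableOn (fun w => torsion N σ ϑ i w ^ 2) disc :=
  (hN.memLp_torsion σ ϑ i).integrable_sq

theorem IsWeakNormalFrame.torsion_antisymm (hN : IsWeakNormalFrame X N) (σ ϑ : Fin n) (i : Fin 2) :
    ∀ᵐ w ∂(volume.restrict disc), torsion N ϑ σ i w = - torsion N σ ϑ i w := by
  have h := ((hN.bddW12 σ).inner (hN.bddW12 ϑ)).ae_eq_of_ae_eq
    (bddW12_const (if σ = ϑ then 1 else 0)) (by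
      filter_upwards [hN.orthonormal] with w hw
      exact orthonormal_iff_ite.mp hw σ ϑ) i
  filter_upwards [h] with w hw
  rw [torsion, torsion, real_inner_comm]
  linarith

/-- In conformal parameters the total torsion is the Dirichlet-type energy `∑ ∬ |T|²`. -/
theorem totalTorsion_eq_sum (hX : IsConformalImmersion k α X) (N : Fin n → Plane → Ambient n) :
    totalTorsion X N = ∑ i : Fin 2, ∑ σ, ∑ ϑ, ∫ w in disc, torsion N σ ϑ i w ^ 2 := by
  have h1 : ∀ i j σ ϑ, ∫ w in disc, (metric X w)⁻¹ i j * torsion N σ ϑ i w * torsion N σ ϑ j w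
      * areaElement X w = if i = j then ∫ w in disc, torsion N σ ϑ i w ^ 2 else 0 := by
    intro i j σ ϑ
    have h2 : ∫ w in disc, (metric X w)⁻¹ i j * torsion N σ ϑ i w * torsion N σ ϑ j w
      * areaElement X w = ∫ w in disc, (if i = j then 1 else 0) * (torsion N σ ϑ i w *
        torsion N σ ϑ j w) := by
      refine setIntegral_congr_fun measurableSet_disc fun w hw => ?_
      rw [← inv_metric_mul_areaElement hX (disc_subset_closedDisc hw)]
      ring
    rw [h2]
    split_ifs with h
    · subst h; simp [sq]
    · simp
  simp only [totalTorsion, h1]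
  refine Finset.sum_congr rfl fun i _ => ?_
  rw [Finset.sum_eq_single i (fun j _ hj => by simp [Ne.symm hj]) (by simp)]
  simp only [if_true]

theorem IsWeakNormalFrame.integrable_sum_torsion_sq (hN : IsWeakNormalFrame X N) (i : Fin 2) :
    IntegrableOn (fun w => ∑ σ, ∑ ϑ, torsion N σ ϑ i w ^ 2) disc :=
  integrable_finsetSum _ fun σ _ => integrable_finsetSum _ fun ϑ _ => hN.integrable_torsion_sq σ ϑ i

theorem totalTorsion_eq (hX : IsConformalImmersion k α X) (hN : IsWeakNormalFrame X N) :
    totalTorsion X N = ∑ i : Fin 2, ∫ w in disc, ∑ σ, ∑ ϑ, torsion N σ ϑ i w ^ 2 := by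
  rw [totalTorsion_eq_sum hX]
  refine Finset.sum_congr rfl fun i _ => ?_
  rw [integral_finsetSum _ fun σ _ => integrable_finsetSum _ fun ϑ _ =>
    hN.integrable_torsion_sq σ ϑ i]
  refine Finset.sum_congr rfl fun σ _ => ?_
  rw [integral_finsetSum _ fun ϑ _ => hN.integrable_torsion_sq σ ϑ i]

theorem totalTorsion_nonneg (hX : IsConformalImmersion k α X) (N : Fin n → Plane → Ambient n) :
    0 ≤ totalTorsion X N := by
  rw [totalTorsion_eq_sum hX]
  exact Finset.sum_nonneg fun i _ => Finset.sum_nonneg fun σ _ => Finset.sum_nonneg fun ϑ _ =>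
    integral_nonneg fun w => sq_nonneg _

/-! ### Orthonormal bases adapted to the surface -/

/-- The columns `X_u, X_v, v_1, …, v_n` of the determinant that fixes the orientation. -/
def columns (X : Plane → Ambient n) (w : Plane) (v : Fin n → Ambient n) :
    Fin (n + 2) → Ambient n :=
  Matrix.vecCons (tangent X 0 w) (Matrix.vecCons (tangent X 1 w) v)

theorem frameDet_eq (X : Plane → Ambient n) (N : Fin n → Plane → Ambient n) (w : Plane) :
    frameDet X N w = (Matrix.of fun r c => columns X w (fun σ => N σ w) c r).det := rfl

theorem mem_normalSpace_iff {w : Plane} {v : Ambient n} :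
    v ∈ normalSpace X w ↔ ∀ i, inner ℝ (tangent X i w) v = 0 := by
  rw [normalSpace, tangentSpace, Submodule.mem_orthogonal]
  constructor
  · exact fun h i => h _ (Submodule.subset_span ⟨i, rfl⟩)
  · intro h u hu
    induction hu using Submodule.span_induction with
    | mem x hx => obtain ⟨i, rfl⟩ := hx; exact h i
    | zero => exact inner_zero_left _
    | add x y _ _ hx hy => rw [inner_add_left, hx, hy, add_zero]
    | smul a x _ hx => rw [inner_smul_left, hx, mul_zero]

theorem inner_columns (hX : IsConformalImmersion k α X) {w : Plane} (hw : w ∈ closedDisc)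
    {v : Fin n → Ambient n} (hv : Orthonormal ℝ v) (hvn : ∀ σ, v σ ∈ normalSpace X w)
    (a b : Fin (n + 2)) :
    inner ℝ (columns X w v a) (columns X w v b) = if a = b then
      (Matrix.vecCons (conformalFactor X w) (Matrix.vecCons (conformalFactor X w) fun _ => 1) :
        Fin (n + 2) → ℝ) a else 0 := by
  have ht := inner_tangent hX hw
  have h1 : ∀ i σ, inner ℝ (tangent X i w) (v σ) = 0 := fun i σ => mem_normalSpace_iff.mp (hvn σ) i
  have h2 : ∀ i σ, inner ℝ (v σ) (tangent X i w) = 0 := fun i σ => by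
    rw [real_inner_comm]; exact h1 i σ
  have h3 := orthonormal_iff_ite.mp hv
  have h4 : ∀ i, ‖tangent X i w‖ ^ 2 = conformalFactor X w := fun i => by
    rw [← real_inner_self_eq_norm_sq, ht, if_pos rfl]
  refine Fin.cases ?_ (fun a => Fin.cases ?_ (fun a => ?_) a) a <;>
  refine Fin.cases ?_ (fun b => Fin.cases ?_ (fun b => ?_) b) b <;>
  simp [columns, ht, h1, h2, h3, h4, (Fin.succ_ne_zero _).symm, Fin.ext_iff]

theorem frameDet_ne_zero (hX : IsConformalImmersion k α X) {w : Plane} (hw : w ∈ closedDisc)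
    (hv : Orthonormal ℝ fun σ => N σ w) (hvn : ∀ σ, N σ w ∈ normalSpace X w) :
    frameDet X N w ≠ 0 := by
  have hpos := conformalFactor_pos hX hw
  set A : Matrix (Fin (n + 2)) (Fin (n + 2)) ℝ :=
    Matrix.of fun r c => columns X w (fun σ => N σ w) c r with hA
  have hG : A.transpose * A = Matrix.diagonal (Matrix.vecCons (conformalFactor X w)
      (Matrix.vecCons (conformalFactor X w) fun _ => 1)) := by
    ext a b
    rw [Matrix.diagonal_apply, ← inner_columns hX hw hv hvn a b, inner_eq_sum, Matrix.mul_apply]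
    rfl
  have hd := congrArg Matrix.det hG
  rw [Matrix.det_mul, Matrix.det_transpose, Matrix.det_diagonal] at hd
  intro h0
  rw [frameDet_eq, ← hA] at h0
  rw [h0, Fin.prod_univ_succ, Fin.prod_univ_succ] at hd
  simp [hpos.ne'] at hd

theorem finrank_normalSpace (hX : IsConformalImmersion k α X) {w : Plane} (hw : w ∈ closedDisc) :
    Module.finrank ℝ (normalSpace X w) = n := by
  have h1 : Module.finrank ℝ (tangentSpace X w) = 2 := by
    rw [tangentSpace, finrank_span_eq_card (hX.immersion w hw)]; rfl
  have h2 := Submodule.finrank_add_finrank_orthogonal (tangentSpace X w)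
  rw [h1, finrank_euclideanSpace_fin] at h2
  rw [normalSpace]
  omega

theorem span_eq_normalSpace (hX : IsConformalImmersion k α X) {w : Plane} (hw : w ∈ closedDisc)
    {v : Fin n → Ambient n} (hv : LinearIndependent ℝ v) (hvn : ∀ σ, v σ ∈ normalSpace X w) :
    Submodule.span ℝ (range v) = normalSpace X w := by
  refine Submodule.eq_of_le_of_finrank_eq (Submodule.span_le.mpr ?_) ?_
  · rintro _ ⟨σ, rfl⟩; exact hvn σ
  · rw [finrank_span_eq_card hv]
    rw [finrank_normalSpace hX hw, Fintype.card_fin]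

/-- Parseval's identity for the adapted frame. -/
theorem norm_sq_eq_normal_add_tangential (hX : IsConformalImmersion k α X) {w : Plane}
    (hw : w ∈ closedDisc) {v : Fin n → Ambient n} (hv : Orthonormal ℝ v)
    (hvn : ∀ σ, v σ ∈ normalSpace X w) (x : Ambient n) :
    ‖x‖ ^ 2 = ∑ σ, inner ℝ x (v σ) ^ 2
      + ∑ i, inner ℝ x (tangent X i w) ^ 2 / conformalFactor X w := by
  have hpos := conformalFactor_pos hX hw
  have hs := Real.sq_sqrt hpos.le
  have hs0 : √(conformalFactor X w) ≠ 0 := (Real.sqrt_pos.mpr hpos).ne'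
  set μ : Fin (n + 2) → ℝ := Matrix.vecCons (√(conformalFactor X w))⁻¹
    (Matrix.vecCons (√(conformalFactor X w))⁻¹ fun _ => 1) with hμ
  have hmul : ∀ a, μ a * μ a * (Matrix.vecCons (conformalFactor X w)
      (Matrix.vecCons (conformalFactor X w) fun _ => 1) : Fin (n + 2) → ℝ) a = 1 := by
    intro a
    refine Fin.cases ?_ (fun a => Fin.cases ?_ (fun a => ?_) a) a
    · simp only [hμ, Matrix.cons_val_zero]; rw [← mul_inv, ← sq, hs]; exact inv_mul_cancel₀ hpos.ne'
    · simp only [hμ, Matrix.cons_val_succ, Matrix.cons_val_zero]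
      rw [← mul_inv, ← sq, hs]; exact inv_mul_cancel₀ hpos.ne'
    · simp [hμ]
  have ho : Orthonormal ℝ fun a => μ a • columns X w v a := by
    rw [orthonormal_iff_ite]
    intro a b
    rw [real_inner_smul_left, real_inner_smul_right, inner_columns hX hw hv hvn]
    split_ifs with h
    · subst h; rw [← mul_assoc]; exact hmul a
    · simp
  have hcard : Fintype.card (Fin (n + 2)) = Module.finrank ℝ (Ambient n) := by simp
  set B := basisOfOrthonormalOfCardEqFinrank ho hcard
  have hB : ⇑B = fun a => μ a • columns X w v a := coe_basisOfOrthonormalOfCardEqFinrank ho hcard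
  have hsum := (B.toOrthonormalBasis (by rw [hB]; exact ho)).sum_sq_norm_inner_left x
  rw [← hsum]
  simp only [Module.Basis.coe_toOrthonormalBasis, hB, Real.norm_eq_abs, sq_abs,
    real_inner_smul_right]
  rw [Fin.sum_univ_succ, Fin.sum_univ_succ, Fin.sum_univ_two]
  simp only [hμ, columns, Matrix.cons_val_zero, Matrix.cons_val_succ, one_mul, mul_pow, inv_pow,
    hs]
  ring

theorem IsWeakNormalFrame.mem_normalSpace (hN : IsWeakNormalFrame X N) :
    ∀ᵐ w ∂(volume.restrict disc), ∀ σ, N σ w ∈ normalSpace X w := by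
  filter_upwards [hN.spans] with w hw σ
  rw [← hw]
  exact Submodule.subset_span ⟨σ, rfl⟩

/-- A criterion for weak normal frames: spanning and a nonzero determinant are automatic. -/
theorem isWeakNormalFrame_of (hX : IsConformalImmersion k α X)
    {N' : Fin n → Fin 2 → Plane → Ambient n} (hN : ∀ σ, BddW12 (N σ) (N' σ))
    (ho : ∀ᵐ w ∂(volume.restrict disc), Orthonormal ℝ fun σ => N σ w)
    (hn : ∀ᵐ w ∂(volume.restrict disc), ∀ σ, N σ w ∈ normalSpace X w)
    (hd : ∀ᵐ w ∂(volume.restrict disc), 0 ≤ frameDet X N w) : IsWeakNormalFrame X N where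
  sobolev σ := (hN σ).memW12
  bounded σ := (hN σ).bdd
  orthonormal := ho
  spans := by
    filter_upwards [ho, hn, ae_restrict_mem measurableSet_disc] with w h1 h2 hw
    exact span_eq_normalSpace hX (disc_subset_closedDisc hw) h1.linearIndependent h2
  oriented := by
    filter_upwards [ho, hn, hd, ae_restrict_mem measurableSet_disc] with w h1 h2 h3 hw
    exact lt_of_le_of_ne h3 (frameDet_ne_zero hX (disc_subset_closedDisc hw) h1 h2).symm

/-! ### Rotation of a normal frame -/

/-- The block matrix with blocks `1` and `S`. -/
def oneBlock {m : ℕ} (S : Matrix (Fin m) (Fin m) ℝ) : Matrix (Fin (m + 1)) (Fin (m + 1)) ℝ :=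
  fun a b => Fin.cases (Fin.cases 1 (fun _ => 0) b) (fun a' => Fin.cases 0 (fun b' => S a' b') b) a

theorem oneBlock_zero_zero {m : ℕ} (S : Matrix (Fin m) (Fin m) ℝ) : oneBlock S 0 0 = 1 := rfl

theorem oneBlock_zero_succ {m : ℕ} (S : Matrix (Fin m) (Fin m) ℝ) (b : Fin m) :
    oneBlock S 0 b.succ = 0 := rfl

theorem oneBlock_succ_zero {m : ℕ} (S : Matrix (Fin m) (Fin m) ℝ) (a : Fin m) :
    oneBlock S a.succ 0 = 0 := rfl

theorem oneBlock_succ_succ {m : ℕ} (S : Matrix (Fin m) (Fin m) ℝ) (a b : Fin m) :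
    oneBlock S a.succ b.succ = S a b := rfl

theorem det_oneBlock {m : ℕ} (S : Matrix (Fin m) (Fin m) ℝ) : (oneBlock S).det = S.det := by
  rw [Matrix.det_succ_row_zero, Fin.sum_univ_succ]
  simp only [oneBlock_zero_zero, oneBlock_zero_succ, mul_zero, zero_mul, Finset.sum_const_zero,
    add_zero, Fin.val_zero, pow_zero, one_mul]
  congr 1

theorem frameDet_rotate (R : Plane → Matrix (Fin n) (Fin n) ℝ) (w : Plane) :
    frameDet X (rotate R N) w = (R w).det * frameDet X N w := by
  have h : (Matrix.of fun r c => columns X w (fun σ => rotate R N σ w) c r)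
      = (Matrix.of fun r c => columns X w (fun σ => N σ w) c r)
        * oneBlock (oneBlock (R w).transpose) := by
    ext r c
    rw [Matrix.mul_apply, Fin.sum_univ_succ, Fin.sum_univ_succ]
    refine Fin.cases ?_ (fun c => Fin.cases ?_ (fun c => ?_) c) c
    all_goals
      simp only [columns, oneBlock_zero_zero, oneBlock_zero_succ, oneBlock_succ_zero,
        oneBlock_succ_succ, Matrix.of_apply, Matrix.cons_val_zero, Matrix.cons_val_succ, mul_one,
        mul_zero, add_zero, zero_add, Finset.sum_const_zero, Matrix.transpose_apply]
    rw [rotate, WithLp.ofLp_sum, Finset.sum_apply]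
    exact Finset.sum_congr rfl fun ϑ _ => mul_comm _ _
  rw [frameDet_eq, frameDet_eq, h, Matrix.det_mul, det_oneBlock, det_oneBlock,
    Matrix.det_transpose, mul_comm]

/-- The sum of the squares of the entries is invariant under right multiplication by an
orthogonal matrix. -/
theorem sum_sq_mul_transpose {R : Matrix (Fin n) (Fin n) ℝ} (hR : R.transpose * R = 1)
    (M : Matrix (Fin n) (Fin n) ℝ) :
    ∑ σ, ∑ ϑ, (M * R.transpose) σ ϑ ^ 2 = ∑ σ, ∑ ϑ, M σ ϑ ^ 2 := by
  have h : ∀ A : Matrix (Fin n) (Fin n) ℝ, ∑ σ, ∑ ϑ, A σ ϑ ^ 2 = (A * A.transpose).trace := by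
    intro A
    simp [Matrix.trace, Matrix.mul_apply, sq]
  rw [h, h, Matrix.transpose_mul, Matrix.transpose_transpose, Matrix.mul_assoc,
    ← Matrix.mul_assoc R.transpose, hR, Matrix.one_mul]

theorem sum_sq_mul_left {R : Matrix (Fin n) (Fin n) ℝ} (hR : R.transpose * R = 1)
    (M : Matrix (Fin n) (Fin n) ℝ) :
    ∑ σ, ∑ ϑ, (R * M) σ ϑ ^ 2 = ∑ σ, ∑ ϑ, M σ ϑ ^ 2 := by
  have h := sum_sq_mul_transpose hR M.transpose
  rw [← Matrix.transpose_mul] at h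
  rw [Finset.sum_comm, Finset.sum_comm (f := fun σ ϑ => M σ ϑ ^ 2)]
  simpa [Matrix.transpose_apply] using h

/-- The torsion coefficients in direction `u^i` as a skew-symmetric matrix. -/
def torsionMatrix (N : Fin n → Plane → Ambient n) (i : Fin 2) (w : Plane) :
    Matrix (Fin n) (Fin n) ℝ := Matrix.of fun σ ϑ => torsion N σ ϑ i w

/-- The entrywise partial derivative of a matrix-valued map. -/
def matrixPartial (R : Plane → Matrix (Fin n) (Fin n) ℝ) (i : Fin 2) (w : Plane) :
    Matrix (Fin n) (Fin n) ℝ := Matrix.of fun σ ϑ => fderiv ℝ (fun w => R w σ ϑ) w (dir i)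

/-- A map from the closed disc to `SO(n)` that is continuously differentiable up to the
boundary. -/
structure IsRotationField (R : Plane → Matrix (Fin n) (Fin n) ℝ) : Prop where
  contDiff : ∀ σ ϑ, ContDiffOn ℝ 1 (fun w => R w σ ϑ) closedDisc
  special : ∀ w ∈ closedDisc, R w ∈ Matrix.specialOrthogonalGroup (Fin n) ℝ

theorem mul_transpose_of_special {R : Matrix (Fin n) (Fin n) ℝ}
    (h : R ∈ Matrix.specialOrthogonalGroup (Fin n) ℝ) : R * R.transpose = 1 := by
  have h1 := (Matrix.mem_specialOrthogonalGroup_iff.mp h).1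
  simpa [Matrix.star_eq_conjTranspose] using (Matrix.mem_orthogonalGroup_iff (Fin n) ℝ).mp h1

theorem det_of_special {R : Matrix (Fin n) (Fin n) ℝ}
    (h : R ∈ Matrix.specialOrthogonalGroup (Fin n) ℝ) : R.det = 1 :=
  (Matrix.mem_specialOrthogonalGroup_iff.mp h).2

theorem IsWeakNormalFrame.bddW12_rotate (hN : IsWeakNormalFrame X N)
    {R : Plane → Matrix (Fin n) (Fin n) ℝ} (hR : IsRotationField R) (σ : Fin n) :
    BddW12 (rotate R N σ) (fun i w => ∑ ϑ, (matrixPartial R i w σ ϑ • N ϑ w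
      + R w σ ϑ • weakPartial i (N ϑ) w)) :=
  bddW12_vec_sum Finset.univ fun ϑ _ => (bddW12_of_contDiffOn (hR.contDiff σ ϑ)).smul (hN.bddW12 ϑ)

theorem inner_rotate {R : Plane → Matrix (Fin n) (Fin n) ℝ} {w : Plane}
    (ho : Orthonormal ℝ fun σ => N σ w) (S : Matrix (Fin n) (Fin n) ℝ) (σ ϑ : Fin n) :
    inner ℝ (∑ β, S σ β • N β w) (rotate R N ϑ w) = (S * (R w).transpose) σ ϑ := by
  rw [rotate, sum_inner, Matrix.mul_apply]
  refine Finset.sum_congr rfl fun β _ => ?_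
  rw [real_inner_smul_left, ho.inner_right_fintype]
  rfl

theorem IsWeakNormalFrame.rotate (hX : IsConformalImmersion k α X) (hN : IsWeakNormalFrame X N)
    {R : Plane → Matrix (Fin n) (Fin n) ℝ} (hR : IsRotationField R) :
    IsWeakNormalFrame X (rotate R N) := by
  refine isWeakNormalFrame_of hX (hN.bddW12_rotate hR) ?_ ?_ ?_
  · filter_upwards [hN.orthonormal, ae_restrict_mem measurableSet_disc] with w ho hw
    rw [orthonormal_iff_ite]
    intro σ ϑ
    have h1 := mul_transpose_of_special (hR.special w (disc_subset_closedDisc hw))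
    have h2 : inner ℝ (∑ β, R w σ β • N β w) (CoulombFrame.rotate R N ϑ w)
      = (R w * (R w).transpose) σ ϑ := inner_rotate ho (R w) σ ϑ
    rw [h1, Matrix.one_apply] at h2
    exact h2
  · filter_upwards [hN.mem_normalSpace] with w hw σ
    exact Submodule.sum_mem _ fun ϑ _ => Submodule.smul_mem _ _ (hw ϑ)
  · filter_upwards [hN.oriented, ae_restrict_mem measurableSet_disc] with w ho hw
    rw [frameDet_rotate, det_of_special (hR.special w (disc_subset_closedDisc hw)), one_mul]
    exact ho.le

/-- Gauge transformation of the torsion coefficients: `T̃_i = (∂_i R + R T_i) Rᵀ`. -/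
theorem IsWeakNormalFrame.torsion_rotate (hN : IsWeakNormalFrame X N)
    {R : Plane → Matrix (Fin n) (Fin n) ℝ} (hR : IsRotationField R) (i : Fin 2) :
    ∀ᵐ w ∂(volume.restrict disc), torsionMatrix (CoulombFrame.rotate R N) i w
      = (matrixPartial R i w + R w * torsionMatrix N i w) * (R w).transpose := by
  have h : ∀ᵐ w ∂(volume.restrict disc), ∀ σ, weakPartial i (CoulombFrame.rotate R N σ) w
      = ∑ ϑ, (matrixPartial R i w σ ϑ • N ϑ w + R w σ ϑ • weakPartial i (N ϑ) w) :=
    ae_all_iff.mpr fun σ => (hN.bddW12_rotate hR σ).weakPartial_ae_eq i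
  filter_upwards [h, hN.orthonormal] with w hw ho
  ext σ ϑ
  rw [Matrix.add_mul, Matrix.add_apply, ← inner_rotate ho]
  change inner ℝ (weakPartial i (CoulombFrame.rotate R N σ) w) _ = _
  rw [hw, Finset.sum_add_distrib, inner_add_left]
  congr 1
  rw [Matrix.mul_assoc, Matrix.mul_apply, sum_inner]
  refine Finset.sum_congr rfl fun β _ => ?_
  rw [real_inner_smul_left, CoulombFrame.rotate, inner_sum, Matrix.mul_apply]
  congr 1
  refine Finset.sum_congr rfl fun γ _ => ?_
  rw [real_inner_smul_right, mul_comm]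
  rfl

theorem memLp_matrixPartial {R : Plane → Matrix (Fin n) (Fin n) ℝ} (hR : IsRotationField R)
    (i : Fin 2) (σ ϑ : Fin n) :
    MemLp (fun w => matrixPartial R i w σ ϑ) 2 (volume.restrict disc) :=
  (bddW12_of_contDiffOn (hR.contDiff σ ϑ)).sq i

theorem IsWeakNormalFrame.memLp_mul_torsionMatrix (hN : IsWeakNormalFrame X N)
    {R : Plane → Matrix (Fin n) (Fin n) ℝ} (hR : IsRotationField R) (i : Fin 2) (σ ϑ : Fin n) :
    MemLp (fun w => (R w * torsionMatrix N i w) σ ϑ) 2 (volume.restrict disc) := by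
  simp only [Matrix.mul_apply]
  exact memLp_finsetSum _ fun β _ =>
    (hN.memLp_torsion β ϑ i).mul (bddW12_of_contDiffOn (hR.contDiff σ β)).bdd

/-- The change of the total torsion under a rotation of the frame. The quadratic term in `T`
cancels because left and right multiplication by orthogonal matrices preserve `∑ |·|²`. -/
theorem totalTorsion_rotate (hX : IsConformalImmersion k α X) (hN : IsWeakNormalFrame X N)
    {R : Plane → Matrix (Fin n) (Fin n) ℝ} (hR : IsRotationField R) :
    totalTorsion X (rotate R N) - totalTorsion X N
      = ∑ i : Fin 2, ∫ w in disc, ∑ σ, ∑ ϑ, (2 * (matrixPartial R i w σ ϑ *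
          (R w * torsionMatrix N i w) σ ϑ) + matrixPartial R i w σ ϑ ^ 2) := by
  rw [totalTorsion_eq hX (hN.rotate hX hR), totalTorsion_eq hX hN, ← Finset.sum_sub_distrib]
  refine Finset.sum_congr rfl fun i _ => ?_
  rw [← integral_sub ((hN.rotate hX hR).integrable_sum_torsion_sq i)
    (hN.integrable_sum_torsion_sq i)]
  refine integral_congr_ae ?_
  filter_upwards [hN.torsion_rotate hR i, ae_restrict_mem measurableSet_disc] with w hT hw
  have hs := hR.special w (disc_subset_closedDisc hw)
  have h1 : (R w).transpose * R w = 1 := mul_eq_one_comm.mp (mul_transpose_of_special hs)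
  have e1 : ∑ σ, ∑ ϑ, torsion (CoulombFrame.rotate R N) σ ϑ i w ^ 2
      = ∑ σ, ∑ ϑ, (matrixPartial R i w + R w * torsionMatrix N i w) σ ϑ ^ 2 := by
    rw [← sum_sq_mul_transpose h1, ← hT]; rfl
  have e2 : ∑ σ, ∑ ϑ, torsion N σ ϑ i w ^ 2 = ∑ σ, ∑ ϑ, (R w * torsionMatrix N i w) σ ϑ ^ 2 := by
    rw [sum_sq_mul_left h1]; rfl
  rw [e1, e2, ← Finset.sum_sub_distrib]
  refine Finset.sum_congr rfl fun σ _ => ?_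
  rw [← Finset.sum_sub_distrib]
  refine Finset.sum_congr rfl fun ϑ _ => ?_
  rw [Matrix.add_apply]; ring

/-! ### The first variation -/

/-- If `f` is `C²` and `f(·, 0)` is constant, then `∂_i f(·, ε) / ε` is bounded and converges as
`ε → 0`. -/
theorem exists_partial_bound {f : Plane × ℝ → ℝ} {ε₀ c : ℝ} (hε₀ : 0 < ε₀)
    (hf : ContDiffOn ℝ 2 f (closedDisc ×ˢ Ioo (-ε₀) ε₀)) (h0 : ∀ w ∈ closedDisc, f (w, 0) = c)
    (i : Fin 2) :
    ∃ (C : ℝ) (D : Plane → ℝ), 0 ≤ C ∧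
      (∀ w ∈ disc, ∀ ε, |ε| < ε₀ / 2 →
        |fderiv ℝ (fun w => f (w, ε)) w (dir i)| ≤ C * |ε|) ∧
      ∀ w ∈ disc, Tendsto (fun ε => fderiv ℝ (fun w => f (w, ε)) w (dir i) / ε) (𝓝[≠] 0)
        (𝓝 (D w)) := by
  set S : Set (Plane × ℝ) := closedDisc ×ˢ Ioo (-ε₀) ε₀ with hS
  have hu : UniqueDiffOn ℝ S := uniqueDiffOn_closedDisc.prod isOpen_Ioo.uniqueDiffOn
  have hnhds : ∀ w ∈ disc, ∀ ε ∈ Ioo (-ε₀) ε₀, S ∈ 𝓝 (w, ε) := fun w hw ε hε =>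
    prod_mem_nhds (closedDisc_mem_nhds hw) (isOpen_Ioo.mem_nhds hε)
  set G : Plane × ℝ → ℝ := fun p => fderivWithin ℝ f S p (dir i, 0) with hGdef
  have hG : ContDiffOn ℝ 1 G S := (hf.fderivWithin hu (by norm_num)).clm_apply contDiffOn_const
  have hGeq : ∀ w ∈ disc, ∀ ε ∈ Ioo (-ε₀) ε₀,
      fderiv ℝ (fun w => f (w, ε)) w (dir i) = G (w, ε) := by
    intro w hw ε hε
    have hd : HasFDerivAt f (fderivWithin ℝ f S (w, ε)) (w, ε) :=
      ((hf.differentiableOn (by norm_num)) (w, ε)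
        ⟨disc_subset_closedDisc hw, hε⟩).hasFDerivWithinAt.hasFDerivAt (hnhds w hw ε hε)
    have hp : HasFDerivAt (fun w : Plane => (w, ε))
        ((ContinuousLinearMap.id ℝ Plane).prod (0 : Plane →L[ℝ] ℝ)) w :=
      (hasFDerivAt_id w).prodMk (hasFDerivAt_const ε w)
    have := hd.comp w hp
    exact (congrArg (fun L : Plane →L[ℝ] ℝ => L (dir i)) this.fderiv).trans (by simp [hGdef])
  have hmem0 : (0 : ℝ) ∈ Ioo (-ε₀) ε₀ := ⟨by linarith, hε₀⟩
  have hG0 : ∀ w ∈ disc, G (w, 0) = 0 := by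
    intro w hw
    rw [← hGeq w hw 0 hmem0]
    have : (fun w => f (w, 0)) =ᶠ[𝓝 w] fun _ => c :=
      eventually_of_mem (closedDisc_mem_nhds hw) h0
    rw [this.fderiv_eq]; simp
  set H : Plane × ℝ → ℝ := fun p => fderivWithin ℝ G S p (0, 1) with hHdef
  have hH : ContinuousOn H S :=
    (hG.continuousOn_fderivWithin hu le_rfl).clm_apply continuousOn_const
  have hder : ∀ w ∈ disc, ∀ ε ∈ Ioo (-ε₀) ε₀,
      HasDerivAt (fun ε => G (w, ε)) (H (w, ε)) ε := by
    intro w hw ε hε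
    have hd : HasFDerivAt G (fderivWithin ℝ G S (w, ε)) (w, ε) :=
      ((hG.differentiableOn (by norm_num)) (w, ε)
        ⟨disc_subset_closedDisc hw, hε⟩).hasFDerivWithinAt.hasFDerivAt (hnhds w hw ε hε)
    have h1 : HasDerivAt (fun ε : ℝ => (w, ε)) ((0 : Plane), (1 : ℝ)) ε :=
      (hasDerivAt_const ε w).prodMk (hasDerivAt_id ε)
    exact hd.comp_hasDerivAt ε h1
  have hsub : Icc (-(ε₀ / 2)) (ε₀ / 2) ⊆ Ioo (-ε₀) ε₀ := fun x hx =>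
    ⟨by linarith [hx.1], by linarith [hx.2]⟩
  obtain ⟨C, hC⟩ := (isCompact_closedDisc.prod isCompact_Icc).exists_bound_of_continuousOn
    (hH.mono (prod_mono subset_rfl hsub))
  refine ⟨|C|, fun w => H (w, 0), abs_nonneg C, fun w hw ε hε => ?_, fun w hw => ?_⟩
  · have hεI : ε ∈ Icc (-(ε₀ / 2)) (ε₀ / 2) := ⟨by linarith [(abs_lt.mp hε).1], (abs_lt.mp hε).2.le⟩
    have := (convex_Icc (-(ε₀ / 2)) (ε₀ / 2)).norm_image_sub_le_of_norm_hasDerivWithin_le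
      (f := fun ε => G (w, ε)) (C := |C|) (x := 0) (y := ε)
      (fun t ht => (hder w hw t (hsub ht)).hasDerivWithinAt)
      (fun t ht => (hC (w, t) ⟨disc_subset_closedDisc hw, ht⟩).trans (le_abs_self C))
      ⟨by linarith, by linarith⟩ hεI
    rw [hGeq w hw ε (hsub hεI)]
    simpa [hG0 w hw] using this
  · have h := (hder w hw 0 hmem0).tendsto_slope
    refine h.congr' ?_
    have hev : ∀ᶠ ε in 𝓝[≠] (0 : ℝ), ε ∈ Ioo (-ε₀) ε₀ :=
      nhdsWithin_le_nhds (isOpen_Ioo.mem_nhds hmem0)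
    filter_upwards [hev] with ε hε
    rw [slope_def_field, hG0 w hw, sub_zero, sub_zero, hGeq w hw ε hε]

theorem IsRotationFamily.isRotationField {ε₀ ε : ℝ} {R : Plane → ℝ → Matrix (Fin n) (Fin n) ℝ}
    (hR : IsRotationFamily ε₀ R) (hε : ε ∈ Ioo (-ε₀) ε₀) : IsRotationField fun w => R w ε where
  contDiff σ ϑ := ((hR.contDiff σ ϑ).comp (contDiffOn_id.prodMk contDiffOn_const)
    fun w hw => ⟨hw, hε⟩).of_le (by norm_num)
  special w hw := hR.special w hw ε hε

theorem abs_entry_le_one {R : Matrix (Fin n) (Fin n) ℝ}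
    (h : R ∈ Matrix.specialOrthogonalGroup (Fin n) ℝ) (σ ϑ : Fin n) : |R σ ϑ| ≤ 1 :=
  entry_norm_bound_of_unitary (𝕜 := ℝ) (Matrix.mem_specialOrthogonalGroup_iff.mp h).1 σ ϑ

/-- The first variation of the total torsion along a family of rotations is
`2 ∑ ∬ ⟨∂_ε ∂_i R, T_i⟩`, where `D i` is the mixed derivative `∂_ε ∂_i R` at `ε = 0`. -/
theorem tendsto_variation (hX : IsConformalImmersion k α X) (hN : IsWeakNormalFrame X N)
    {ε₀ : ℝ} (hε₀ : 0 < ε₀) {R : Plane → ℝ → Matrix (Fin n) (Fin n) ℝ}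
    (hR : IsRotationFamily ε₀ R) :
    ∃ D : Fin 2 → Plane → Matrix (Fin n) (Fin n) ℝ,
      (∀ i, ∀ w ∈ disc, ∀ σ ϑ, Tendsto (fun ε => matrixPartial (fun w => R w ε) i w σ ϑ / ε)
        (𝓝[≠] 0) (𝓝 (D i w σ ϑ))) ∧
      Tendsto (fun ε : ℝ => 1 / ε *
        (totalTorsion X (rotate (fun w => R w ε) N) - totalTorsion X N)) (𝓝[≠] 0)
        (𝓝 (∑ i, ∫ w in disc, ∑ σ, ∑ ϑ, 2 * (D i w σ ϑ * torsion N σ ϑ i w))) := by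
  have hb := fun (i : Fin 2) (σ ϑ : Fin n) =>
    exists_partial_bound (c := (1 : Matrix (Fin n) (Fin n) ℝ) σ ϑ) hε₀ (hR.contDiff σ ϑ)
      (fun w hw => by simp only [hR.initial w hw]) i
  choose C D hC0 hCb hD using hb
  refine ⟨fun i w σ ϑ => D i σ ϑ w, fun i w hw σ ϑ => hD i σ ϑ w hw, ?_⟩
  have hmem0 : (0 : ℝ) ∈ Ioo (-ε₀) ε₀ := ⟨by linarith, hε₀⟩
  have hnear : ∀ᶠ ε in 𝓝[≠] (0 : ℝ), |ε| < ε₀ / 2 ∧ ε ≠ 0 := by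
    refine Filter.Eventually.and ?_ self_mem_nhdsWithin
    refine nhdsWithin_le_nhds ?_
    filter_upwards [Metric.ball_mem_nhds (0 : ℝ) (half_pos hε₀)] with ε hε
    simpa using hε
  have hIoo : ∀ {ε : ℝ}, |ε| < ε₀ / 2 → ε ∈ Ioo (-ε₀) ε₀ := fun h =>
    ⟨by linarith [(abs_lt.mp h).1], by linarith [(abs_lt.mp h).2]⟩
  have hlim : ∀ i : Fin 2, Tendsto (fun ε : ℝ => ∫ w in disc, ∑ σ, ∑ ϑ,
      (2 * (matrixPartial (fun w => R w ε) i w σ ϑ / ε * (R w ε * torsionMatrix N i w) σ ϑ)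
        + ε * (matrixPartial (fun w => R w ε) i w σ ϑ / ε) ^ 2)) (𝓝[≠] 0)
      (𝓝 (∫ w in disc, ∑ σ, ∑ ϑ, 2 * (D i σ ϑ w * torsion N σ ϑ i w))) := by
    intro i
    refine tendsto_integral_filter_of_dominated_convergence (fun w => ∑ σ, ∑ ϑ,
      (2 * (C i σ ϑ * ∑ β, |torsion N β ϑ i w|) + ε₀ * C i σ ϑ ^ 2)) ?_ ?_ ?_ ?_
    · filter_upwards [hnear] with ε hε
      have hRf := hR.isRotationField (hIoo hε.1)
      refine Finset.aestronglyMeasurable_fun_sum _ fun σ _ =>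
        Finset.aestronglyMeasurable_fun_sum _ fun ϑ _ => ?_
      have m1 := (memLp_matrixPartial hRf i σ ϑ).aestronglyMeasurable
      have m2 := (hN.memLp_mul_torsionMatrix hRf i σ ϑ).aestronglyMeasurable
      simp only [div_eq_mul_inv]
      exact (((m1.mul_const _).mul m2).const_mul 2).add (((m1.mul_const _).pow 2).const_mul ε)
    · filter_upwards [hnear] with ε hε
      filter_upwards [ae_restrict_mem measurableSet_disc] with w hw
      have hp : ∀ σ ϑ, |matrixPartial (fun w => R w ε) i w σ ϑ / ε| ≤ C i σ ϑ := fun σ ϑ => by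
        rw [abs_div, div_le_iff₀ (abs_pos.mpr hε.2)]
        exact hCb i σ ϑ w hw ε hε.1
      have hRT : ∀ σ ϑ, |(R w ε * torsionMatrix N i w) σ ϑ| ≤ ∑ β, |torsion N β ϑ i w| := by
        intro σ ϑ
        rw [Matrix.mul_apply]
        refine (Finset.abs_sum_le_sum_abs _ _).trans (Finset.sum_le_sum fun β _ => ?_)
        rw [abs_mul]
        exact mul_le_of_le_one_left (abs_nonneg _)
          (abs_entry_le_one (hR.special w (disc_subset_closedDisc hw) ε (hIoo hε.1)) σ β)
      refine (norm_sum_le _ _).trans (Finset.sum_le_sum fun σ _ => (norm_sum_le _ _).trans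
        (Finset.sum_le_sum fun ϑ _ => (norm_add_le _ _).trans (add_le_add ?_ ?_)))
      · rw [Real.norm_eq_abs, abs_mul, abs_mul, abs_two]
        exact mul_le_mul_of_nonneg_left (mul_le_mul (hp σ ϑ) (hRT σ ϑ) (abs_nonneg _)
          (hC0 i σ ϑ)) zero_le_two
      · rw [Real.norm_eq_abs, abs_mul, abs_pow]
        exact mul_le_mul (by linarith [hε.1]) (pow_le_pow_left₀ (abs_nonneg _) (hp σ ϑ) 2)
          (by positivity) hε₀.le
    · refine integrable_finsetSum _ fun σ _ => integrable_finsetSum _ fun ϑ _ =>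
        Integrable.add (Integrable.const_mul (Integrable.const_mul
          (integrable_finsetSum _ fun β _ => ?_) _) _) (integrable_const _)
      exact (MemLp.integrableOn_disc (hN.memLp_torsion β ϑ i) one_le_two).abs
    · filter_upwards [ae_restrict_mem measurableSet_disc] with w hw
      refine tendsto_finsetSum _ fun σ _ => tendsto_finsetSum _ fun ϑ _ => ?_
      have hid : Tendsto (fun ε : ℝ => ε) (𝓝[≠] 0) (𝓝 0) := nhdsWithin_le_nhds
      have hRε : ∀ β, Tendsto (fun ε => R w ε σ β) (𝓝[≠] 0)
          (𝓝 ((1 : Matrix (Fin n) (Fin n) ℝ) σ β)) := by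
        intro β
        have hc := ((hR.contDiff σ β).continuousOn (w, 0) ⟨disc_subset_closedDisc hw, hmem0⟩)
          |>.continuousAt (prod_mem_nhds (closedDisc_mem_nhds hw) (isOpen_Ioo.mem_nhds hmem0))
        have h2 : Tendsto (fun ε : ℝ => (w, ε)) (𝓝[≠] 0) (𝓝 (w, 0)) :=
          tendsto_const_nhds.prodMk_nhds hid
        have h3 := hc.tendsto.comp h2
        simp only [hR.initial w (disc_subset_closedDisc hw)] at h3
        exact h3
      have hRT : Tendsto (fun ε => (R w ε * torsionMatrix N i w) σ ϑ) (𝓝[≠] 0)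
          (𝓝 (torsion N σ ϑ i w)) := by
        have h4 : Tendsto (fun ε => ∑ β, R w ε σ β * torsionMatrix N i w β ϑ) (𝓝[≠] 0)
            (𝓝 (∑ β, (1 : Matrix (Fin n) (Fin n) ℝ) σ β * torsionMatrix N i w β ϑ)) :=
          tendsto_finsetSum _ fun β _ => (hRε β).mul_const _
        simp only [← Matrix.mul_apply, Matrix.one_mul] at h4
        exact h4
      have h5 := ((hD i σ ϑ w hw).mul hRT).const_mul 2
      have h6 := hid.mul ((hD i σ ϑ w hw).pow 2)
      rw [zero_mul] at h6
      have h7 := h5.add h6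
      rw [add_zero] at h7
      exact h7
  have hsum := tendsto_finsetSum Finset.univ fun i _ => hlim i
  refine hsum.congr' ?_
  filter_upwards [hnear] with ε hε
  rw [totalTorsion_rotate hX hN (hR.isRotationField (hIoo hε.1)), Finset.mul_sum]
  refine Finset.sum_congr rfl fun i _ => ?_
  rw [← integral_const_mul]
  congr 1; ext w
  rw [Finset.mul_sum]
  refine Finset.sum_congr rfl fun σ _ => ?_
  rw [Finset.mul_sum]
  refine Finset.sum_congr rfl fun ϑ _ => ?_
  have := hε.2
  field_simp

/-- Minimizers of the total torsion are critical: the difference quotients converge and their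
one-sided limits have opposite signs. -/
theorem isCritical_of_minimal (hX : IsConformalImmersion k α X) (hN : IsWeakNormalFrame X N)
    (hmin : ∀ M, IsWeakNormalFrame X M → totalTorsion X N ≤ totalTorsion X M) :
    IsCritical X N := by
  intro ε₀ R hε₀ hR
  obtain ⟨D, -, hlim⟩ := tendsto_variation hX hN hε₀ hR
  set ℓ := ∑ i, ∫ w in disc, ∑ σ, ∑ ϑ, 2 * (D i w σ ϑ * torsion N σ ϑ i w)
  have hge : ∀ ε ∈ Ioo (-ε₀) ε₀,
      0 ≤ totalTorsion X (rotate (fun w => R w ε) N) - totalTorsion X N := fun ε hε =>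
    sub_nonneg.mpr (hmin _ (hN.rotate hX (hR.isRotationField hε)))
  have hnhds : Ioo (-ε₀) ε₀ ∈ 𝓝 (0 : ℝ) := isOpen_Ioo.mem_nhds ⟨by linarith, hε₀⟩
  have h1 : 0 ≤ ℓ := by
    refine ge_of_tendsto (hlim.mono_left (nhdsGT_le_nhdsNE 0)) ?_
    filter_upwards [self_mem_nhdsWithin, nhdsWithin_le_nhds hnhds] with ε hε hε'
    exact mul_nonneg (one_div_nonneg.mpr (le_of_lt hε)) (hge ε hε')
  have h2 : ℓ ≤ 0 := by
    refine le_of_tendsto (hlim.mono_left (nhdsLT_le_nhdsNE 0)) ?_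
    filter_upwards [self_mem_nhdsWithin, nhdsWithin_le_nhds hnhds] with ε hε hε'
    exact mul_nonpos_of_nonpos_of_nonneg (one_div_nonpos.mpr (le_of_lt hε)) (hge ε hε')
  rwa [le_antisymm h2 h1] at hlim

/-! ### Rotations in a coordinate plane -/

/-- The infinitesimal rotation in the plane of the axes `σ` and `ϑ`. -/
def planeGenerator (σ ϑ : Fin n) : Matrix (Fin n) (Fin n) ℝ :=
  Matrix.single σ ϑ 1 - Matrix.single ϑ σ 1

/-- The exponential of `t J` for a matrix with `J³ = -J`, by Rodrigues' formula. -/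
def planeRotation (J : Matrix (Fin n) (Fin n) ℝ) (t : ℝ) : Matrix (Fin n) (Fin n) ℝ :=
  1 + Real.sin t • J + (1 - Real.cos t) • (J * J)

theorem planeGenerator_cube {σ ϑ : Fin n} (h : σ ≠ ϑ) :
    planeGenerator σ ϑ * planeGenerator σ ϑ * planeGenerator σ ϑ = -planeGenerator σ ϑ := by
  simp [planeGenerator, sub_mul, mul_sub, h, h.symm, Matrix.single_mul_single_of_ne]
  abel

theorem planeGenerator_transpose (σ ϑ : Fin n) :
    (planeGenerator σ ϑ).transpose = -planeGenerator σ ϑ := by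
  simp [planeGenerator, Matrix.transpose_sub]

theorem planeRotation_mul {J : Matrix (Fin n) (Fin n) ℝ} (hJ : J * J * J = -J) (s t : ℝ) :
    planeRotation J s * planeRotation J t = planeRotation J (s + t) := by
  have h3 : J * (J * J) = -J := by rw [← mul_assoc, hJ]
  have h4 : J * J * (J * J) = -(J * J) := by rw [← mul_assoc, hJ, neg_mul]
  simp only [planeRotation, add_mul, mul_add, one_mul, mul_one, smul_mul_assoc, mul_smul_comm,
    hJ, h3, h4, Real.sin_add, Real.cos_add, smul_neg]
  module

theorem planeRotation_mem {J : Matrix (Fin n) (Fin n) ℝ} (hJ : J * J * J = -J)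
    (hT : J.transpose = -J) (t : ℝ) :
    planeRotation J t ∈ Matrix.specialOrthogonalGroup (Fin n) ℝ := by
  have htr : ∀ t, (planeRotation J t).transpose = planeRotation J (-t) := by
    intro t
    simp [planeRotation, Matrix.transpose_add, Matrix.transpose_smul, Matrix.transpose_mul, hT]
  have h0 : planeRotation J 0 = 1 := by simp [planeRotation]
  have hmul : ∀ t, planeRotation J t * (planeRotation J t).transpose = 1 := fun t => by
    rw [htr, planeRotation_mul hJ, add_neg_cancel, h0]
  rw [Matrix.mem_specialOrthogonalGroup_iff]
  refine ⟨(Matrix.mem_orthogonalGroup_iff (Fin n) ℝ).mpr (hmul t), ?_⟩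
  -- the rotation by `t` is the square of the rotation by `t / 2`
  have h1 := congrArg Matrix.det (hmul (t / 2))
  rw [Matrix.det_mul, Matrix.det_transpose, Matrix.det_one, ← Matrix.det_mul,
    planeRotation_mul hJ, add_halves] at h1
  exact h1

theorem isRotationFamily_planeRotation {J : Matrix (Fin n) (Fin n) ℝ} (hJ : J * J * J = -J)
    (hT : J.transpose = -J) {φ : Plane → ℝ} (hφ : ContDiffOn ℝ 2 φ closedDisc) :
    IsRotationFamily 1 fun w ε => planeRotation J (ε * φ w) where
  contDiff σ ϑ := by
    have h1 : ContDiffOn ℝ 2 (fun p : Plane × ℝ => p.2 * φ p.1) (closedDisc ×ˢ Ioo (-1) 1) :=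
      contDiffOn_snd.mul (hφ.comp contDiffOn_fst fun p hp => hp.1)
    simp only [planeRotation, Matrix.add_apply, Matrix.smul_apply, smul_eq_mul]
    exact (contDiffOn_const.add (h1.sin.mul contDiffOn_const)).add
      ((contDiffOn_const.sub h1.cos).mul contDiffOn_const)
  special w _ ε _ := planeRotation_mem hJ hT _
  initial w _ := by simp [planeRotation]

theorem tendsto_matrixPartial_planeRotation (J : Matrix (Fin n) (Fin n) ℝ) {φ : Plane → ℝ}
    {w : Plane} (hφ : DifferentiableAt ℝ φ w) (i : Fin 2) (σ ϑ : Fin n) :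
    Tendsto (fun ε => matrixPartial (fun w => planeRotation J (ε * φ w)) i w σ ϑ / ε) (𝓝[≠] 0)
      (𝓝 (fderiv ℝ φ w (dir i) * J σ ϑ)) := by
  have hd : ∀ ε, matrixPartial (fun w => planeRotation J (ε * φ w)) i w σ ϑ
      = ε * fderiv ℝ φ w (dir i) * (Real.cos (ε * φ w) * J σ ϑ
        + Real.sin (ε * φ w) * (J * J) σ ϑ) := by
    intro ε
    have h1 : HasFDerivAt (fun w => ε * φ w) (ε • fderiv ℝ φ w) w := hφ.hasFDerivAt.const_mul ε
    have h2 := ((h1.sin.mul_const (J σ ϑ)).const_add ((1 : Matrix (Fin n) (Fin n) ℝ) σ ϑ)).add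
      ((h1.cos.const_sub 1).mul_const ((J * J) σ ϑ))
    have h3 : (fun w => planeRotation J (ε * φ w) σ ϑ) = fun w =>
        (1 : Matrix (Fin n) (Fin n) ℝ) σ ϑ + Real.sin (ε * φ w) * J σ ϑ
          + (1 - Real.cos (ε * φ w)) * (J * J) σ ϑ := by
      ext w
      simp only [planeRotation, Matrix.add_apply, Matrix.smul_apply, smul_eq_mul]
    have h4 := (congrArg (fun g => fderiv ℝ g w) h3).trans h2.fderiv
    change fderiv ℝ (fun w => planeRotation J (ε * φ w) σ ϑ) w (dir i) = _
    rw [h4]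
    simp
    ring
  have hid : Tendsto (fun ε : ℝ => ε * φ w) (𝓝[≠] 0) (𝓝 0) := by
    have : Tendsto (fun ε : ℝ => ε * φ w) (𝓝 0) (𝓝 (0 * φ w)) := tendsto_id.mul_const _
    rw [zero_mul] at this
    exact this.mono_left nhdsWithin_le_nhds
  have hc := (Real.continuous_cos.tendsto 0).comp hid
  have hs := (Real.continuous_sin.tendsto 0).comp hid
  rw [Real.cos_zero] at hc
  rw [Real.sin_zero] at hs
  have h4 := ((hc.mul_const (J σ ϑ)).add (hs.mul_const ((J * J) σ ϑ))).const_mul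
    (fderiv ℝ φ w (dir i))
  rw [one_mul, zero_mul, add_zero] at h4
  refine h4.congr' ?_
  filter_upwards [self_mem_nhdsWithin] with ε hε
  have hε' : ε ≠ 0 := hε
  rw [hd]
  simp only [Function.comp]
  field_simp

/-- The Euler–Lagrange system: the first variation along rotations by the angle `ε φ` in the plane
of the axes `σ` and `ϑ`. -/
theorem solvesWeakEulerLagrange_of_critical (hX : IsConformalImmersion k α X)
    (hN : IsWeakNormalFrame X N) (hcrit : IsCritical X N) : SolvesWeakEulerLagrange N := by
  intro σ ϑ
  refine ⟨hN.memLp_torsion σ ϑ, fun φ hφ => ?_⟩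
  by_cases hσϑ : σ = ϑ
  · subst hσϑ
    rw [integral_congr_ae (g := fun _ => 0)]
    · simp
    · filter_upwards [hN.torsion_antisymm σ σ 0, hN.torsion_antisymm σ σ 1] with w h0 h1
      rw [self_eq_neg.mp h0, self_eq_neg.mp h1]; simp
  have hJ := planeGenerator_cube hσϑ
  have hT := planeGenerator_transpose σ ϑ
  set J := planeGenerator σ ϑ with hJdef
  have hφ2 : ContDiffOn ℝ 2 φ closedDisc := hφ.of_le (WithTop.coe_le_coe.mpr le_top)
  have hR := isRotationFamily_planeRotation hJ hT hφ2
  obtain ⟨D, hD, hlim⟩ := tendsto_variation hX hN one_pos hR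
  have hzero := tendsto_nhds_unique hlim (hcrit 1 _ one_pos hR)
  have hDeq : ∀ i, ∀ w ∈ disc, ∀ a b, D i w a b = fderiv ℝ φ w (dir i) * J a b := by
    intro i w hw a b
    refine tendsto_nhds_unique (hD i w hw a b) (tendsto_matrixPartial_planeRotation J ?_ i a b)
    exact ((hφ2.differentiableOn (by norm_num)) w (disc_subset_closedDisc hw)).differentiableAt
      (closedDisc_mem_nhds hw)
  have hint : ∀ i, ∫ w in disc, ∑ a, ∑ b, 2 * (D i w a b * torsion N a b i w)
      = 4 * ∫ w in disc, fderiv ℝ φ w (dir i) * torsion N σ ϑ i w := by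
    intro i
    rw [← integral_const_mul]
    refine integral_congr_ae ?_
    filter_upwards [ae_restrict_mem measurableSet_disc, hN.torsion_antisymm σ ϑ i] with w hw ha
    -- by skew-symmetry both entries of the generator contribute the same, hence the factor `4`
    have h1 : ∑ a, ∑ b, J a b * torsion N a b i w = torsion N σ ϑ i w - torsion N ϑ σ i w := by
      have h2 : ∀ p q : Fin n, ∑ a, ∑ b, (Matrix.single p q (1 : ℝ)) a b * torsion N a b i w
          = torsion N p q i w := by
        intro p q
        rw [Finset.sum_eq_single p, Finset.sum_eq_single q]
        · simp
        · intro b _ hb; simp [Ne.symm hb]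
        · simp
        · intro a _ ha; exact Finset.sum_eq_zero fun b _ => by simp [Ne.symm ha]
        · simp
      simp only [hJdef, planeGenerator, Matrix.sub_apply, sub_mul, Finset.sum_sub_distrib, h2]
    calc ∑ a, ∑ b, 2 * (D i w a b * torsion N a b i w)
        = 2 * fderiv ℝ φ w (dir i) * ∑ a, ∑ b, J a b * torsion N a b i w := by
          rw [Finset.mul_sum]
          refine Finset.sum_congr rfl fun a _ => ?_
          rw [Finset.mul_sum]
          refine Finset.sum_congr rfl fun b _ => ?_
          rw [hDeq i w hw]; ring
      _ = 4 * (fderiv ℝ φ w (dir i) * torsion N σ ϑ i w) := by rw [h1, ha]; ring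
  have hbd := bddW12_of_contDiffOn (hφ2.of_le (by norm_num))
  have hI : ∀ i, IntegrableOn (fun w => fderiv ℝ φ w (dir i) * torsion N σ ϑ i w) disc := fun i =>
    (hbd.sq i).integrable_mul (hN.memLp_torsion σ ϑ i)
  rw [integral_add (hI 0) (hI 1)]
  rw [Fin.sum_univ_two, hint, hint] at hzero
  linarith

/-! ### Existence of a normal frame -/

/-- The orthogonal projection onto the normal space at `w`, written out in conformal parameters. -/
def normalProj (X : Plane → Ambient n) (w : Plane) : Ambient n →L[ℝ] Ambient n :=
  ContinuousLinearMap.id ℝ (Ambient n) - ∑ i : Fin 2, (conformalFactor X w)⁻¹ •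
    (innerSL ℝ (tangent X i w)).smulRight (tangent X i w)

theorem normalProj_apply (w : Plane) (v : Ambient n) : normalProj X w v = v -
    ∑ i : Fin 2, (conformalFactor X w)⁻¹ • inner ℝ (tangent X i w) v • tangent X i w := by
  simp [normalProj]

theorem normalProj_mem (hX : IsConformalImmersion k α X) {w : Plane} (hw : w ∈ closedDisc)
    (v : Ambient n) : normalProj X w v ∈ normalSpace X w := by
  have hpos := conformalFactor_pos hX hw
  rw [mem_normalSpace_iff]
  intro j
  rw [normalProj_apply, inner_sub_right, inner_sum]
  simp only [real_inner_smul_right, inner_tangent hX hw]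
  simp only [mul_ite, mul_zero, Finset.sum_ite_eq, Finset.mem_univ, if_true]
  field_simp
  ring

theorem normalProj_of_mem {w : Plane} {v : Ambient n} (hv : v ∈ normalSpace X w) :
    normalProj X w v = v := by
  rw [normalProj_apply]
  simp [mem_normalSpace_iff.mp hv]

theorem normalProj_contDiffOn (hX : IsConformalImmersion k α X) (hk : 3 ≤ k) :
    ContDiffOn ℝ 1 (normalProj X) closedDisc := by
  have ht := tangent_contDiffOn hX hk
  have hc : ContDiffOn ℝ 1 (conformalFactor X) closedDisc := (ht 0).inner ℝ (ht 0)
  refine contDiffOn_const.sub (ContDiffOn.sum fun i _ => ?_)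
  refine (hc.inv fun w hw => (conformalFactor_pos hX hw).ne').smul ?_
  exact ((innerSL ℝ (E := Ambient n)).contDiff.comp_contDiffOn (ht i)).smulRight (ht i)

theorem gramSchmidt_contDiffOn {E : Type*} [NormedAddCommGroup E] [NormedSpace ℝ E]
    {F : Type*} [NormedAddCommGroup F] [InnerProductSpace ℝ F] {s : Set E} {A : Fin n → E → F}
    (hA : ∀ σ, ContDiffOn ℝ 1 (A σ) s) (hl : ∀ w ∈ s, LinearIndependent ℝ fun σ => A σ w)
    (σ : Fin n) :
    ContDiffOn ℝ 1 (fun w => InnerProductSpace.gramSchmidt ℝ (fun σ => A σ w) σ) s := by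
  induction σ using WellFoundedLT.induction with
  | ind σ ih =>
    simp only [InnerProductSpace.gramSchmidt_def ℝ _ σ, Submodule.starProjection_singleton]
    refine (hA σ).sub (ContDiffOn.sum fun τ hτ => ?_)
    have hg := ih τ (Finset.mem_Iio.mp hτ)
    refine ContDiffOn.smul (ContDiffOn.div (hg.inner ℝ (hA σ)) (hg.norm_sq ℝ) fun w hw => ?_) hg
    have := InnerProductSpace.gramSchmidt_ne_zero (𝕜 := ℝ) τ (hl w hw)
    exact pow_ne_zero 2 (norm_ne_zero_iff.mpr this)

theorem gramSchmidtNormed_contDiffOn {E : Type*} [NormedAddCommGroup E] [NormedSpace ℝ E]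
    {F : Type*} [NormedAddCommGroup F] [InnerProductSpace ℝ F] {s : Set E} {A : Fin n → E → F}
    (hA : ∀ σ, ContDiffOn ℝ 1 (A σ) s) (hl : ∀ w ∈ s, LinearIndependent ℝ fun σ => A σ w)
    (σ : Fin n) :
    ContDiffOn ℝ 1 (fun w => InnerProductSpace.gramSchmidtNormed ℝ (fun σ => A σ w) σ) s := by
  have hg := gramSchmidt_contDiffOn hA hl σ
  have h0 : ∀ w ∈ s, InnerProductSpace.gramSchmidt ℝ (fun σ => A σ w) σ ≠ 0 := fun w hw =>
    InnerProductSpace.gramSchmidt_ne_zero (𝕜 := ℝ) σ (hl w hw)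
  exact ContDiffOn.smul ((hg.norm ℝ h0).inv fun w hw => norm_ne_zero_iff.mpr (h0 w hw)) hg

theorem smul_mem_closedDisc {t : ℝ} (h0 : 0 ≤ t) (h1 : t ≤ 1) {w : Plane} (hw : w ∈ closedDisc) :
    t • w ∈ closedDisc := by
  rw [closedDisc, mem_closedBall_zero_iff] at hw ⊢
  rw [norm_smul, Real.norm_of_nonneg h0]
  exact mul_le_one₀ h1 (norm_nonneg _) hw

/-- Normal vectors at a point are carried injectively to the normal space of nearby points. -/
theorem exists_normalProj_injOn (hX : IsConformalImmersion k α X) (hk : 3 ≤ k) :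
    ∃ δ > 0, ∀ w ∈ closedDisc, ∀ w' ∈ closedDisc, dist w w' < δ →
      InjOn (normalProj X w') (normalSpace X w) := by
  have huc := isCompact_closedDisc.uniformContinuousOn_of_continuous
    (normalProj_contDiffOn hX hk).continuousOn
  obtain ⟨δ, hδ, h⟩ := Metric.uniformContinuousOn_iff.mp huc 1 one_pos
  refine ⟨δ, hδ, fun w hw w' hw' hd => ?_⟩
  intro x hx y hy hxy
  by_contra hne
  have hz : x - y ∈ normalSpace X w := Submodule.sub_mem _ hx hy
  have hz' : normalProj X w' (x - y) = 0 := by rw [map_sub, hxy, sub_self]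
  have hlt : ‖normalProj X w - normalProj X w'‖ < 1 := by
    rw [← dist_eq_norm]; exact h w hw w' hw' hd
  have h1 : ‖x - y‖ ≤ ‖normalProj X w - normalProj X w'‖ * ‖x - y‖ := by
    refine le_trans (le_of_eq ?_) ((normalProj X w - normalProj X w').le_opNorm (x - y))
    rw [_root_.sub_apply, normalProj_of_mem hz, hz', sub_zero]
  have hpos : 0 < ‖x - y‖ := norm_pos_iff.mpr (sub_ne_zero.mpr hne)
  nlinarith

/-- Linearly independent normal fields of class `C¹`: a basis of the normal space at the centre is
projected successively onto the normal spaces along the radii, in steps so small that no projection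
loses rank. -/
theorem exists_normal_basis (hX : IsConformalImmersion k α X) (hk : 3 ≤ k) :
    ∃ A : Fin n → Plane → Ambient n, (∀ σ, ContDiffOn ℝ 1 (A σ) closedDisc) ∧
      ∀ w ∈ closedDisc, (LinearIndependent ℝ fun σ => A σ w) ∧ ∀ σ, A σ w ∈ normalSpace X w := by
  obtain ⟨δ, hδ, hinj⟩ := exists_normalProj_injOn hX hk
  obtain ⟨m, hm⟩ := exists_nat_one_div_lt hδ
  have hm0 : (0 : ℝ) < m + 1 := by positivity
  suffices H : ∀ j : ℕ, j ≤ m + 1 → ∃ A : Fin n → Plane → Ambient n,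
      (∀ σ, ContDiffOn ℝ 1 (A σ) closedDisc) ∧ ∀ w ∈ closedDisc,
        (LinearIndependent ℝ fun σ => A σ w) ∧
          ∀ σ, A σ w ∈ normalSpace X (((j : ℝ) / (m + 1)) • w) by
    obtain ⟨A, hA, hw⟩ := H (m + 1) le_rfl
    refine ⟨A, hA, fun w hw' => ⟨(hw w hw').1, fun σ => ?_⟩⟩
    have := (hw w hw').2 σ
    rwa [Nat.cast_add, Nat.cast_one, div_self hm0.ne', one_smul] at this
  intro j
  induction j with
  | zero =>
    intro _
    have h0 : (0 : Plane) ∈ closedDisc := by simp [closedDisc]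
    let b := Module.finBasisOfFinrankEq ℝ (normalSpace X 0) (finrank_normalSpace hX h0)
    refine ⟨fun σ _ => b σ, fun σ => contDiffOn_const, fun w _ => ⟨?_, fun σ => ?_⟩⟩
    · exact b.linearIndependent.map' (normalSpace X 0).subtype (Submodule.ker_subtype _)
    · simp
  | succ j ih =>
    intro hj
    obtain ⟨A, hA, hw⟩ := ih (by omega)
    have hjm : (j : ℝ) + 1 ≤ m + 1 := by exact_mod_cast hj
    have ht1 : ∀ w ∈ closedDisc, ((j : ℝ) / (m + 1)) • w ∈ closedDisc := fun w hw =>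
      smul_mem_closedDisc (by positivity) ((div_le_one hm0).mpr (by linarith)) hw
    have ht2 : ∀ w ∈ closedDisc, (((j + 1 : ℕ) : ℝ) / (m + 1)) • w ∈ closedDisc := fun w hw =>
      smul_mem_closedDisc (by positivity) ((div_le_one hm0).mpr (by push_cast; linarith)) hw
    refine ⟨fun σ w => normalProj X ((((j + 1 : ℕ) : ℝ) / (m + 1)) • w) (A σ w), fun σ => ?_,
      fun w hwd => ⟨?_, fun σ => normalProj_mem hX (ht2 w hwd) _⟩⟩
    · exact ((normalProj_contDiffOn hX hk).comp (contDiffOn_id.const_smul _) ht2).clm_apply (hA σ)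
    · have hd : dist (((j : ℝ) / (m + 1)) • w) ((((j + 1 : ℕ) : ℝ) / (m + 1)) • w) < δ := by
        rw [dist_eq_norm, ← sub_smul, norm_smul]
        have e : (j : ℝ) / (m + 1) - ((j + 1 : ℕ) : ℝ) / (m + 1) = -(1 / (m + 1)) := by
          push_cast; ring
        have hw1 : ‖w‖ ≤ 1 := by simpa [closedDisc] using hwd
        rw [e, norm_neg, Real.norm_of_nonneg (by positivity)]
        exact (mul_le_of_le_one_right (by positivity) hw1).trans_lt hm
      refine (hw w hwd).1.map_injOn
        (normalProj X ((((j + 1 : ℕ) : ℝ) / (m + 1)) • w)).toLinearMap ?_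
      refine (hinj _ (ht1 w hwd) _ (ht2 w hwd) hd).mono ?_
      rw [SetLike.coe_subset_coe, Submodule.span_le]
      rintro _ ⟨σ, rfl⟩
      exact (hw w hwd).2 σ

theorem continuousOn_frameDet (hX : IsConformalImmersion k α X) (hk : 3 ≤ k)
    (hN : ∀ σ, ContinuousOn (N σ) closedDisc) : ContinuousOn (frameDet X N) closedDisc := by
  rw [continuousOn_iff_continuous_domRestrict]
  refine Continuous.matrix_det (continuous_matrix fun r c => ?_)
  have ht := fun i =>
    continuousOn_iff_continuous_domRestrict.mp (tangent_contDiffOn hX hk i).continuousOn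
  have hN' := fun σ => continuousOn_iff_continuous_domRestrict.mp (hN σ)
  refine Fin.cases ?_ (fun c => Fin.cases ?_ (fun c => ?_) c) c
  · exact (EuclideanSpace.proj r : Ambient n →L[ℝ] ℝ).continuous.comp (ht 0)
  · exact (EuclideanSpace.proj r : Ambient n →L[ℝ] ℝ).continuous.comp (ht 1)
  · exact (EuclideanSpace.proj r : Ambient n →L[ℝ] ℝ).continuous.comp (hN' c)

/-- Every conformally immersed disc has a weak normal frame, in fact one of class `C¹` up to the
boundary. -/
theorem exists_weakNormalFrame (hn : 1 ≤ n) (hX : IsConformalImmersion k α X) (hk : 3 ≤ k) :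
    ∃ N : Fin n → Plane → Ambient n, IsWeakNormalFrame X N := by
  obtain ⟨A, hA, hAw⟩ := exists_normal_basis hX hk
  set N : Fin n → Plane → Ambient n :=
    fun σ w => InnerProductSpace.gramSchmidtNormed ℝ (fun σ => A σ w) σ with hNdef
  have hN : ∀ σ, ContDiffOn ℝ 1 (N σ) closedDisc :=
    gramSchmidtNormed_contDiffOn hA fun w hw => (hAw w hw).1
  have ho : ∀ w ∈ closedDisc, Orthonormal ℝ fun σ => N σ w := fun w hw =>
    InnerProductSpace.gramSchmidtNormed_orthonormal (hAw w hw).1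
  have hmem : ∀ w ∈ closedDisc, ∀ σ, N σ w ∈ normalSpace X w := by
    intro w hw σ
    have h1 : N σ w ∈ Submodule.span ℝ (range fun σ => A σ w) := by
      rw [← InnerProductSpace.span_gramSchmidt ℝ, ← InnerProductSpace.span_gramSchmidtNormed_range]
      exact Submodule.subset_span ⟨σ, rfl⟩
    refine Submodule.span_le.mpr ?_ h1
    rintro _ ⟨τ, rfl⟩
    exact (hAw w hw).2 τ
  have hne : ∀ w ∈ closedDisc, frameDet X N w ≠ 0 := fun w hw =>
    frameDet_ne_zero hX hw (ho w hw) (hmem w hw)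
  have hcont := continuousOn_frameDet hX hk fun σ => (hN σ).continuousOn
  have hpre : IsPreconnected closedDisc := (convex_closedBall (0 : Plane) 1).isPreconnected
  have h0 : (0 : Plane) ∈ closedDisc := by simp [closedDisc]
  have hae : ∀ {p : Plane → Prop}, (∀ w ∈ closedDisc, p w) →
      ∀ᵐ w ∂(volume.restrict disc), p w := fun h => by
    filter_upwards [ae_restrict_mem measurableSet_disc] with w hw
    exact h w (disc_subset_closedDisc hw)
  -- the determinant has constant sign; if it is negative, one field is reversed
  rcases (hne 0 h0).lt_or_gt with hneg | hpos
  · have hsign : ∀ w ∈ closedDisc, frameDet X N w < 0 := by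
      intro w hw
      by_contra hle
      obtain ⟨z, hz, hz0⟩ := hpre.intermediate_value h0 hw hcont ⟨hneg.le, not_lt.mp hle⟩
      exact hne z hz hz0
    set s : Fin n → ℝ := Function.update (fun _ => 1) ⟨0, hn⟩ (-1) with hs
    have hss : ∀ σ, s σ * s σ = 1 := fun σ => by
      by_cases h : σ = ⟨0, hn⟩
      · subst h; simp [hs]
      · simp [hs, Function.update_of_ne h]
    have hrot : ∀ σ w, rotate (fun _ => Matrix.diagonal s) N σ w = s σ • N σ w := by
      intro σ w
      rw [rotate, Finset.sum_eq_single σ (fun τ _ hτ => by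
        simp [Matrix.diagonal_apply_ne s hτ.symm]) (by simp)]
      simp
    refine ⟨rotate (fun _ => Matrix.diagonal s) N,
      isWeakNormalFrame_of (N' := fun σ i w => fderiv ℝ (rotate (fun _ => Matrix.diagonal s) N σ) w
        (dir i)) hX (fun σ => bddW12_vec_of_contDiffOn ?_) (hae fun w hw => ?_)
        (hae fun w hw σ => ?_) (hae fun w hw => ?_)⟩
    · rw [funext (hrot σ)]
      exact (hN σ).const_smul (s σ)
    · simp only [hrot]
      rw [orthonormal_iff_ite]
      intro σ τ
      rw [real_inner_smul_left, real_inner_smul_right, orthonormal_iff_ite.mp (ho w hw)]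
      split_ifs with h
      · subst h; rw [mul_one, hss]
      · simp
    · rw [hrot]; exact Submodule.smul_mem _ _ (hmem w hw σ)
    · rw [frameDet_rotate, Matrix.det_diagonal, hs, Finset.prod_update_of_mem (Finset.mem_univ _)]
      simp only [Finset.prod_const_one, mul_one, neg_mul, one_mul]
      exact (neg_pos.mpr (hsign w hw)).le
  · refine ⟨N, isWeakNormalFrame_of hX (fun σ => bddW12_vec_of_contDiffOn (hN σ)) (hae ho)
      (hae hmem) (hae fun w hw => ?_)⟩
    by_contra hle
    obtain ⟨z, hz, hz0⟩ := hpre.intermediate_value hw h0 hcont ⟨(not_le.mp hle).le, hpos.le⟩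
    exact hne z hz hz0

/-! ### The direct method -/

/-- The derivative of a unit normal field is controlled by its torsion coefficients, since its
tangential part `-⟨N_σ, X_{u^i u^j}⟩` is of order zero. -/
theorem exists_gradient_bound (hX : IsConformalImmersion k α X) (hk : 3 ≤ k) :
    ∃ K : ℝ, 0 ≤ K ∧ ∀ N : Fin n → Plane → Ambient n, IsWeakNormalFrame X N → ∀ σ i,
      ∀ᵐ w ∂(volume.restrict disc),
        ‖weakPartial i (N σ) w‖ ^ 2 ≤ (∑ ϑ, torsion N σ ϑ i w ^ 2) + K := by
  have ht := tangent_contDiffOn hX hk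
  have hcf : ContinuousOn (conformalFactor X) closedDisc :=
    (ht 0).continuousOn.inner (ht 0).continuousOn
  have hbd : ∀ i : Fin 2, ∃ K, ∀ w ∈ closedDisc, ‖∑ j : Fin 2,
      ‖fderivWithin ℝ (tangent X j) closedDisc w (dir i)‖ ^ 2 / conformalFactor X w‖ ≤ K :=
    fun i => isCompact_closedDisc.exists_bound_of_continuousOn
      (continuousOn_finsetSum _ fun j _ => ((continuousOn_fderivWithin_dir (ht j) i).norm.pow 2).div
        hcf fun w hw => (conformalFactor_pos hX hw).ne')
  choose K hK using hbd
  refine ⟨∑ i, |K i|, Finset.sum_nonneg fun i _ => abs_nonneg _, fun N hN σ i => ?_⟩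
  -- the weak derivative of `⟨N_σ, X_{u^j}⟩ = 0`
  have hT : ∀ᵐ w ∂(volume.restrict disc), ∀ j, inner ℝ (weakPartial i (N σ) w) (tangent X j w)
      + inner ℝ (N σ w) (fderiv ℝ (tangent X j) w (dir i)) = 0 := by
    refine ae_all_iff.mpr fun j => ?_
    refine ((hN.bddW12 σ).inner (bddW12_vec_of_contDiffOn (ht j))).ae_eq_of_ae_eq (bddW12_const 0)
      ?_ i
    filter_upwards [hN.mem_normalSpace] with w hw
    rw [real_inner_comm]
    exact mem_normalSpace_iff.mp (hw σ) j
  filter_upwards [hT, hN.orthonormal, hN.mem_normalSpace, ae_restrict_mem measurableSet_disc]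
    with w h1 ho hm hw
  have hwc := disc_subset_closedDisc hw
  rw [norm_sq_eq_normal_add_tangential hX hwc ho hm]
  refine add_le_add le_rfl ?_
  calc ∑ j, inner ℝ (weakPartial i (N σ) w) (tangent X j w) ^ 2 / conformalFactor X w
      ≤ ∑ j, ‖fderivWithin ℝ (tangent X j) closedDisc w (dir i)‖ ^ 2 / conformalFactor X w := by
        refine Finset.sum_le_sum fun j _ => div_le_div_of_nonneg_right ?_
          (conformalFactor_pos hX hwc).le
        rw [← fderiv_eq_fderivWithin _ hw, eq_neg_of_add_eq_zero_left (h1 j), neg_sq, ← sq_abs]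
        refine pow_le_pow_left₀ (abs_nonneg _) ((abs_real_inner_le_norm _ _).trans ?_) 2
        rw [ho.1 σ, one_mul]
    _ ≤ K i := (le_abs_self _).trans (hK i w hwc)
    _ ≤ |K i| := le_abs_self _
    _ ≤ ∑ i, |K i| := Finset.single_le_sum (f := fun i => |K i|) (fun i _ => abs_nonneg _)
        (Finset.mem_univ i)

/-- Bounds on the total torsion of a frame give bounds on its Dirichlet integral. -/
theorem exists_integral_gradient_bound (hX : IsConformalImmersion k α X) (hk : 3 ≤ k) :
    ∃ K : ℝ, 0 ≤ K ∧ ∀ N : Fin n → Plane → Ambient n, IsWeakNormalFrame X N → ∀ σ i c,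
      ∫ w in disc, (weakPartial i (N σ) w c) ^ 2 ≤ totalTorsion X N + K := by
  obtain ⟨K, hK0, hK⟩ := exists_gradient_bound hX hk
  refine ⟨∫ _ in disc, K, integral_nonneg fun _ => hK0, fun N hN σ i c => ?_⟩
  have hpos : ∀ i w, 0 ≤ ∑ σ, ∑ ϑ, torsion N σ ϑ i w ^ 2 := fun i w =>
    Finset.sum_nonneg fun σ _ => Finset.sum_nonneg fun ϑ _ => sq_nonneg _
  calc ∫ w in disc, (weakPartial i (N σ) w c) ^ 2
      ≤ ∫ w in disc, ((∑ σ, ∑ ϑ, torsion N σ ϑ i w ^ 2) + K) := by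
        refine integral_mono_ae (((hN.bddW12 σ).sq i).eval_piLp c).integrable_sq
          ((hN.integrable_sum_torsion_sq i).add (integrable_const K)) ?_
        filter_upwards [hK N hN σ i] with w hw
        calc (weakPartial i (N σ) w c) ^ 2 = ‖weakPartial i (N σ) w c‖ ^ 2 := by
              rw [Real.norm_eq_abs, sq_abs]
          _ ≤ ‖weakPartial i (N σ) w‖ ^ 2 :=
              pow_le_pow_left₀ (norm_nonneg _) (PiLp.norm_apply_le _ c) 2
          _ ≤ _ := hw
          _ ≤ _ := add_le_add (Finset.single_le_sum (f := fun σ => ∑ ϑ, torsion N σ ϑ i w ^ 2)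
              (fun σ _ => Finset.sum_nonneg fun ϑ _ => sq_nonneg _) (Finset.mem_univ σ)) le_rfl
    _ = (∫ w in disc, ∑ σ, ∑ ϑ, torsion N σ ϑ i w ^ 2) + ∫ _ in disc, K :=
        integral_add (hN.integrable_sum_torsion_sq i) (integrable_const K)
    _ ≤ totalTorsion X N + ∫ _ in disc, K := by
        rw [totalTorsion_eq hX hN]
        refine add_le_add ?_ le_rfl
        exact Finset.single_le_sum (f := fun i => ∫ w in disc, ∑ σ, ∑ ϑ, torsion N σ ϑ i w ^ 2)
          (fun i _ => integral_nonneg (hpos i)) (Finset.mem_univ i)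

theorem eLpNorm_two_le {f : Plane → ℝ} (hf : MemLp f 2 (volume.restrict disc)) {A : ℝ}
    (h : ∫ w in disc, f w ^ 2 ≤ A) :
    eLpNorm f 2 (volume.restrict disc) ≤ (Real.toNNReal (√A) : ℝ≥0∞) := by
  rw [hf.eLpNorm_eq_integral_rpow_norm (by norm_num) (by simp)]
  refine ENNReal.ofReal_le_ofReal ?_
  simp only [ENNReal.toReal_ofNat, Real.rpow_two, Real.norm_eq_abs, sq_abs]
  rw [← one_div, ← Real.sqrt_eq_rpow]
  exact Real.sqrt_le_sqrt h

/-- Products of weakly convergent sequences with bounded, a.e. convergent ones. -/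
theorem tendsto_integral_mul_mul {a b : ℕ → Plane → ℝ} {a₀ b₀ T : Plane → ℝ} {A : ℝ}
    (ha : ∀ l, MemLp (a l) 2 (volume.restrict disc)) (hA : ∀ l, ∫ w in disc, a l w ^ 2 ≤ A)
    (hw : ∀ ψ, MemLp ψ 2 (volume.restrict disc) →
      Tendsto (fun l => ∫ w in disc, a l w * ψ w) atTop (𝓝 (∫ w in disc, a₀ w * ψ w)))
    (hb : ∀ l, MemLp (b l) ∞ (volume.restrict disc)) (hb₀ : MemLp b₀ ∞ (volume.restrict disc))
    (hb1 : ∀ l, ∀ᵐ w ∂(volume.restrict disc), |b l w| ≤ 1)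
    (hlim : ∀ᵐ w ∂(volume.restrict disc), Tendsto (fun l => b l w) atTop (𝓝 (b₀ w)))
    (hT : MemLp T 2 (volume.restrict disc)) :
    Tendsto (fun l => ∫ w in disc, a l w * (b l w * T w)) atTop
      (𝓝 (∫ w in disc, a₀ w * (b₀ w * T w))) := by
  have hb₀T : MemLp (fun w => b₀ w * T w) 2 (volume.restrict disc) := hT.mul hb₀
  have hy : ∀ l, MemLp (fun w => (b l w - b₀ w) * T w) 2 (volume.restrict disc) := fun l =>
    hT.mul ((hb l).sub hb₀)
  have hysq : Tendsto (fun l => ∫ w in disc, ((b l w - b₀ w) * T w) ^ 2) atTop (𝓝 0) := by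
    have := tendsto_integral_of_dominated_convergence (μ := volume.restrict disc)
      (F := fun l w => ((b l w - b₀ w) * T w) ^ 2) (f := fun _ => 0) (fun w => 4 * T w ^ 2)
      (fun l => (hy l).aestronglyMeasurable.pow 2) (hT.integrable_sq.const_mul 4) (fun l => ?_) ?_
    · simpa using this
    · filter_upwards [ae_all_iff.mpr hb1, hlim] with w h1 h2
      have h3 : |b₀ w| ≤ 1 := le_of_tendsto h2.abs (Eventually.of_forall h1)
      have h4 : |b l w - b₀ w| ≤ 2 := (abs_sub _ _).trans (by linarith [h1 l])
      have h5 : (b l w - b₀ w) ^ 2 ≤ 2 ^ 2 := sq_le_sq' (abs_le.mp h4).1 (abs_le.mp h4).2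
      rw [Real.norm_of_nonneg (sq_nonneg _), mul_pow]
      nlinarith [sq_nonneg (T w)]
    · filter_upwards [hlim] with w h2
      have := ((h2.sub_const (b₀ w)).mul_const (T w)).pow 2
      simpa using this
  have hsmall : Tendsto (fun l => ∫ w in disc, a l w * ((b l w - b₀ w) * T w)) atTop (𝓝 0) := by
    have hub : ∀ l, ‖∫ w in disc, a l w * ((b l w - b₀ w) * T w)‖
        ≤ √A * √(∫ w in disc, ((b l w - b₀ w) * T w) ^ 2) := by
      intro l
      have h2 : ENNReal.ofReal 2 = 2 := by simp
      have hH := integral_mul_norm_le_Lp_mul_Lq (μ := volume.restrict disc)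
        (Real.HolderConjugate.two_two) (f := a l) (g := fun w => (b l w - b₀ w) * T w)
        (by rw [h2]; exact ha l) (by rw [h2]; exact hy l)
      simp only [Real.rpow_two, Real.norm_eq_abs, sq_abs, ← Real.sqrt_eq_rpow] at hH
      refine (norm_integral_le_integral_norm _).trans ?_
      simp only [norm_mul, Real.norm_eq_abs] at hH ⊢
      simp only [abs_mul] at hH
      exact hH.trans (mul_le_mul_of_nonneg_right (Real.sqrt_le_sqrt (hA l)) (Real.sqrt_nonneg _))
    refine squeeze_zero_norm hub ?_
    have := (hysq.sqrt).const_mul (√A)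
    simpa using this
  have h0 := (hw _ hb₀T).add hsmall
  rw [add_zero] at h0
  refine h0.congr fun l => ?_
  rw [← integral_add (integrableOn_mul_of_memLp_two (ha l) hb₀T)
    (integrableOn_mul_of_memLp_two (ha l) (hy l))]
  exact integral_congr_ae (Eventually.of_forall fun w => by beta_reduce; ring)

theorem IsWeakNormalFrame.abs_apply_le_one (hN : IsWeakNormalFrame X N) (σ : Fin n)
    (c : Fin (n + 2)) : ∀ᵐ w ∂(volume.restrict disc), |N σ w c| ≤ 1 := by
  filter_upwards [hN.orthonormal] with w hw
  exact (PiLp.norm_apply_le (N σ w) c).trans (hw.1 σ).le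

/-- Sequential compactness of sets of weak normal frames with bounded total torsion, together with
lower semicontinuity of the total torsion. The torsion coefficients of the limit pair a weakly
convergent factor `∂_i N_σ` with a bounded, a.e. convergent factor `N_ϑ`. -/
theorem exists_limit_frame (hX : IsConformalImmersion k α X) (hk : 3 ≤ k)
    {M : ℕ → Fin n → Plane → Ambient n} (hM : ∀ l, IsWeakNormalFrame X (M l)) {I : ℝ}
    (hI : Tendsto (fun l => totalTorsion X (M l)) atTop (𝓝 I)) :
    ∃ N, IsWeakNormalFrame X N ∧ totalTorsion X N ≤ I := by
  obtain ⟨K, hK0, hK⟩ := exists_integral_gradient_bound hX hk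
  obtain ⟨B, hB⟩ := hI.bddAbove_range
  have hA : ∀ l σ i c, ∫ w in disc, (weakPartial i (M l σ) w c) ^ 2 ≤ B + K := fun l σ i c =>
    (hK (M l) (hM l) σ i c).trans (add_le_add (hB ⟨l, rfl⟩) le_rfl)
  have hbdd : ∀ l σ c, BddW12 (fun w => M l σ w c) (fun i w => weakPartial i (M l σ) w c) :=
    fun l σ c => bddW12_euclidean_iff.mp ((hM l).bddW12 σ) c
  obtain ⟨s, hs, hQ⟩ := exists_common_subseq (ι := Fin n × Fin (n + 2))
    (fun j s => ∃ (g : Plane → ℝ) (g' : Fin 2 → Plane → ℝ), BddW12 g g' ∧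
      (∀ᵐ w ∂(volume.restrict disc), Tendsto (fun l => M (s l) j.1 w j.2) atTop (𝓝 (g w))) ∧
      ∀ i ψ, MemLp ψ 2 (volume.restrict disc) →
        Tendsto (fun l => ∫ w in disc, weakPartial i (M (s l) j.1) w j.2 * ψ w) atTop
          (𝓝 (∫ w in disc, g' i w * ψ w))) (by
      rintro ⟨σ, c⟩ s hs
      exact exists_rellich_subseq zero_le_one (fun l => hbdd (s l) σ c)
        (fun l => (hM (s l)).abs_apply_le_one σ c)
        (fun l i => eLpNorm_two_le ((hbdd (s l) σ c).sq i) (hA (s l) σ i c))) (by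
      rintro j s t ht ⟨g, g', h1, h2, h3⟩
      exact ⟨g, g', h1, h2.mono fun w hw => hw.comp ht.tendsto_atTop,
        fun i ψ hψ => (h3 i ψ hψ).comp ht.tendsto_atTop⟩)
  choose g g' hg hae hweak using hQ
  set N : Fin n → Plane → Ambient n := fun σ w => WithLp.toLp 2 fun c => g (σ, c) w with hNdef
  set N' : Fin n → Fin 2 → Plane → Ambient n :=
    fun σ i w => WithLp.toLp 2 fun c => g' (σ, c) i w with hN'def
  have hNb : ∀ σ, BddW12 (N σ) (N' σ) := fun σ => bddW12_euclidean_iff.mpr fun c => hg (σ, c)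
  have hconv : ∀ᵐ w ∂(volume.restrict disc), ∀ σ,
      Tendsto (fun l => M (s l) σ w) atTop (𝓝 (N σ w)) := by
    filter_upwards [ae_all_iff.mpr hae] with w hw σ
    have h1 : Tendsto (fun l => (M (s l) σ w).ofLp) atTop (𝓝 fun c => g (σ, c) w) :=
      tendsto_pi_nhds.mpr fun c => hw (σ, c)
    exact ((PiLp.continuous_toLp 2 fun _ : Fin (n + 2) => ℝ).tendsto _).comp h1
  have hN : IsWeakNormalFrame X N := by
    refine isWeakNormalFrame_of hX hNb ?_ ?_ ?_
    · filter_upwards [hconv, ae_all_iff.mpr fun l => (hM (s l)).orthonormal] with w h1 h2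
      rw [orthonormal_iff_ite]
      intro σ ϑ
      refine tendsto_nhds_unique ((h1 σ).inner (h1 ϑ)) ?_
      exact tendsto_const_nhds.congr fun l => (orthonormal_iff_ite.mp (h2 l) σ ϑ).symm
    · filter_upwards [hconv, ae_all_iff.mpr fun l => (hM (s l)).mem_normalSpace] with w h1 h2 σ
      rw [mem_normalSpace_iff]
      intro i
      refine tendsto_nhds_unique ((tendsto_const_nhds (x := tangent X i w)).inner (h1 σ)) ?_
      exact tendsto_const_nhds.congr fun l => (mem_normalSpace_iff.mp (h2 l σ) i).symm
    -- only `det ≥ 0` survives in the limit; it cannot vanish on an adapted frame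
    · filter_upwards [hconv, ae_all_iff.mpr fun l => (hM (s l)).oriented] with w h1 h2
      have h3 : Tendsto (fun l => Matrix.of fun r c => columns X w (fun σ => M (s l) σ w) c r)
          atTop (𝓝 (Matrix.of fun r c => columns X w (fun σ => N σ w) c r)) := by
        refine tendsto_pi_nhds.mpr fun r => tendsto_pi_nhds.mpr fun c => ?_
        refine Fin.cases ?_ (fun c => Fin.cases ?_ (fun c => ?_) c) c
        · exact tendsto_const_nhds
        · exact tendsto_const_nhds
        · exact ((EuclideanSpace.proj r : Ambient n →L[ℝ] ℝ).continuous.tendsto _).comp (h1 c)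
      have h4 := ((continuous_id.matrix_det).tendsto _).comp h3
      exact ge_of_tendsto h4 (Eventually.of_forall fun l => (h2 l).le)
  refine ⟨N, hN, ?_⟩
  have hTlim : ∀ i σ ϑ, Tendsto
      (fun l => ∫ w in disc, torsion (M (s l)) σ ϑ i w * torsion N σ ϑ i w) atTop
      (𝓝 (∫ w in disc, torsion N σ ϑ i w ^ 2)) := by
    intro i σ ϑ
    have hT := hN.memLp_torsion σ ϑ i
    have hMT : ∀ l c, MemLp (fun w => M (s l) ϑ w c * torsion N σ ϑ i w) 2
        (volume.restrict disc) := fun l c => hT.mul (hbdd (s l) ϑ c).bdd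
    have hgT : ∀ c, MemLp (fun w => g (ϑ, c) w * torsion N σ ϑ i w) 2
        (volume.restrict disc) := fun c => hT.mul (hg (ϑ, c)).bdd
    have h1 := tendsto_finsetSum Finset.univ fun c (_ : c ∈ Finset.univ) =>
      tendsto_integral_mul_mul (fun l => (hbdd (s l) σ c).sq i) (fun l => hA (s l) σ i c)
        (hweak (σ, c) i) (fun l => (hbdd (s l) ϑ c).bdd) (hg (ϑ, c)).bdd
        (fun l => (hM (s l)).abs_apply_le_one ϑ c) (hae (ϑ, c)) hT
    have h2 : ∀ l, ∑ c, ∫ w in disc, weakPartial i (M (s l) σ) w c * (M (s l) ϑ w c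
        * torsion N σ ϑ i w) = ∫ w in disc, torsion (M (s l)) σ ϑ i w * torsion N σ ϑ i w := by
      intro l
      rw [← integral_finsetSum _ fun c _ => integrableOn_mul_of_memLp_two
        ((hbdd (s l) σ c).sq i) (hMT l c)]
      refine integral_congr_ae (Eventually.of_forall fun w => ?_)
      have h4 : torsion (M (s l)) σ ϑ i w
          = ∑ c, weakPartial i (M (s l) σ) w c * M (s l) ϑ w c := inner_eq_sum _ _
      beta_reduce
      rw [h4, Finset.sum_mul]
      exact Finset.sum_congr rfl fun c _ => (mul_assoc _ _ _).symm
    have h3 : ∑ c, ∫ w in disc, g' (σ, c) i w * (g (ϑ, c) w * torsion N σ ϑ i w)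
        = ∫ w in disc, torsion N σ ϑ i w ^ 2 := by
      rw [← integral_finsetSum _ fun c _ => integrableOn_mul_of_memLp_two
        ((hg (σ, c)).sq i) (hgT c)]
      refine integral_congr_ae ?_
      filter_upwards [(hNb σ).weakPartial_ae_eq i] with w hw
      have h4 : torsion N σ ϑ i w = ∑ c, g' (σ, c) i w * g (ϑ, c) w := by
        rw [torsion, hw, inner_eq_sum]
      rw [sq]
      nth_rw 2 [h4]
      rw [Finset.sum_mul]
      exact Finset.sum_congr rfl fun c _ => (mul_assoc _ _ _).symm
    rw [h3] at h1
    exact h1.congr h2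
  -- `T_l² ≥ 2 T_l T - T²`
  have hlow : ∀ l, 2 * (∑ i, ∑ σ, ∑ ϑ,
      ∫ w in disc, torsion (M (s l)) σ ϑ i w * torsion N σ ϑ i w) - totalTorsion X N
        ≤ totalTorsion X (M (s l)) := by
    intro l
    rw [totalTorsion_eq_sum hX N, totalTorsion_eq_sum hX (M (s l))]
    simp only [Finset.mul_sum, ← Finset.sum_sub_distrib]
    refine Finset.sum_le_sum fun i _ => Finset.sum_le_sum fun σ _ => Finset.sum_le_sum fun ϑ _ => ?_
    have i1 := integrableOn_mul_of_memLp_two ((hM (s l)).memLp_torsion σ ϑ i)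
      (hN.memLp_torsion σ ϑ i)
    have i2 := hN.integrable_torsion_sq σ ϑ i
    rw [← integral_const_mul, ← integral_sub (i1.const_mul 2) i2]
    refine integral_mono ((i1.const_mul 2).sub i2) ((hM (s l)).integrable_torsion_sq σ ϑ i)
      fun w => ?_
    beta_reduce
    nlinarith [sq_nonneg (torsion (M (s l)) σ ϑ i w - torsion N σ ϑ i w)]
  have hlim2 := ((tendsto_finsetSum Finset.univ fun i (_ : i ∈ Finset.univ) =>
    tendsto_finsetSum Finset.univ fun σ (_ : σ ∈ Finset.univ) =>
      tendsto_finsetSum Finset.univ fun ϑ (_ : ϑ ∈ Finset.univ) => hTlim i σ ϑ).const_mul 2)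
        |>.sub_const (totalTorsion X N)
  have hfin := le_of_tendsto_of_tendsto' hlim2 (hI.comp hs.tendsto_atTop) hlow
  rw [← totalTorsion_eq_sum hX N] at hfin
  linarith

/-- The direct method: a minimizing sequence subconverges to a minimizer of the total torsion. -/
theorem exists_minimizer (hn : 1 ≤ n) (hX : IsConformalImmersion k α X) (hk : 3 ≤ k) :
    ∃ N : Fin n → Plane → Ambient n, IsWeakNormalFrame X N ∧
      ∀ M, IsWeakNormalFrame X M → totalTorsion X N ≤ totalTorsion X M := by
  set S : Set ℝ := {t | ∃ M : Fin n → Plane → Ambient n,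
    IsWeakNormalFrame X M ∧ totalTorsion X M = t} with hS
  have hne : S.Nonempty := by
    obtain ⟨M, hM⟩ := exists_weakNormalFrame hn hX hk
    exact ⟨_, M, hM, rfl⟩
  have hbelow : BddBelow S := ⟨0, by
    rintro _ ⟨M, hM, rfl⟩
    exact totalTorsion_nonneg hX M⟩
  obtain ⟨u, -, hu, huS⟩ := exists_seq_tendsto_sInf hne hbelow
  choose M hM hMu using huS
  obtain ⟨N, hN, hle⟩ := exists_limit_frame hX hk hM (hu.congr fun l => (hMu l).symm)
  exact ⟨N, hN, fun P hP => hle.trans (csInf_le hbelow ⟨P, hP, rfl⟩)⟩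

end CoulombFrame

end

theorem proposition4p1 (n : ℕ) (hn : 1 ≤ n) (k : ℕ) (hk : 3 ≤ k) (α : ℝ≥0) (hα₀ : 0 < α)
    (hα₁ : α < 1) (X : CoulombFrame.Plane → CoulombFrame.Ambient n)
    (hX : CoulombFrame.IsConformalImmersion k α X) :
    ∃ N : Fin n → CoulombFrame.Plane → CoulombFrame.Ambient n,
      CoulombFrame.IsWeakNormalCoulombFrame X N ∧
      CoulombFrame.SolvesWeakEulerLagrange N ∧
      ∀ M : Fin n → CoulombFrame.Plane → CoulombFrame.Ambient n,
        CoulombFrame.IsWeakNormalFrame X M →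
          CoulombFrame.totalTorsion X N ≤ CoulombFrame.totalTorsion X M := by
  obtain ⟨N, hN, hmin⟩ := CoulombFrame.exists_minimizer hn hX hk
  have hcrit := CoulombFrame.isCritical_of_minimal hX hN hmin
  exact ⟨N, ⟨hN, hcrit⟩, CoulombFrame.solvesWeakEulerLagrange_of_critical hX hN hcrit, hmin⟩
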